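/- Let $n,r,p,d$ be natural numbers with $p\ge 1$ and $r=pd$, let $\xi\in\mathbb C$ be a primitive $p$th root of unity, $0\ne q\in\mathbb C$, and let $u_1,\dots,u_r,v_0,\dots,v_{d-1}\in\mathbb C$ satisfy $$(X-u_1)\cdots(X-u_r)=(X^p-v_0^p)\cdots(X^p-v_{d-1}^p)\quad\text{in }\mathbb C[X],\qquad v_i^p\neq v_j^p\ \text{ for } i\ne j .$$ Let $\mathcal H=\mathcal H_{r,1,n}(u_1,\dots,u_r,q)$ be the $\mathbb C$-algebra generated by $T_1,\dots,T_n$ with relations $T_iT_j=T_jT_i$ ($|i-j|>1$), $T_iT_{i+1}T_i=T_{i+1}T_iT_{i+1}$ ($2\le i\le n-1$), $T_1T_2T_1T_2=T_2T_1T_2T_1$, $(T_1-u_1)\cdots(T_1-u_r)=0$ and $(T_i-1)(T_i+q)=0$ ($2\le i\le n$), and suppose that $\mathcal H$ is semisimple. Let $\tau$ be the automorphism of $\mathcal H$ with $\tau(T_1)=\xi T_1$ and $\tau(T_i)=T_i$ for $2\le i\le n$. For an $\mathcal H$-module $N$ let ${}^{\tau}N$ be the vector space $N$ on which $h\in\mathcal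 H$ acts as $\tau^{-1}(h)$. Consider $r$-tuples $\lambda=(\lambda^i_j)_{i\in\mathbb Z/p,\,0\le j<d}$ of Young diagrams with $n$ cells altogether, and put $\mathrm{shift}(\lambda)=(\lambda^{i+1}_j)_{i,j}$. A standard tableau $\mathbb T$ of shape $\lambda$ is a bijection from $\{1,\dots,n\}$ to the cells of $\lambda$ that increases along rows and down columns of each diagram. Given an ordering $(u_{i,j})_{i\in\mathbb Z/p,\,0\le j<d}$ of $u_1,\dots,u_r$, let $V(\lambda)$ denote the $\mathcal H$-module of Ariki and Koike: it has a basis $v(\mathbb T)$ indexed by the standard tableaux of shape $\lambda$, $T_1v(\mathbb T)=u_{i,j}v(\mathbb T)$ if $1$ lies in $\lambda^i_j$, and for $2\le k\le n$ $$T_k v(\mathbb T)=a\,v(\mathbb T)+(a+q)\,v(\mathbb T'),$$ where $\mathbb T'$ is $\mathbb T$ with $k-1,k$ exchanged and $v(\mathbb T')=0$ if $\mathbb T'$ is not standard. Here, if $k-1$ and $k$ lie in diagrams with parameters $w,w'$, in cells with contents (column minus row) $c,c'$, then $a=\dfrac{(1-q)\,w'q^{-c'}}{w'q^{-c'}-wq^{-c}}$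 if the two diagrams have different indices, while $a=\dfrac{1-q}{1-q^{\,c'-c}}$ (read as $\dfrac1{c'-c}$ for $q=1$) if they lie in the same diagram. Theorem. There is an ordering of the $u$'s, namely one with $u_{i,j}=\xi^{-i}v_j$ for all $i,j$, such that every $V(\lambda)$ exists and is simple, every simple $\mathcal H$-module is isomorphic to $V(\lambda)$ for exactly one $\lambda$ (so that $\mathrm{shift}$ acts on isomorphism classes of simple $\mathcal H$-modules by $V(\lambda)\mapsto V(\mathrm{shift}(\lambda))$), and $$\tau\circ\mathrm{shift}=1\ \text{ on the simple } \mathcal H\text{-modules, i.e. } {}^{\tau}V(\mathrm{shift}(\lambda))\cong V(\lambda)\ \text{ for every } \lambda .$$ -/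

import Mathlib

/-! ### The cyclotomic Hecke algebra -/

/-- Defining relations of the cyclotomic Hecke algebra `H_{r,1,n}(u₁, …, u_r, q)` on free generators
`T₁, …, T_n`. The generators are indexed from `0` here: `T₁` has index `0`, and the generator with
index `i ≥ 1` belongs to the transposition of the neighbouring letters `i - 1` and `i`. -/
inductive HeckeRel (n : ℕ) {r : ℕ} (u : Fin r → ℂ) (q : ℂ) :
    FreeAlgebra ℂ (Fin n) → FreeAlgebra ℂ (Fin n) → Prop
  | comm (i j : Fin n) (h : i.val + 1 < j.val) :
      HeckeRel n u q (FreeAlgebra.ι ℂ i * FreeAlgebra.ι ℂ j)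
        (FreeAlgebra.ι ℂ j * FreeAlgebra.ι ℂ i)
  | braid (i j : Fin n) (hi : 1 ≤ i.val) (h : i.val + 1 = j.val) :
      HeckeRel n u q (FreeAlgebra.ι ℂ i * FreeAlgebra.ι ℂ j * FreeAlgebra.ι ℂ i)
        (FreeAlgebra.ι ℂ j * FreeAlgebra.ι ℂ i * FreeAlgebra.ι ℂ j)
  | braid_four (i j : Fin n) (hi : i.val = 0) (hj : j.val = 1) :
      HeckeRel n u q
        (FreeAlgebra.ι ℂ i * FreeAlgebra.ι ℂ j * FreeAlgebra.ι ℂ i * FreeAlgebra.ι ℂ j)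
        (FreeAlgebra.ι ℂ j * FreeAlgebra.ι ℂ i * FreeAlgebra.ι ℂ j * FreeAlgebra.ι ℂ i)
  | cyclotomic (i : Fin n) (hi : i.val = 0) :
      HeckeRel n u q
        (Polynomial.aeval (FreeAlgebra.ι ℂ i)
          (∏ k : Fin r, (Polynomial.X - Polynomial.C (u k)))) 0
  | quadratic (i : Fin n) (hi : 1 ≤ i.val) :
      HeckeRel n u q
        ((FreeAlgebra.ι ℂ i - 1) * (FreeAlgebra.ι ℂ i + algebraMap ℂ _ q)) 0

/-- The cyclotomic Hecke algebra `H_{r,1,n}(u₁, …, u_r, q)` over `ℂ`. -/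
abbrev CycHecke (n : ℕ) {r : ℕ} (u : Fin r → ℂ) (q : ℂ) : Type :=
  RingQuot (HeckeRel n u q)

namespace CycHecke

/-- The generators of the cyclotomic Hecke algebra. -/
noncomputable def gen (n : ℕ) {r : ℕ} (u : Fin r → ℂ) (q : ℂ) (i : Fin n) : CycHecke n u q :=
  RingQuot.mkAlgHom ℂ (HeckeRel n u q) (FreeAlgebra.ι ℂ i)

/-- The effect on generators of `T₁ ↦ ζ T₁`, `T_i ↦ T_i` for the other indices. -/
noncomputable def scaleGen (n : ℕ) {r : ℕ} (u : Fin r → ℂ) (q ζ : ℂ) (i : Fin n) :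
    CycHecke n u q :=
  if i.val = 0 then ζ • gen n u q i else gen n u q i

theorem scaleGen_rel (n : ℕ) {r p d : ℕ} (u : Fin r → ℂ) (v : Fin d → ℂ) (q ζ : ℂ)
    (hζ : ζ ^ p = 1)
    (huv : ∏ k : Fin r, (Polynomial.X - Polynomial.C (u k)) =
      ∏ l : Fin d, (Polynomial.X ^ p - Polynomial.C (v l ^ p)))
    {x y : FreeAlgebra ℂ (Fin n)} (h : HeckeRel n u q x y) :
    FreeAlgebra.lift ℂ (scaleGen n u q ζ) x = FreeAlgebra.lift ℂ (scaleGen n u q ζ) y := by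
  have key := RingQuot.mkAlgHom_rel ℂ h
  cases h with
  | comm i j h =>
    have hj : j.val ≠ 0 := by omega
    simp only [map_mul] at key
    simp only [map_mul, FreeAlgebra.lift_ι_apply, scaleGen, hj, if_false]
    split_ifs
    · simp only [smul_mul_assoc, mul_smul_comm, gen, key]
    · exact key
  | braid i j hi h =>
    have hi' : i.val ≠ 0 := by omega
    have hj : j.val ≠ 0 := by omega
    simp only [map_mul] at key
    simp only [map_mul, FreeAlgebra.lift_ι_apply, scaleGen, hj, hi', if_false]
    exact key
  | braid_four i j hi hj =>
    have hj : j.val ≠ 0 := by omega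
    simp only [map_mul] at key
    simp only [map_mul, FreeAlgebra.lift_ι_apply, scaleGen, hj, hi, if_false, if_true]
    simp only [smul_mul_assoc, mul_smul_comm, gen, key]
  | cyclotomic i hi =>
    rw [huv, map_zero, ← Polynomial.aeval_algHom_apply] at key
    rw [huv, map_zero, ← Polynomial.aeval_algHom_apply]
    simp only [FreeAlgebra.lift_ι_apply, scaleGen, hi, if_true]
    rw [← key]
    have hexp : ∏ l : Fin d, (Polynomial.X ^ p - Polynomial.C (v l ^ p)) =
        Polynomial.expand ℂ p (∏ l : Fin d, (Polynomial.X - Polynomial.C (v l ^ p))) := by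
      rw [map_prod]
      simp only [map_sub, Polynomial.expand_X, Polynomial.expand_C]
    rw [hexp, Polynomial.expand_aeval, Polynomial.expand_aeval, smul_pow, hζ, one_smul]
    rfl
  | quadratic i hi =>
    have hi' : i.val ≠ 0 := by omega
    simp only [map_mul, map_zero, map_sub, map_add, map_one, AlgHom.commutes] at key
    simp only [map_mul, map_zero, map_sub, map_add, map_one, AlgHom.commutes,
      FreeAlgebra.lift_ι_apply, scaleGen, hi', if_false]
    exact key

/-- The algebra endomorphism `T₁ ↦ ζ T₁`, `T_i ↦ T_i` (`2 ≤ i ≤ n`), where `ζ ^ p = 1` and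
`∏ (X - u_k) = ∏ (X ^ p - v_l ^ p)`. -/
noncomputable def scaleHom (n : ℕ) {r p d : ℕ} (u : Fin r → ℂ) (v : Fin d → ℂ) (q ζ : ℂ)
    (hζ : ζ ^ p = 1)
    (huv : ∏ k : Fin r, (Polynomial.X - Polynomial.C (u k)) =
      ∏ l : Fin d, (Polynomial.X ^ p - Polynomial.C (v l ^ p))) :
    CycHecke n u q →ₐ[ℂ] CycHecke n u q :=
  RingQuot.liftAlgHom ℂ ⟨FreeAlgebra.lift ℂ (scaleGen n u q ζ),
    fun {_ _} h => scaleGen_rel n u v q ζ hζ huv h⟩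

theorem scaleHom_gen (n : ℕ) {r p d : ℕ} (u : Fin r → ℂ) (v : Fin d → ℂ) (q ζ : ℂ)
    (hζ : ζ ^ p = 1)
    (huv : ∏ k : Fin r, (Polynomial.X - Polynomial.C (u k)) =
      ∏ l : Fin d, (Polynomial.X ^ p - Polynomial.C (v l ^ p))) (i : Fin n) :
    scaleHom n u v q ζ hζ huv (gen n u q i) =
      if i.val = 0 then ζ • gen n u q i else gen n u q i := by
  simp [scaleHom, gen, scaleGen]

theorem scaleHom_comp (n : ℕ) {r p d : ℕ} (u : Fin r → ℂ) (v : Fin d → ℂ) (q ζ ζ' : ℂ)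
    (hζ : ζ ^ p = 1) (hζ' : ζ' ^ p = 1) (h : ζ * ζ' = 1)
    (huv : ∏ k : Fin r, (Polynomial.X - Polynomial.C (u k)) =
      ∏ l : Fin d, (Polynomial.X ^ p - Polynomial.C (v l ^ p))) :
    (scaleHom n u v q ζ hζ huv).comp (scaleHom n u v q ζ' hζ' huv) = AlgHom.id ℂ _ := by
  apply RingQuot.ringQuot_ext'
  apply FreeAlgebra.hom_ext
  funext i
  change scaleHom n u v q ζ hζ huv (scaleHom n u v q ζ' hζ' huv (gen n u q i)) = gen n u q i
  rw [scaleHom_gen]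
  split_ifs with hi
  · rw [map_smul, scaleHom_gen, if_pos hi, smul_smul, mul_comm, h, one_smul]
  · rw [scaleHom_gen, if_neg hi]

/-- The automorphism `τ` of `H_{r,1,n}(u₁, …, u_r, q)`: `τ(T₁) = ξ T₁` and `τ(T_i) = T_i` for
`2 ≤ i ≤ n`. -/
noncomputable def tau (n : ℕ) {r p d : ℕ} [NeZero p] (u : Fin r → ℂ) (v : Fin d → ℂ) (q ξ : ℂ)
    (hξ : IsPrimitiveRoot ξ p)
    (huv : ∏ k : Fin r, (Polynomial.X - Polynomial.C (u k)) =
      ∏ l : Fin d, (Polynomial.X ^ p - Polynomial.C (v l ^ p))) :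
    CycHecke n u q ≃ₐ[ℂ] CycHecke n u q :=
  AlgEquiv.ofAlgHom
    (scaleHom n u v q ξ hξ.pow_eq_one huv)
    (scaleHom n u v q ξ⁻¹ (by rw [inv_pow, hξ.pow_eq_one, inv_one]) huv)
    (scaleHom_comp n u v q ξ ξ⁻¹ _ _ (mul_inv_cancel₀ (hξ.ne_zero (NeZero.ne p))) huv)
    (scaleHom_comp n u v q ξ⁻¹ ξ _ _ (inv_mul_cancel₀ (hξ.ne_zero (NeZero.ne p))) huv)

theorem tau_gen (n : ℕ) {r p d : ℕ} [NeZero p] (u : Fin r → ℂ) (v : Fin d → ℂ) (q ξ : ℂ)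
    (hξ : IsPrimitiveRoot ξ p)
    (huv : ∏ k : Fin r, (Polynomial.X - Polynomial.C (u k)) =
      ∏ l : Fin d, (Polynomial.X ^ p - Polynomial.C (v l ^ p))) (i : Fin n) :
    tau n u v q ξ hξ huv (gen n u q i) =
      if i.val = 0 then ξ • gen n u q i else gen n u q i :=
  scaleHom_gen n u v q ξ _ huv i

end CycHecke

/-! ### Twisting modules by automorphisms -/

/-- The twisted module `^σN`: the vector space `N` with `a` acting as `σ⁻¹(a)`. -/
def TwistedModule {A : Type*} [Ring A] [Algebra ℂ A] (_σ : A ≃ₐ[ℂ] A) (N : Type*) : Type _ := N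

namespace TwistedModule

instance {A : Type*} [Ring A] [Algebra ℂ A] (σ : A ≃ₐ[ℂ] A) (N : Type*) [AddCommGroup N] :
    AddCommGroup (TwistedModule σ N) :=
  inferInstanceAs (AddCommGroup N)

instance {A : Type*} [Ring A] [Algebra ℂ A] (σ : A ≃ₐ[ℂ] A) (N : Type*) [AddCommGroup N]
    [Module A N] : Module A (TwistedModule σ N) :=
  Module.compHom N (σ.symm : A →+* A)

end TwistedModule

/-! ### Tuples of Young diagrams, standard tableaux, shift -/

/-- Tuples of Young diagrams, indexed by `ι`, with `n` cells altogether. -/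
abbrev MultiPartition (ι : Type) [Fintype ι] (n : ℕ) : Type :=
  {lam : ι → YoungDiagram // ∑ x, (lam x).card = n}

/-- The cells of a tuple of Young diagrams: the index of the diagram, then row and column. -/
abbrev MultiCell {ι : Type} (lam : ι → YoungDiagram) : Type :=
  {c : ι × ℕ × ℕ // c.2 ∈ lam c.1}

/-- A bijection from the letters to the cells is standard if the letters increase along the rows and
down the columns of every diagram. -/
def IsStandard {ι : Type} {n : ℕ} {lam : ι → YoungDiagram} (t : Fin n ≃ MultiCell lam) : Prop :=
  ∀ a b : Fin n, (t a).1.1 = (t b).1.1 → (t a).1.2 ≤ (t b).1.2 → a ≤ b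

/-- Standard tableaux of shape `lam`. -/
abbrev StdTableau {ι : Type} (lam : ι → YoungDiagram) (n : ℕ) : Type :=
  {t : Fin n ≃ MultiCell lam // IsStandard t}

/-- The content `column - row` of a cell. -/
def cellContent {ι : Type} {lam : ι → YoungDiagram} (c : MultiCell lam) : ℤ :=
  (c.1.2.2 : ℤ) - (c.1.2.1 : ℤ)

/-- Ariki's shift operator `shift(λ) = (λ_j^{i+1})`, the upper index being taken modulo `p`. -/
def shift {p d n : ℕ} [NeZero p] (lam : MultiPartition (ZMod p × Fin d) n) :
    MultiPartition (ZMod p × Fin d) n :=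
  ⟨fun x => lam.1 (x.1 + 1, x.2), by
    refine Eq.trans ?_ lam.2
    exact Equiv.sum_comp ((Equiv.addRight (1 : ZMod p)).prodCongr (Equiv.refl (Fin d)))
      (fun x => (lam.1 x).card)⟩

/-! ### The modules `V(λ)` of Ariki and Koike -/

/-- The `q`-integer `[m] = (1 - q ^ m) / (1 - q)`, which is `m` for `q = 1`. -/
noncomputable def qInteger (q : ℂ) (m : ℤ) : ℂ :=
  open Classical in if q = 1 then (m : ℂ) else (1 - q ^ m) / (1 - q)

/-- The diagonal coefficient of the generator exchanging two consecutive letters, the smaller of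
which lies in the cell `x` and the larger in the cell `y`. It is `(1 - q) / (1 - ρ)`, where `ρ` is
the ratio of `w_x q ^ (-content x)` to `w_y q ^ (-content y)` for the parameters `w_x`, `w_y` of the
diagrams in which the cells lie; for cells of the same diagram the parameter cancels. -/
noncomputable def diagCoeff {ι : Type} (w : ι → ℂ) (q : ℂ) {lam : ι → YoungDiagram}
    (x y : MultiCell lam) : ℂ :=
  open Classical in
  if x.1.1 = y.1.1 then (qInteger q (cellContent y - cellContent x))⁻¹
  else (1 - q) * (w y.1.1 * q ^ (-cellContent y)) /
    (w y.1.1 * q ^ (-cellContent y) - w x.1.1 * q ^ (-cellContent x))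

/-- `M` is (a copy of) the `H_{r,1,n}(u₁, …, u_r, q)`-module `V(λ)` attached to the family `lam` of
Young diagrams when the parameters are labelled as `w x` (`x : ι`): `M` has a basis `v(𝕋)` indexed by
the standard tableaux of shape `lam`, such that
* `T₁ v(𝕋) = w_x v(𝕋)`, where the first letter lies in the diagram with index `x`;
* for the other generators `T_i v(𝕋) = a v(𝕋) + (a + q) v(𝕋')`, where `a` is the diagonal coefficient
  and `𝕋'` is `𝕋` with the letters `i - 1` and `i` exchanged; `v(𝕋') = 0` if `𝕋'` is not standard (and
  then `a` is `1` or `-q`, as the two letters are neighbours in a row or in a column). -/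
def IsYoungModule {n r : ℕ} {u : Fin r → ℂ} {q : ℂ} {ι : Type} (w : ι → ℂ)
    (lam : ι → YoungDiagram) (M : Type*) [AddCommGroup M] [Module ℂ M] [Module (CycHecke n u q) M] :
    Prop :=
  open Classical in
  ∃ b : Module.Basis (StdTableau lam n) ℂ M,
    (∀ (t : StdTableau lam n) (i : Fin n), i.val = 0 →
      CycHecke.gen n u q i • b t = w (t.1 i).1.1 • b t) ∧
    (∀ (t : StdTableau lam n) (j i : Fin n), j.val + 1 = i.val →
      CycHecke.gen n u q i • b t =
        diagCoeff w q (t.1 j) (t.1 i) • b t +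
          (diagCoeff w q (t.1 j) (t.1 i) + q) •
            (if h : IsStandard ((Equiv.swap j i).trans t.1)
              then b ⟨(Equiv.swap j i).trans t.1, h⟩ else 0))

/-! Put `w (i, j) = ξ⁻ⁱ v_j`. As `X ^ p - v ^ p` is the product of the `X - ξ⁻ⁱ v`, the `u`'s and
the `w`'s are the same multiset, which gives the ordering. The twist can be read off the bases.
Shifting relabels the tableaux and moves each diagram to a parameter differing by the factor `ξ⁻¹`.
The diagonal coefficients are homogeneous of degree `0` in the parameters, so `T_2, …, T_n` keep
their matrices, while the eigenvalues of `T_1` change by `ξ⁻¹`, exactly as under `τ⁻¹`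
(`nonempty_twistedModule_equiv`). The bulk of the proof is the classification of the simple modules,
for parameters about which only semisimplicity is known.

Semisimplicity makes the parameters generic. If a module carries a nonzero functional that
transforms by a one-dimensional character, then it contains a vector that transforms by the same
character and on which the functional is `1` (`exists_invariant`). For explicit modules of words the
value of the functional on such a vector is a multiple of a product that therefore cannot vanish.
Words without repetition give the `q`-integers up to `n`; words in two letters, with a first
operator having eigenvalues `w x` and `w y`, give `w x ≠ q ^ k * w y` for `k < n`
(`genericParameters_of_isSemisimpleRing`).

For generic parameters no denominator of the seminormal form vanishes, and the relations reduce to a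
three-term identity between diagonal coefficients (`cellDiag_mul`, `heckeOn_seminormal`). The
operators generate all matrix units between standard tableaux of equal shape (`hasMatrixUnits`).
Hence each `V(λ)` is simple, and different shapes have nothing in common.

Completeness is an induction on `n` (`HeckeFamily.span_intertwines`). A seminormal family for level
`n` inside a module for level `n + 1` generates at most `r (n + 1)` times its dimension
(`HeckeFamily.exists_stable`). By `sum_tableauCount_addable` this is the total dimension of the
seminormal forms obtained by adding one cell. Pairing the module with those forms, the dimension
count shows that the generated submodule is the graph of a map from them, so the family is a sum of
seminormal families one level up (`Intertwines.exists_extension`). -/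

/-! ### Families of operators satisfying the Hecke relations -/

/-- The relations of the cyclotomic Hecke algebra with parameters `w` for a family `T` of elements of
an algebra, of which only the members with index less than `n` matter. -/
structure HeckeFamily {A : Type*} [Ring A] [Algebra ℂ A] {ι : Type*} [Fintype ι] (n : ℕ)
    (w : ι → ℂ) (q : ℂ) (T : ℕ → A) : Prop where
  comm : ∀ i j, i + 1 < j → j < n → T i * T j = T j * T i
  braid : ∀ i, 1 ≤ i → i + 1 < n → T i * T (i + 1) * T i = T (i + 1) * T i * T (i + 1)
  braid_four : 1 < n → T 0 * T 1 * T 0 * T 1 = T 1 * T 0 * T 1 * T 0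
  cyclotomic : 0 < n → Polynomial.aeval (T 0) (∏ x, (Polynomial.X - Polynomial.C (w x))) = 0
  quadratic : ∀ i, 1 ≤ i → i < n → T i * T i = (1 - q) • T i + q • (1 : A)

namespace HeckeFamily

variable {A : Type*} [Ring A] [Algebra ℂ A] {ι : Type*} [Fintype ι] {n : ℕ} {w : ι → ℂ} {q : ℂ}
  {T : ℕ → A}

theorem mono (h : HeckeFamily n w q T) {m : ℕ} (hm : m ≤ n) : HeckeFamily m w q T where
  comm i j hij hj := h.comm i j hij (hj.trans_le hm)
  braid i hi hj := h.braid i hi (hj.trans_le hm)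
  braid_four h1 := h.braid_four (h1.trans_le hm)
  cyclotomic h0 := h.cyclotomic (h0.trans_le hm)
  quadratic i hi hj := h.quadratic i hi (hj.trans_le hm)

theorem map {B : Type*} [Ring B] [Algebra ℂ B] (h : HeckeFamily n w q T) (ρ : A →ₐ[ℂ] B) :
    HeckeFamily n w q (fun i => ρ (T i)) where
  comm i j hij hj := by simp only [← map_mul, h.comm i j hij hj]
  braid i hi hj := by simp only [← map_mul, h.braid i hi hj]
  braid_four h1 := by simp only [← map_mul, h.braid_four h1]
  cyclotomic h0 := by rw [Polynomial.aeval_algHom_apply, h.cyclotomic h0, map_zero]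
  quadratic i hi hj := by rw [← map_mul, h.quadratic i hi hj]; simp

/-- The parameters enter the relations only through the polynomial with these roots, so any
labelling of the same multiset is allowed. -/
theorem exists_algHom {r : ℕ} {u : Fin r → ℂ} (h : HeckeFamily n w q T)
    (huw : ∏ k, (Polynomial.X - Polynomial.C (u k)) = ∏ x, (Polynomial.X - Polynomial.C (w x))) :
    ∃ ρ : CycHecke n u q →ₐ[ℂ] A, ∀ i : Fin n, ρ (CycHecke.gen n u q i) = T i := by
  have key : ∀ {x y : FreeAlgebra ℂ (Fin n)}, HeckeRel n u q x y →
      FreeAlgebra.lift ℂ (fun i : Fin n => T i) x = FreeAlgebra.lift ℂ (fun i : Fin n => T i) y := by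
    intro x y hxy
    cases hxy with
    | comm i j hij => simpa using h.comm i j hij j.2
    | braid i j hi hij =>
      have := h.braid i hi (hij ▸ j.2)
      rw [hij] at this
      simpa using this
    | braid_four i j hi hj =>
      have := h.braid_four (hj ▸ j.2)
      simpa [hi, hj] using this
    | cyclotomic i hi =>
      have := h.cyclotomic (hi ▸ i.2)
      rw [← Polynomial.aeval_algHom_apply, FreeAlgebra.lift_ι_apply, hi, huw, this, map_zero]
    | quadratic i hi =>
      have := h.quadratic i hi i.2
      rw [map_mul, map_sub, map_add, FreeAlgebra.lift_ι_apply, map_one, map_zero,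
        AlgHom.commutes, sub_mul, mul_add, this, one_mul, Algebra.algebraMap_eq_smul_one,
        mul_smul_comm, mul_one]
      module
  refine ⟨RingQuot.liftAlgHom ℂ ⟨FreeAlgebra.lift ℂ (fun i : Fin n => T i), fun {_ _} h => key h⟩,
    fun i => ?_⟩
  simp [CycHecke.gen]

end HeckeFamily

/-- The generators of the cyclotomic Hecke algebra, extended by `0`. -/
noncomputable def CycHecke.genNat (n : ℕ) {r : ℕ} (u : Fin r → ℂ) (q : ℂ) (i : ℕ) :
    CycHecke n u q :=
  if h : i < n then CycHecke.gen n u q ⟨i, h⟩ else 0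

theorem CycHecke.genNat_val (n : ℕ) {r : ℕ} (u : Fin r → ℂ) (q : ℂ) (i : Fin n) :
    CycHecke.genNat n u q i = CycHecke.gen n u q i := by
  simp [CycHecke.genNat]

theorem CycHecke.heckeFamily_genNat (n : ℕ) {r : ℕ} (u : Fin r → ℂ) (q : ℂ) {ι : Type*} [Fintype ι]
    (w : ι → ℂ)
    (huw : ∏ k, (Polynomial.X - Polynomial.C (u k)) = ∏ x, (Polynomial.X - Polynomial.C (w x))) :
    HeckeFamily n w q (CycHecke.genNat n u q) where
  comm i j hij hj := by
    have := RingQuot.mkAlgHom_rel ℂ (HeckeRel.comm (u := u) (q := q) ⟨i, by omega⟩ ⟨j, hj⟩ hij)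
    simpa [genNat, gen, hj, show i < n by omega] using this
  braid i hi hj := by
    have := RingQuot.mkAlgHom_rel ℂ (HeckeRel.braid (u := u) (q := q) ⟨i, by omega⟩ ⟨i + 1, hj⟩ hi rfl)
    simpa [genNat, gen, hj, show i < n by omega] using this
  braid_four h1 := by
    have := RingQuot.mkAlgHom_rel ℂ
      (HeckeRel.braid_four (u := u) (q := q) ⟨0, by omega⟩ ⟨1, h1⟩ rfl rfl)
    simpa [genNat, gen, h1, show 0 < n by omega] using this
  cyclotomic h0 := by
    have := RingQuot.mkAlgHom_rel ℂ (HeckeRel.cyclotomic (u := u) (q := q) ⟨0, h0⟩ rfl)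
    rw [huw, ← Polynomial.aeval_algHom_apply, map_zero] at this
    simpa [genNat, gen, h0] using this
  quadratic i hi hj := by
    have := RingQuot.mkAlgHom_rel ℂ (HeckeRel.quadratic (u := u) (q := q) ⟨i, hj⟩ hi)
    simp only [map_mul, map_sub, map_add, map_one, map_zero, AlgHom.commutes] at this
    simp only [genNat, hj, dif_pos, gen]
    rw [sub_mul, mul_add, one_mul, Algebra.algebraMap_eq_smul_one, mul_smul_comm, mul_one] at this
    linear_combination (norm := module) this

theorem CycHecke.adjoin_gen (n : ℕ) {r : ℕ} (u : Fin r → ℂ) (q : ℂ) :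
    Algebra.adjoin ℂ (Set.range (CycHecke.gen n u q)) = ⊤ := by
  have : Set.range (CycHecke.gen n u q) =
      RingQuot.mkAlgHom ℂ (HeckeRel n u q) '' Set.range (FreeAlgebra.ι ℂ) := by
    rw [← Set.range_comp]; rfl
  rw [this, Algebra.adjoin_image, FreeAlgebra.adjoin_range_ι, Algebra.map_top,
    AlgHom.range_eq_top]
  exact RingQuot.mkAlgHom_surjective ℂ _

/-! ### Exchange operators on words -/

section Exchange

variable {C : Type*}

open Finsupp

/-- The operator on words that mixes a word and the word with the letters `i` and `i + 1` exchanged,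
with coefficients depending on these letters. -/
noncomputable def exchange (a b : C → C → ℂ) (i : ℕ) : Module.End ℂ ((ℕ → C) →₀ ℂ) :=
  Finsupp.linearCombination ℂ fun f =>
    a (f i) (f (i + 1)) • single f (1 : ℂ) +
      b (f i) (f (i + 1)) • single (f ∘ Equiv.swap i (i + 1)) (1 : ℂ)

theorem exchange_single (a b : C → C → ℂ) (i : ℕ) (f : ℕ → C) :
    exchange a b i (single f 1) = a (f i) (f (i + 1)) • single f (1 : ℂ) +
      b (f i) (f (i + 1)) • single (f ∘ Equiv.swap i (i + 1)) (1 : ℂ) := by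
  simp [exchange]

theorem comp_swap_swap (f : ℕ → C) (i : ℕ) :
    (f ∘ Equiv.swap i (i + 1)) ∘ Equiv.swap i (i + 1) = f := by
  ext j; simp

theorem exchange_comm_single (a b : C → C → ℂ) {i j : ℕ} (hij : i + 1 < j) (f : ℕ → C) :
    exchange a b i (exchange a b j (single f 1)) = exchange a b j (exchange a b i (single f 1)) := by
  have h1 : Equiv.swap j (j + 1) i = i := Equiv.swap_apply_of_ne_of_ne (by omega) (by omega)
  have h2 : Equiv.swap j (j + 1) (i + 1) = i + 1 :=
    Equiv.swap_apply_of_ne_of_ne (by omega) (by omega)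
  have h3 : Equiv.swap i (i + 1) j = j := Equiv.swap_apply_of_ne_of_ne (by omega) (by omega)
  have h4 : Equiv.swap i (i + 1) (j + 1) = j + 1 :=
    Equiv.swap_apply_of_ne_of_ne (by omega) (by omega)
  have h5 : (f ∘ Equiv.swap j (j + 1)) ∘ Equiv.swap i (i + 1) =
      (f ∘ Equiv.swap i (i + 1)) ∘ Equiv.swap j (j + 1) := by
    ext k
    simp only [Function.comp_apply]
    congr 1
    simp only [Equiv.swap_apply_def]
    split_ifs <;> omega
  simp only [exchange_single, map_add, map_smul, Function.comp_apply, h1, h2, h3, h4, h5]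
  module

theorem exchange_quadratic_single (a b : C → C → ℂ) (q : ℂ) (i : ℕ) (f : ℕ → C)
    (h1 : b (f i) (f (i + 1)) * (a (f i) (f (i + 1)) + a (f (i + 1)) (f i) - (1 - q)) = 0)
    (h2 : b (f i) (f (i + 1)) * b (f (i + 1)) (f i) =
      (a (f i) (f (i + 1)) + q) * (1 - a (f i) (f (i + 1)))) :
    exchange a b i (exchange a b i (single f 1)) =
      (1 - q) • exchange a b i (single f 1) + q • single f 1 := by
  simp only [exchange_single, map_add, map_smul, Function.comp_apply, comp_swap_swap,
    Equiv.swap_apply_left, Equiv.swap_apply_right]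
  linear_combination (norm := module) h1 • (single (f ∘ Equiv.swap i (i + 1)) (1 : ℂ)) +
    h2 • (single f (1 : ℂ))

/-- Both sides are combinations of the six rearrangements of three letters. `h1`, `h2`, `h3` compare
the coefficients of the words with the first pair exchanged, with the second pair exchanged, and of
`f` itself; the other three agree identically. -/
theorem exchange_braid_single (a b : C → C → ℂ) (i : ℕ) (f : ℕ → C) {x y z : C}
    (hx : f i = x) (hy : f (i + 1) = y) (hz : f (i + 2) = z)
    (h1 : b x y * (a x y * a y z + a x z * a y x - a y z * a x z) = 0)
    (h2 : b y z * (a x y * a x z - a x z * a z y - a y z * a x y) = 0)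
    (h3 : a x y ^ 2 * a y z + a x z * (b x y * b y x) =
      a y z ^ 2 * a x y + a x z * (b y z * b z y)) :
    exchange a b i (exchange a b (i + 1) (exchange a b i (single f 1))) =
      exchange a b (i + 1) (exchange a b i (exchange a b (i + 1) (single f 1))) := by
  have s1 : Equiv.swap i (i + 1) (i + 2) = i + 2 :=
    Equiv.swap_apply_of_ne_of_ne (by omega) (by omega)
  have s2 : Equiv.swap (i + 1) (i + 2) i = i :=
    Equiv.swap_apply_of_ne_of_ne (by omega) (by omega)
  have s3 : ((f ∘ Equiv.swap i (i + 1)) ∘ Equiv.swap (i + 1) (i + 2)) ∘ Equiv.swap i (i + 1) =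
      ((f ∘ Equiv.swap (i + 1) (i + 2)) ∘ Equiv.swap i (i + 1)) ∘ Equiv.swap (i + 1) (i + 2) := by
    have p1 := Equiv.swap_mul_swap_mul_swap (x := i + 2) (y := i + 1) (z := i) (by omega) (by omega)
    have p2 := Equiv.swap_mul_swap_mul_swap (x := i) (y := i + 1) (z := i + 2) (by omega) (by omega)
    rw [Equiv.swap_comm (i + 1) i, Equiv.swap_comm (i + 2) (i + 1)] at p1
    have p3 := p1.trans ((Equiv.swap_comm _ _).trans p2.symm)
    ext k
    exact congrArg f (DFunLike.congr_fun p3 k)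
  have s4 := comp_swap_swap f i
  have s5 := comp_swap_swap f (i + 1)
  simp only [show i + 1 + 1 = i + 2 by omega] at s5
  have s6 := comp_swap_swap (f ∘ Equiv.swap i (i + 1)) (i + 1)
  simp only [show i + 1 + 1 = i + 2 by omega] at s6
  simp only [exchange_single, map_add, map_smul, Function.comp_apply, s1, s2, s3, s4, s5,
    show i + 1 + 1 = i + 2 by omega, Equiv.swap_apply_left, Equiv.swap_apply_right, hx, hy, hz]
  linear_combination (norm := module) h1 • (single (f ∘ Equiv.swap i (i + 1)) (1 : ℂ)) +
    h2 • (single (f ∘ Equiv.swap (i + 1) (i + 2)) (1 : ℂ)) + h3 • (single f (1 : ℂ))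

end Exchange

/-! ### Semisimplicity restricts the parameters -/

/-- The conditions on the parameters under which `H_{r,1,n}` has a seminormal form: the `q`-integers
up to `n` do not vanish, and the parameters are not related by `q`-powers of exponent less than `n`. -/
structure GenericParameters {ι : Type*} (n : ℕ) (w : ι → ℂ) (q : ℂ) : Prop where
  q_ne : q ≠ 0
  qInteger_ne : ∀ m : ℕ, 1 ≤ m → m ≤ n → qInteger q m ≠ 0
  ratio_ne : ∀ x y, x ≠ y → ∀ k : ℕ, k < n → w x ≠ q ^ k * w y

theorem GenericParameters.mono {ι : Type*} {n : ℕ} {w : ι → ℂ} {q : ℂ}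
    (h : GenericParameters n w q) {m : ℕ} (hm : m ≤ n) : GenericParameters m w q where
  q_ne := h.q_ne
  qInteger_ne k h1 h2 := h.qInteger_ne k h1 (h2.trans hm)
  ratio_ne x y hxy k hk := h.ratio_ne x y hxy k (hk.trans_le hm)

/-- In a semisimple algebra every character is afforded by a left ideal generated by an element on
which the character takes the value `1`. -/
theorem IsSemisimpleRing.exists_eigenvector {H : Type*} [Ring H] [Algebra ℂ H] [IsSemisimpleRing H]
    (χ : H →ₐ[ℂ] ℂ) : ∃ e : H, χ e = 1 ∧ ∀ h, h * e = χ h • e := by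
  -- The kernel has codimension one, so a complementary left ideal is a line on which the algebra
  -- acts by `χ`; `e` is the component of `1` in it.
  let I : Submodule H H := RingHom.ker χ
  obtain ⟨J, hJ⟩ := exists_isCompl I
  obtain ⟨x, hx, e, he, hxe⟩ := Submodule.mem_sup.1
    (show (1 : H) ∈ I ⊔ J by rw [hJ.sup_eq_top]; trivial)
  have hχ : χ e = 1 := by
    have := congrArg χ hxe
    rwa [map_add, show χ x = 0 from hx, zero_add, map_one] at this
  refine ⟨e, hχ, fun h => ?_⟩
  have h1 : h * e - χ h • e ∈ J := by
    refine J.sub_mem (J.smul_mem h he) ?_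
    rw [Algebra.smul_def]
    exact J.smul_mem _ he
  have h2 : h * e - χ h • e ∈ I := by
    change χ _ = 0
    rw [map_sub, map_mul, map_smul, hχ]
    simp
  have := (Submodule.disjoint_def.1 hJ.disjoint) _ h2 h1
  exact sub_eq_zero.1 this

section Necessity

variable {ι : Type*} [Fintype ι] {n : ℕ} {w : ι → ℂ} {q : ℂ}

theorem heckeFamily_char (n : ℕ) (w : ι → ℂ) (q : ℂ) (x : ι) :
    HeckeFamily n w q (fun i => if i = 0 then w x else (1 : ℂ)) where
  comm i j _ _ := mul_comm _ _
  braid i hi _ := by simp [show i ≠ 0 by omega]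
  braid_four _ := by simp
  cyclotomic _ := by
    simp only [if_true, map_prod, map_sub, Polynomial.aeval_X, Polynomial.aeval_C]
    exact Finset.prod_eq_zero (Finset.mem_univ x) (by simp)
  quadratic i hi _ := by simp [show i ≠ 0 by omega]

/-- Semisimplicity turns a quotient on which the algebra acts by the character `T₁ ↦ w x`, `T_i ↦ 1`
into a submodule of the same type: the element `e` belonging to the character maps a suitable vector
to `z`. -/
theorem exists_invariant {r : ℕ} {u : Fin r → ℂ}
    (huw : ∏ k, (Polynomial.X - Polynomial.C (u k)) = ∏ x, (Polynomial.X - Polynomial.C (w x)))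
    (hss : IsSemisimpleRing (CycHecke n u q)) {W : Type*} [AddCommGroup W] [Module ℂ W]
    {T : ℕ → Module.End ℂ W} (hT : HeckeFamily n w q T) (x : ι) (ε : W →ₗ[ℂ] ℂ) (hε : ε ≠ 0)
    (h0 : 0 < n → ∀ y, ε (T 0 y) = w x * ε y)
    (h1 : ∀ i, i + 1 < n → ∀ y, ε (T (i + 1) y) = ε y) :
    ∃ z, ε z = 1 ∧ (0 < n → T 0 z = w x • z) ∧ ∀ i, i + 1 < n → T (i + 1) z = z := by
  obtain ⟨ρ, hρ⟩ := hT.exists_algHom huw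
  obtain ⟨χ, hχ⟩ := (heckeFamily_char n w q x).exists_algHom huw
  obtain ⟨e, he1, he2⟩ := IsSemisimpleRing.exists_eigenvector χ
  obtain ⟨y0, hy0⟩ : ∃ y, ε y ≠ 0 := by
    by_contra! h
    exact hε (LinearMap.ext h)
  have key : ∀ h : CycHecke n u q, ∀ y, ε (ρ h y) = χ h * ε y := by
    intro h
    have hh : h ∈ Algebra.adjoin ℂ (Set.range (CycHecke.gen n u q)) := by
      rw [CycHecke.adjoin_gen]; trivial
    induction hh using Algebra.adjoin_induction with
    | mem h hh =>
      obtain ⟨i, rfl⟩ := hh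
      intro y
      rw [hρ, hχ]
      rcases i with ⟨_ | i, hi⟩
      · simpa using h0 hi y
      · simpa using h1 i hi y
    | algebraMap c => intro y; simp [Algebra.algebraMap_eq_smul_one]
    | add a b _ _ ha hb => intro y; simp [ha, hb, add_mul]
    | mul a b _ _ ha hb => intro y; simp [ha, hb, mul_assoc]
  have key2 : ∀ i : Fin n, T i (ρ e ((ε y0)⁻¹ • y0)) = χ (CycHecke.gen n u q i) •
      ρ e ((ε y0)⁻¹ • y0) := by
    intro i
    rw [← hρ, ← Module.End.mul_apply, ← map_mul, he2, map_smul ρ,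
      LinearMap.smul_apply]
  refine ⟨ρ e ((ε y0)⁻¹ • y0), ?_, fun h => ?_, fun i h => ?_⟩
  · rw [key, he1, map_smul, smul_eq_mul, inv_mul_cancel₀ hy0, one_mul]
  · rw [key2 ⟨0, h⟩, hχ]; simp
  · rw [key2 ⟨i + 1, h⟩, hχ]; simp

/-! ### Exchange operators on words in a linearly ordered alphabet -/

section Words

variable {C : Type*} [LinearOrder C]

/-- The diagonal coefficients of the action on words. -/
noncomputable def wordDiag (q : ℂ) (x y : C) : ℂ := if x < y then 0 else if y < x then 1 - q else 1

/-- The off-diagonal coefficients of the action on words. -/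
noncomputable def wordOff (q : ℂ) (x y : C) : ℂ := if x < y then 1 else if y < x then q else 0

open Finsupp

theorem exchange_apply {C : Type*} (a b : C → C → ℂ) (i : ℕ) (z : (ℕ → C) →₀ ℂ) (g : ℕ → C) :
    exchange a b i z g = a (g i) (g (i + 1)) * z g +
      b (g (i + 1)) (g i) * z (g ∘ Equiv.swap i (i + 1)) := by
  classical
  induction z using Finsupp.induction_linear with
  | zero => simp
  | add z z' h h' => rw [map_add, Finsupp.add_apply, h, h', Finsupp.add_apply, Finsupp.add_apply]; ring
  | single f c =>
    have h1 : (single f c : (ℕ → C) →₀ ℂ) = c • single f 1 := by simp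
    have h2 : f ∘ Equiv.swap i (i + 1) = g ↔ f = g ∘ Equiv.swap i (i + 1) := by
      constructor <;> rintro rfl <;> rw [comp_swap_swap]
    have h3 : (if f ∘ Equiv.swap i (i + 1) = g then b (f i) (f (i + 1)) else 0) =
        if f = g ∘ Equiv.swap i (i + 1) then b (g (i + 1)) (g i) else 0 := by
      simp only [h2]
      split_ifs with h
      · rw [h]; simp
      · rfl
    have h4 : (if f = g then a (f i) (f (i + 1)) else 0) =
        if f = g then a (g i) (g (i + 1)) else 0 := by
      split_ifs with h
      · rw [h]
      · rfl
    rw [h1, map_smul, exchange_single]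
    simp only [Finsupp.smul_apply, Finsupp.add_apply, Finsupp.single_apply, smul_eq_mul, mul_ite, mul_one,
      mul_zero] at *
    rw [h3, h4]
    split_ifs <;> ring

/-- This is the action of the finite Hecke algebra on tensor space. The conditions on the
coefficients are polynomial identities for each order pattern of the letters; inconsistent patterns
are discarded. -/
theorem word_quadratic (q : ℂ) (i : ℕ) :
    exchange (C := C) (wordDiag q) (wordOff q) i * exchange (wordDiag q) (wordOff q) i =
      (1 - q) • exchange (wordDiag q) (wordOff q) i + q • 1 := by
  refine Finsupp.lhom_ext' fun f => LinearMap.ext_ring ?_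
  simp only [LinearMap.comp_apply, lsingle_apply, Module.End.mul_apply, LinearMap.add_apply,
    LinearMap.smul_apply, Module.End.one_apply]
  apply exchange_quadratic_single <;> unfold wordDiag wordOff <;> split_ifs <;>
    first | (exfalso; order) | ring1

theorem word_braid (q : ℂ) (i : ℕ) :
    exchange (C := C) (wordDiag q) (wordOff q) i * exchange (wordDiag q) (wordOff q) (i + 1) *
      exchange (wordDiag q) (wordOff q) i =
    exchange (wordDiag q) (wordOff q) (i + 1) * exchange (wordDiag q) (wordOff q) i *
      exchange (wordDiag q) (wordOff q) (i + 1) := by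
  refine Finsupp.lhom_ext' fun f => LinearMap.ext_ring ?_
  simp only [LinearMap.comp_apply, lsingle_apply, Module.End.mul_apply]
  generalize hx : f i = x
  generalize hy : f (i + 1) = y
  generalize hz : f (i + 2) = z
  apply exchange_braid_single _ _ _ _ hx hy hz <;> clear hx hy hz <;> unfold wordDiag wordOff <;>
    split_ifs <;> first | (exfalso; order) | ring1

/-- The family of operators on words with a given first operator. -/
noncomputable def wordFamily (K : Module.End ℂ ((ℕ → C) →₀ ℂ)) (q : ℂ) :
    ℕ → Module.End ℂ ((ℕ → C) →₀ ℂ)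
  | 0 => K
  | i + 1 => exchange (wordDiag q) (wordOff q) i

theorem heckeFamily_word (n : ℕ) (w : ι → ℂ) (K : Module.End ℂ ((ℕ → C) →₀ ℂ)) (q : ℂ)
    (hcomm : ∀ i, K * exchange (wordDiag q) (wordOff q) (i + 1) =
      exchange (wordDiag q) (wordOff q) (i + 1) * K)
    (hfour : K * exchange (wordDiag q) (wordOff q) 0 * K * exchange (wordDiag q) (wordOff q) 0 =
      exchange (wordDiag q) (wordOff q) 0 * K * exchange (wordDiag q) (wordOff q) 0 * K)
    (hcyc : Polynomial.aeval K (∏ x, (Polynomial.X - Polynomial.C (w x))) = 0) :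
    HeckeFamily n w q (wordFamily K q) where
  comm i j hij _ := by
    rcases i with _ | i <;> rcases j with _ | _ | j
    any_goals omega
    · exact hcomm j
    · refine Finsupp.lhom_ext' fun f => LinearMap.ext_ring ?_
      exact exchange_comm_single _ _ (by omega) f
  braid i hi _ := by
    rcases i with _ | i
    · omega
    · exact word_braid q i
  braid_four _ := hfour
  cyclotomic _ := hcyc
  quadratic i hi _ := by
    rcases i with _ | i
    · omega
    · exact word_quadratic q i

end Words

end Necessity

section
variable {ι : Type*} [Fintype ι] {n : ℕ} {w : ι → ℂ} {q : ℂ}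

/-- At an ascent the diagonal coefficient is `0`, and the exchanged word, having a descent there,
contributes with coefficient `q`. -/
theorem word_invariant_apply {C : Type*} [LinearOrder C] {i : ℕ} {z : (ℕ → C) →₀ ℂ}
    (hz : exchange (wordDiag q) (wordOff q) i z = z) {g : ℕ → C} (hg : g i < g (i + 1)) :
    z g = q * z (g ∘ Equiv.swap i (i + 1)) := by
  have := exchange_apply (wordDiag q) (wordOff q) i z g
  rw [hz] at this
  simpa [wordDiag, wordOff, hg, hg.not_gt] using this

/-! ### Words without repeated letters -/

/-- The letter `a` is smaller than all letters of `l`, so each step to the right costs a factor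
`q⁻¹`. -/
theorem sum_permutations'Aux (hq : q ≠ 0) (N : ℕ) (Z : List ℕ → ℂ)
    (hZ : ∀ l₁ x y l₂, (l₁ ++ x :: y :: l₂).length = N → x < y →
      Z (l₁ ++ x :: y :: l₂) = q * Z (l₁ ++ y :: x :: l₂))
    (a : ℕ) (l p : List ℕ) (hl : ∀ x ∈ l, a < x) (hN : (p ++ a :: l).length = N) :
    ((List.permutations'Aux a l).map fun m => Z (p ++ m)).sum =
      (∑ k ∈ Finset.range (l.length + 1), q⁻¹ ^ k) * Z (p ++ a :: l) := by
  induction l generalizing p with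
  | nil => simp
  | cons y ys ih =>
    have h1 := ih (p ++ [y]) (fun x hx => hl x (List.mem_cons_of_mem _ hx)) (by simp at hN ⊢; omega)
    have h2 := hZ p a y ys hN (hl y List.mem_cons_self)
    simp only [List.append_assoc, List.cons_append, List.nil_append] at h1
    simp only [List.permutations'Aux, List.map_cons, List.sum_cons, List.map_map,
      Function.comp_def, h1, List.length_cons, Finset.sum_range_succ' _ (ys.length + 1), pow_succ,
      ← Finset.sum_mul, pow_zero]
    rw [h2]
    field_simp
    ring

/-- Summing over the places of the smallest letter, then of the next one, gives the Poincaré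
polynomial of the symmetric group at `q⁻¹` as a product of `q⁻¹`-integers. -/
theorem sum_permutations' (hq : q ≠ 0) (N : ℕ) (l : List ℕ) (hl : l.Pairwise (· < ·))
    (Z : List ℕ → ℂ) (p : List ℕ)
    (hZ : ∀ l₁ x y l₂, (l₁ ++ x :: y :: l₂).length = N → x < y →
      Z (l₁ ++ x :: y :: l₂) = q * Z (l₁ ++ y :: x :: l₂)) (hN : (p ++ l).length = N) :
    ((List.permutations' l).map fun m => Z (p ++ m)).sum =
      (∏ k ∈ Finset.range l.length, ∑ j ∈ Finset.range (k + 1), q⁻¹ ^ j) * Z (p ++ l) := by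
  induction l generalizing p with
  | nil => simp
  | cons a l ih =>
    rw [List.pairwise_cons] at hl
    have h1 : ∀ m ∈ List.permutations' l,
        ((List.permutations'Aux a m).map fun m => Z (p ++ m)).sum =
          (∑ k ∈ Finset.range (l.length + 1), q⁻¹ ^ k) * Z ((p ++ [a]) ++ m) := by
      intro m hm
      have hp := List.mem_permutations'.1 hm
      rw [sum_permutations'Aux hq N Z hZ a m p (fun x hx => hl.1 x (hp.mem_iff.1 hx))
        (by simpa [hp.length_eq] using hN), hp.length_eq]
      simp
    have h2 := ih hl.2 (p ++ [a]) (by simp at hN ⊢; omega)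
    rw [List.permutations', List.map_flatMap, List.flatMap, List.sum_flatten, List.map_map,
      Function.comp_def, List.map_congr_left h1,
      List.sum_map_mul_left, h2, List.length_cons, Finset.prod_range_succ]
    simp only [List.append_assoc, List.cons_append, List.nil_append]
    ring

/-- The sequence of letters of a list, continued by `0`. -/
def listSeq (l : List ℕ) (k : ℕ) : ℕ := l.getD k 0

theorem listSeq_swap (l₁ : List ℕ) (x y : ℕ) (l₂ : List ℕ) :
    listSeq (l₁ ++ x :: y :: l₂) ∘ Equiv.swap l₁.length (l₁.length + 1) =
      listSeq (l₁ ++ y :: x :: l₂) := by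
  ext k
  simp only [listSeq, Function.comp_apply, Equiv.swap_apply_def]
  rcases lt_trichotomy k l₁.length with h | h | h
  · rw [if_neg (by omega), if_neg (by omega)]
    rw [List.getD_append _ _ _ _ h, List.getD_append _ _ _ _ h]
  · subst h; simp
  · by_cases h' : k = l₁.length + 1
    · subst h'; simp
    · rw [if_neg (by omega), if_neg (by omega)]
      obtain ⟨j, rfl⟩ : ∃ j, k = l₁.length + (j + 2) := ⟨k - l₁.length - 2, by omega⟩
      rw [List.getD_append_right _ _ _ _ (by omega), List.getD_append_right _ _ _ _ (by omega)]
      simp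

theorem listSeq_injOn (N : ℕ) : Set.InjOn listSeq {l | l.length = N} := by
  intro l hl l' hl' h
  simp only [Set.mem_ofPred_eq] at hl hl'
  refine List.ext_getElem (by omega) fun k h1 h2 => ?_
  have := congrFun h k
  simpa [listSeq, List.getD_eq_getElem, h1, h2] using this

theorem exists_eq_append_cons_cons (l : List ℕ) (i : ℕ) (hi : i + 1 < l.length) :
    ∃ l₁ x y l₂, l = l₁ ++ x :: y :: l₂ ∧ l₁.length = i := by
  refine ⟨l.take i, l[i], l[i + 1], l.drop (i + 2), ?_, by simp; omega⟩
  rw [List.cons_getElem_drop_succ (h := hi), List.cons_getElem_drop_succ, List.take_append_drop]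

/-- The words obtained by ordering the letters below `n`. -/
noncomputable def permWords (n : ℕ) : Finset (ℕ → ℕ) :=
  open Classical in ((List.permutations' (List.range n)).toFinset).image listSeq

theorem swap_mem_permWords {n i : ℕ} (hi : i + 1 < n) {f : ℕ → ℕ} (hf : f ∈ permWords n) :
    f ∘ Equiv.swap i (i + 1) ∈ permWords n := by
  simp only [permWords, Finset.mem_image, List.mem_toFinset, List.mem_permutations'] at hf ⊢
  obtain ⟨l, hl, rfl⟩ := hf
  obtain ⟨l₁, x, y, l₂, rfl, rfl⟩ := exists_eq_append_cons_cons l i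
    (by rw [hl.length_eq, List.length_range]; exact hi)
  refine ⟨l₁ ++ y :: x :: l₂, (List.Perm.append_left l₁ (List.Perm.swap x y l₂)).trans hl, ?_⟩
  rw [listSeq_swap]

theorem sum_permWords (n : ℕ) (Y : (ℕ → ℕ) → ℂ) :
    ∑ f ∈ permWords n, Y f = ((List.permutations' (List.range n)).map fun l => Y (listSeq l)).sum := by
  classical
  have hnd : (List.permutations' (List.range n)).Nodup :=
    (List.permutations_perm_permutations' _).nodup_iff.1 (List.nodup_permutations _ List.nodup_range)
  rw [permWords, Finset.sum_image, List.sum_toFinset _ hnd]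
  intro l hl l' hl' h
  simp only [List.coe_toFinset, Set.mem_ofPred_eq, List.mem_permutations'] at hl hl'
  exact listSeq_injOn n (by simpa using hl.length_eq) (by simpa using hl'.length_eq) h

/-- Every word is sent to a combination with coefficients of sum `1`, so the sum of the coordinates
is unchanged. -/
theorem sum_exchange_permWords {i : ℕ} (hi : i + 1 < n) (y : (ℕ → ℕ) →₀ ℂ) :
    ∑ f ∈ permWords n, exchange (wordDiag q) (wordOff q) i y f = ∑ f ∈ permWords n, y f := by
  have h1 : ∑ f ∈ permWords n, wordOff q (f (i + 1)) (f i) * y (f ∘ Equiv.swap i (i + 1)) =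
      ∑ f ∈ permWords n, wordOff q (f i) (f (i + 1)) * y f := by
    refine Finset.sum_nbij' (fun f => f ∘ Equiv.swap i (i + 1)) (fun f => f ∘ Equiv.swap i (i + 1))
      (fun f hf => swap_mem_permWords hi hf) (fun f hf => swap_mem_permWords hi hf)
      (fun f _ => comp_swap_swap f i) (fun f _ => comp_swap_swap f i) (fun f _ => by simp)
  simp only [exchange_apply, Finset.sum_add_distrib, h1]
  rw [← Finset.sum_add_distrib]
  refine Finset.sum_congr rfl fun f _ => ?_
  rw [← add_mul]
  have : wordDiag q (f i) (f (i + 1)) + wordOff q (f i) (f (i + 1)) = 1 := by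
    unfold wordDiag wordOff; split_ifs <;> ring
  rw [this, one_mul]

theorem qInteger_natCast (q : ℂ) (m : ℕ) : qInteger q m = ∑ j ∈ Finset.range m, q ^ j := by
  unfold qInteger
  split_ifs with h
  · subst h; simp
  · rw [geom_sum_eq h, ← neg_sub, ← neg_sub q, neg_div_neg_eq]; simp

/-- In the module of words without repetition, with `T₁` acting as a scalar, an invariant vector has
coordinate sum equal to the Poincaré polynomial times its coordinate at the increasing word.
Semisimplicity provides an invariant vector of coordinate sum `1`, so no factor vanishes. -/
theorem qInteger_ne_zero_of_isSemisimpleRing [Nonempty ι] {r : ℕ} {u : Fin r → ℂ} (hq : q ≠ 0)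
    (huw : ∏ k, (Polynomial.X - Polynomial.C (u k)) = ∏ x, (Polynomial.X - Polynomial.C (w x)))
    (hss : IsSemisimpleRing (CycHecke n u q)) (m : ℕ) (h1 : 1 ≤ m) (hm : m ≤ n) :
    qInteger q m ≠ 0 := by
  obtain ⟨x⟩ := ‹Nonempty ι›
  have hT : HeckeFamily n w q (wordFamily (C := ℕ) (algebraMap ℂ _ (w x)) q) := by
    refine heckeFamily_word n w _ q (fun i => Algebra.commutes _ _) ?_ ?_
    · simp only [Algebra.algebraMap_eq_smul_one, smul_mul_assoc, one_mul, mul_smul_comm, mul_one]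
    · rw [Polynomial.aeval_algebraMap_apply, map_prod, Finset.prod_eq_zero (Finset.mem_univ x) (by simp), map_zero]
  let ε : ((ℕ → ℕ) →₀ ℂ) →ₗ[ℂ] ℂ := ∑ f ∈ permWords n, Finsupp.lapply f
  have hε : ∀ y, ε y = ∑ f ∈ permWords n, y f := by intro y; simp [ε]
  have hmem : listSeq (List.range n) ∈ permWords n := by
    simp only [permWords, Finset.mem_image, List.mem_toFinset, List.mem_permutations']
    exact ⟨_, List.Perm.refl _, rfl⟩
  obtain ⟨z, hz1, -, hz⟩ := exists_invariant huw hss hT x ε (by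
      intro h
      have := hε (Finsupp.single (listSeq (List.range n)) 1)
      rw [h] at this
      rw [Finset.sum_eq_single_of_mem _ hmem fun g _ hg => Finsupp.single_eq_of_ne hg] at this
      simp at this)
    (fun _ y => by simp [wordFamily])
    (fun i hi y => by rw [hε, hε]; exact sum_exchange_permWords hi y)
  rw [hε, sum_permWords] at hz1
  have key := sum_permutations' hq n (List.range n) List.pairwise_lt_range (fun l => z (listSeq l)) []
    (by
      intro l₁ x y l₂ hl hxy
      have := word_invariant_apply (hz l₁.length (by simp at hl; omega))
        (g := listSeq (l₁ ++ x :: y :: l₂)) (by simpa [listSeq] using hxy)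
      rw [listSeq_swap] at this
      exact this) (by simp)
  simp only [List.nil_append] at key
  rw [key, List.length_range] at hz1
  intro h0
  rw [qInteger_natCast] at h0
  -- The `q⁻¹`-integer of `m` is `q⁻¹ ^ (m - 1)` times the `q`-integer, by reversing the sum.
  have h2 : ∑ j ∈ Finset.range (m - 1 + 1), q⁻¹ ^ j = 0 := by
    rw [← Finset.sum_range_reflect]
    have : ∀ j ∈ Finset.range (m - 1 + 1), q⁻¹ ^ (m - 1 + 1 - 1 - j) = q⁻¹ ^ (m - 1) * q ^ j := by
      intro j hj
      rw [Finset.mem_range] at hj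
      rw [show m - 1 + 1 - 1 - j = m - 1 - j by omega, show m - 1 = (m - 1 - j) + j by omega, pow_add,
        Nat.add_sub_cancel, mul_assoc, inv_pow q j, inv_mul_cancel₀ (pow_ne_zero _ hq), mul_one]
    rw [Finset.sum_congr rfl this, ← Finset.mul_sum, show m - 1 + 1 = m by omega, h0, mul_zero]
  rw [Finset.prod_eq_zero (Finset.mem_range.2 (show m - 1 < n by omega)) h2] at hz1
  simp at hz1
end

section
variable {ι : Type*} [Fintype ι] {n : ℕ} {w : ι → ℂ} {q : ℂ}

/-! ### Words in two letters -/

open Finsupp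

/-- The first operator of the action on words in two letters; its eigenvalues are `Q` and `Q'`. -/
noncomputable def flipFirst (Q Q' : ℂ) : Module.End ℂ ((ℕ → Bool) →₀ ℂ) :=
  Finsupp.linearCombination ℂ fun f =>
    (if f 0 = true then 0 else (Q + Q')) • single f (1 : ℂ) +
      (if f 0 = true then -(Q * Q') else 1) • single (Function.update f 0 (!f 0)) (1 : ℂ)

theorem flipFirst_single (Q Q' : ℂ) (f : ℕ → Bool) :
    flipFirst Q Q' (single f 1) = (if f 0 = true then 0 else (Q + Q')) • single f (1 : ℂ) +
      (if f 0 = true then -(Q * Q') else 1) • single (Function.update f 0 (!f 0)) (1 : ℂ) := by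
  simp [flipFirst]

theorem update_not_involutive (f : ℕ → Bool) (k : ℕ) :
    Function.update (Function.update f k (!f k)) k (!Function.update f k (!f k) k) = f := by
  simp

theorem flipFirst_apply (Q Q' : ℂ) (z : (ℕ → Bool) →₀ ℂ) (g : ℕ → Bool) :
    flipFirst Q Q' z g = (if g 0 = true then 0 else (Q + Q')) * z g +
      (if g 0 = true then 1 else -(Q * Q')) * z (Function.update g 0 (!g 0)) := by
  classical
  induction z using Finsupp.induction_linear with
  | zero => simp
  | add z z' h h' =>
    rw [map_add, Finsupp.add_apply, h, h', Finsupp.add_apply, Finsupp.add_apply]; ring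
  | single f c =>
    have h1 : (single f c : (ℕ → Bool) →₀ ℂ) = c • single f 1 := by simp
    have h2 : Function.update f 0 (!f 0) = g ↔ f = Function.update g 0 (!g 0) := by
      constructor <;> rintro rfl <;> rw [update_not_involutive]
    rw [h1, map_smul, flipFirst_single]
    simp only [Finsupp.smul_apply, Finsupp.add_apply, Finsupp.single_apply, smul_eq_mul]
    by_cases h : f = g
    · subst h
      have h3 : ¬ f = Function.update f 0 (!f 0) := by
        intro h
        have := congrFun h 0
        simp at this
      simp [h2, h3]
      ring_nf
    · by_cases h' : f = Function.update g 0 (!g 0)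
      · rw [if_neg h, if_pos (h2.2 h'), if_pos h', h']
        cases hg : g 0 <;> simp [mul_comm]
      · rw [if_neg h, if_neg (mt h2.1 h'), if_neg h']
        simp

/-- On the plane spanned by a word and its flip the operator is the companion matrix of `(X - Q) (X
- Q')`. -/
theorem flipFirst_sq (Q Q' : ℂ) :
    (flipFirst Q Q' - algebraMap ℂ _ Q) * (flipFirst Q Q' - algebraMap ℂ _ Q') = 0 := by
  refine Finsupp.lhom_ext' fun f => LinearMap.ext_ring ?_
  simp only [LinearMap.comp_apply, lsingle_apply, Module.End.mul_apply, LinearMap.sub_apply,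
    Algebra.algebraMap_eq_smul_one, LinearMap.smul_apply, Module.End.one_apply, LinearMap.zero_apply,
    map_sub, map_smul, flipFirst_single, map_add, Function.update_self]
  have hf : Function.update f 0 (f 0) = f := Function.update_eq_self 0 f
  cases h : f 0 <;> rw [h] at hf <;>
    simp only [hf, Bool.not_false, Bool.not_true, if_true, if_false, Bool.false_eq_true,
      Function.update_idem] <;>
    module

theorem flipFirst_comm (Q Q' : ℂ) (i : ℕ) :
    flipFirst Q Q' * exchange (wordDiag q) (wordOff q) (i + 1) =
      exchange (wordDiag q) (wordOff q) (i + 1) * flipFirst Q Q' := by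
  refine Finsupp.lhom_ext' fun f => LinearMap.ext_ring ?_
  have h0 : Equiv.swap (i + 1) (i + 1 + 1) 0 = 0 :=
    Equiv.swap_apply_of_ne_of_ne (by omega) (by omega)
  have h1 : ∀ b, Function.update (f ∘ Equiv.swap (i + 1) (i + 1 + 1)) 0 b =
      Function.update f 0 b ∘ Equiv.swap (i + 1) (i + 1 + 1) := by
    intro b
    rw [← h0, Function.update_comp_equiv]
    simp [h0]
  simp only [LinearMap.comp_apply, lsingle_apply, Module.End.mul_apply, flipFirst_single,
    exchange_single, map_add, map_smul, Function.comp_apply, h0, h1,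
    Function.update_of_ne (show i + 1 ≠ 0 by omega), Function.update_of_ne (show i + 1 + 1 ≠ 0 by omega)]
  module

/-- The word `f` with its first two letters replaced. -/
def replaceTwo (f : ℕ → Bool) (b c : Bool) : ℕ → Bool :=
  Function.update (Function.update f 1 c) 0 b

/-- Only the first two letters matter, which leaves an identity of operators on four words. -/
theorem flipFirst_four (Q Q' : ℂ) :
    flipFirst Q Q' * exchange (wordDiag q) (wordOff q) 0 * flipFirst Q Q' *
      exchange (wordDiag q) (wordOff q) 0 =
    exchange (wordDiag q) (wordOff q) 0 * flipFirst Q Q' * exchange (wordDiag q) (wordOff q) 0 *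
      flipFirst Q Q' := by
  refine Finsupp.lhom_ext' fun f => LinearMap.ext_ring ?_
  have hK : ∀ b c, flipFirst Q Q' (single (replaceTwo f b c) 1) =
      (if b = true then 0 else (Q + Q')) • single (replaceTwo f b c) (1 : ℂ) +
        (if b = true then -(Q * Q') else 1) • single (replaceTwo f (!b) c) (1 : ℂ) := by
    intro b c
    rw [flipFirst_single]
    simp [replaceTwo]
  have hR : ∀ b c, exchange (wordDiag q) (wordOff q) 0 (single (replaceTwo f b c) 1) =
      wordDiag q b c • single (replaceTwo f b c) (1 : ℂ) +
      wordOff q b c • single (replaceTwo f c b) (1 : ℂ) := by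
    intro b c
    have : replaceTwo f b c ∘ Equiv.swap 0 1 = replaceTwo f c b := by
      ext k
      rcases k with _ | _ | k
      · simp [replaceTwo]
      · simp [replaceTwo]
      · simp [replaceTwo, Equiv.swap_apply_of_ne_of_ne]
    rw [exchange_single]
    simp only [zero_add, this]
    simp [replaceTwo]
  have hf : f = replaceTwo f (f 0) (f 1) := by simp [replaceTwo]
  simp only [LinearMap.comp_apply, lsingle_apply, Module.End.mul_apply]
  rw [hf]
  generalize f 0 = b
  generalize f 1 = c
  cases b <;> cases c <;>
    simp only [hK, hR, map_add, map_smul, wordDiag, wordOff, Bool.not_true, Bool.not_false, if_true,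
      lt_self_iff_false, if_false, Bool.false_lt_true, Bool.false_eq_true,
      (by decide : ¬ (true < false))] <;>
    module

/-- The sequence `f` with the letter `c` inserted at the place `k`. -/
def insertLetter {C : Type*} (k : ℕ) (c : C) (f : ℕ → C) (j : ℕ) : C :=
  if j < k then f j else if j = k then c else f (j - 1)

theorem insertLetter_succ {C : Type*} (k : ℕ) (c : C) (f : ℕ → C) :
    insertLetter (k + 1) c f = insertLetter k c f ∘ Equiv.swap k (k + 1) := by
  ext j
  simp only [insertLetter, Function.comp_apply, Equiv.swap_apply_def]
  by_cases h1 : j = k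
  · subst h1; simp
  · by_cases h2 : j = k + 1
    · subst h2; simp
    · by_cases h3 : j < k
      · simp [h1, h2, h3, show j < k + 1 by omega]
      · simp [h1, h2, h3, show ¬ j < k + 1 by omega]

/-- The relations satisfied by the coefficients of an invariant combination of words in two letters
of length `m`. -/
structure InvariantCoeff (q Q : ℂ) (m : ℕ) (Y : (ℕ → Bool) → ℂ) : Prop where
  swap : ∀ i, i + 1 < m → ∀ g, g i = false → g (i + 1) = true →
    Y g = q * Y (g ∘ Equiv.swap i (i + 1))
  first : 0 < m → ∀ g, Y (Function.update g 0 false) = Q * Y (Function.update g 0 true)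

/-- At the place `0` this is the relation for the first letter. Moving the inserted letter past `f
k` changes only one of the two sides: `false` past `true` gives `q⁻¹`, `true` past `false` gives
`q`, equal letters give nothing. Either way the ratio gains `q⁻¹`. -/
theorem InvariantCoeff.insertLetter_false {q Q : ℂ} (hq : q ≠ 0) {m : ℕ} {Y : (ℕ → Bool) → ℂ}
    (hY : InvariantCoeff q Q (m + 1) Y) (f : ℕ → Bool) (k : ℕ) (hk : k ≤ m) :
    Y (insertLetter k false f) = Q * q⁻¹ ^ k * Y (insertLetter k true f) := by
  induction k with
  | zero =>
    have : ∀ c, insertLetter 0 c f = Function.update (insertLetter 0 false f) 0 c := by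
      intro c
      ext j
      rcases j with _ | j <;> simp [insertLetter]
    rw [this true, pow_zero, mul_one, ← hY.first (by omega), ← this]
  | succ k ih =>
    have h1 : ∀ c, insertLetter k c f k = c := by intro c; simp [insertLetter]
    have h2 : ∀ c, insertLetter k c f (k + 1) = f k := by intro c; simp [insertLetter]
    have h3 : ∀ c, f k = c → insertLetter k c f ∘ Equiv.swap k (k + 1) = insertLetter k c f := by
      intro c hc
      ext j
      simp only [Function.comp_apply, Equiv.swap_apply_def]
      split_ifs with h h'
      · rw [h2, h, h1, hc]
      · rw [h1, h', h2, hc]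
      · rfl
    have ih := ih (by omega)
    rw [insertLetter_succ, insertLetter_succ]
    cases hf : f k with
    | false =>
      have h4 := hY.swap k (by omega) (insertLetter k true f ∘ Equiv.swap k (k + 1)) (by simp [h2, hf])
        (by simp [h1])
      rw [comp_swap_swap] at h4
      rw [h3 _ hf, ih, h4, pow_succ]
      field_simp
    | true =>
      have h4 := hY.swap k (by omega) (insertLetter k false f) (h1 _) (by rw [h2, hf])
      rw [h3 _ hf, pow_succ]
      rw [h4] at ih
      field_simp at ih ⊢
      linear_combination ih

theorem insertLetter_last {m : ℕ} {f : ℕ → Bool} (hf : ∀ k, m ≤ k → f k = false) (c : Bool) :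
    insertLetter m c f = Function.update f m c := by
  ext j
  simp only [insertLetter, Function.update_apply]
  rcases lt_trichotomy j m with h | h | h
  · rw [if_pos h, if_neg h.ne]
  · rw [if_neg h.not_lt, if_pos h, if_pos h]
  · rw [if_neg h.not_gt, if_neg h.ne', if_neg h.ne', hf _ (by omega), hf _ h.le]

/-- The words in two letters of length `m`, continued by `false`. -/
noncomputable def boolWords (m : ℕ) : Finset (ℕ → Bool) :=
  open Classical in (Finset.range m).powerset.image fun A k => decide (k ∈ A)

theorem mem_boolWords {m : ℕ} {f : ℕ → Bool} : f ∈ boolWords m ↔ ∀ k, m ≤ k → f k = false := by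
  classical
  simp only [boolWords, Finset.mem_image, Finset.mem_powerset]
  constructor
  · rintro ⟨A, hA, rfl⟩ k hk
    simp only [decide_eq_false_iff_not]
    exact fun h => by have := Finset.mem_range.1 (hA h); omega
  · intro h
    refine ⟨(Finset.range m).filter fun k => f k = true, Finset.filter_subset _ _, ?_⟩
    ext k
    by_cases hk : k < m
    · simp [hk]
    · simp [hk, h k (by omega)]

theorem boolWords_succ (m : ℕ) (F : (ℕ → Bool) → ℂ) : ∑ f ∈ boolWords (m + 1), F f =
    ∑ f ∈ boolWords m, (F f + F (Function.update f m true)) := by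
  classical
  have h : boolWords (m + 1) = boolWords m ∪ (boolWords m).image (Function.update · m true) := by
    ext f
    simp only [Finset.mem_union, Finset.mem_image, mem_boolWords]
    constructor
    · intro h
      cases hf : f m with
      | false =>
        refine Or.inl fun k hk => ?_
        rcases hk.eq_or_lt with rfl | hk
        · exact hf
        · exact h k hk
      | true =>
        refine Or.inr ⟨Function.update f m false, fun k hk => ?_, by simp [← hf]⟩
        rcases hk.eq_or_lt with rfl | hk
        · simp
        · rw [Function.update_of_ne hk.ne']; exact h k hk
    · rintro (h | ⟨g, hg, rfl⟩) k hk
      · exact h k (by omega)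
      · rw [Function.update_of_ne (by omega)]; exact hg k (by omega)
  rw [h, Finset.sum_union, Finset.sum_image, Finset.sum_add_distrib]
  · intro f hf g hg hfg
    have hf := mem_boolWords.1 hf
    have hg := mem_boolWords.1 hg
    ext k
    by_cases hk : k = m
    · rw [hk, hf m le_rfl, hg m le_rfl]
    · simpa [hk] using congrFun hfg k
  · rw [Finset.disjoint_left]
    intro f hf hf'
    obtain ⟨g, -, rfl⟩ := Finset.mem_image.1 hf'
    simpa using mem_boolWords.1 hf m le_rfl

/-- The product of the weights of the first `m` letters, `true` having the weight `c`. -/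
def letterWeight (c : ℂ) (m : ℕ) (f : ℕ → Bool) : ℂ := ∏ k ∈ Finset.range m, if f k = true then c else 1

/-- Sum over the last letter first. By `InvariantCoeff.insertLetter_false` its two values contribute
`Q * q⁻¹ ^ m` and `-Q'` times the coefficient with last letter `true`. These coefficients again
satisfy the relations, for words shorter by one. -/
theorem InvariantCoeff.sum_eq {q Q : ℂ} (hq : q ≠ 0) (Q' : ℂ) {m : ℕ} {Y : (ℕ → Bool) → ℂ}
    (hY : InvariantCoeff q Q m Y) : ∑ f ∈ boolWords m, letterWeight (-Q') m f * Y f =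
      (∏ k ∈ Finset.range m, (Q * q⁻¹ ^ k - Q')) * Y fun k => decide (k < m) := by
  induction m generalizing Y with
  | zero => simp [boolWords, letterWeight]
  | succ m ih =>
    have h1 : InvariantCoeff q Q m fun f => Y (Function.update f m true) := by
      refine ⟨fun i hi g h1 h2 => ?_, fun hm g => ?_⟩
      · rw [hY.swap i (by omega) _ (by rwa [Function.update_of_ne (by omega)])
          (by rwa [Function.update_of_ne (by omega)])]
        congr 2
        ext j
        have hs : Equiv.swap i (i + 1) m = m :=
          Equiv.swap_apply_of_ne_of_ne (by omega) (by omega)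
        by_cases hj : j = m
        · simp [hj, hs]
        · have : Equiv.swap i (i + 1) j ≠ m := by
            intro h
            rw [← hs] at h
            exact hj ((Equiv.swap i (i + 1)).injective h)
          simp [Function.update_of_ne, hj, this]
      · rw [Function.update_comm (by omega), hY.first (by omega),
          Function.update_comm (by omega)]
    have h2 : ∀ f ∈ boolWords m, letterWeight (-Q') (m + 1) f * Y f +
        letterWeight (-Q') (m + 1) (Function.update f m true) * Y (Function.update f m true) =
        (Q * q⁻¹ ^ m - Q') * (letterWeight (-Q') m f * Y (Function.update f m true)) := by
      intro f hf
      have hf := mem_boolWords.1 hf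
      have h3 := hY.insertLetter_false hq f m le_rfl
      rw [insertLetter_last hf, insertLetter_last hf,
        show Function.update f m false = f by rw [← hf m le_rfl, Function.update_eq_self]] at h3
      have h4 : letterWeight (-Q') (m + 1) f = letterWeight (-Q') m f := by
        simp [letterWeight, Finset.prod_range_succ, hf m le_rfl]
      have h5 : letterWeight (-Q') (m + 1) (Function.update f m true) =
          -Q' * letterWeight (-Q') m f := by
        rw [letterWeight, Finset.prod_range_succ, mul_comm]
        congr 1
        · simp
        · refine Finset.prod_congr rfl fun k hk => ?_
          rw [Function.update_of_ne (Finset.mem_range.1 hk).ne]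
      rw [h4, h5, h3]
      ring
    have h6 : Function.update (fun k => decide (k < m)) m true = fun k => decide (k < m + 1) := by
      ext k
      rcases lt_trichotomy k m with h | h | h
      · simp [Function.update_of_ne h.ne, h, h.le]
      · simp [h]
      · simp [Function.update_of_ne h.ne', h.not_gt, h]
    rw [boolWords_succ, Finset.sum_congr rfl h2, ← Finset.mul_sum, ih h1, Finset.prod_range_succ, h6]
    ring

theorem letterWeight_swap {c : ℂ} {m i : ℕ} (hi : i + 1 < m) (f : ℕ → Bool) :
    letterWeight c m (f ∘ Equiv.swap i (i + 1)) = letterWeight c m f := by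
  refine Equiv.Perm.prod_comp (Equiv.swap i (i + 1)) (Finset.range m)
    (fun k => if f k = true then c else 1) fun k hk => ?_
  have := (Equiv.swap_apply_ne_self_iff.1 hk).2
  simp only [Finset.coe_range, Set.mem_Iio]
  omega

theorem sum_exchange_boolWords {c : ℂ} {i : ℕ} (hi : i + 1 < n) (y : (ℕ → Bool) →₀ ℂ) :
    ∑ f ∈ boolWords n, letterWeight c n f * exchange (wordDiag q) (wordOff q) i y f =
      ∑ f ∈ boolWords n, letterWeight c n f * y f := by
  have hmem : ∀ f ∈ boolWords n, f ∘ Equiv.swap i (i + 1) ∈ boolWords n := by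
    intro f hf
    rw [mem_boolWords] at hf ⊢
    intro k hk
    rw [Function.comp_apply, Equiv.swap_apply_of_ne_of_ne (by omega) (by omega)]
    exact hf k hk
  have h1 : ∑ f ∈ boolWords n, letterWeight c n f *
      (wordOff q (f (i + 1)) (f i) * y (f ∘ Equiv.swap i (i + 1))) =
      ∑ f ∈ boolWords n, letterWeight c n f * (wordOff q (f i) (f (i + 1)) * y f) := by
    refine Finset.sum_nbij' (fun f => f ∘ Equiv.swap i (i + 1)) (fun f => f ∘ Equiv.swap i (i + 1))
      hmem hmem (fun f _ => comp_swap_swap f i) (fun f _ => comp_swap_swap f i) (fun f _ => ?_)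
    rw [letterWeight_swap hi]
    simp
  simp only [exchange_apply, mul_add, Finset.sum_add_distrib, h1]
  rw [← Finset.sum_add_distrib]
  refine Finset.sum_congr rfl fun f _ => ?_
  have : wordDiag q (f i) (f (i + 1)) + wordOff q (f i) (f (i + 1)) = 1 := by
    unfold wordDiag wordOff; split_ifs <;> simp
  linear_combination letterWeight c n f * y f * this

/-- The weights `1` and `-Q'` of the letters `false` and `true` form a left eigenvector of the
companion matrix for the eigenvalue `Q`. -/
theorem sum_flipFirst_boolWords {Q Q' : ℂ} (hn : 0 < n) (y : (ℕ → Bool) →₀ ℂ) :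
    ∑ f ∈ boolWords n, letterWeight (-Q') n f * flipFirst Q Q' y f =
      Q * ∑ f ∈ boolWords n, letterWeight (-Q') n f * y f := by
  have hmem : ∀ f ∈ boolWords n, Function.update f 0 (!f 0) ∈ boolWords n := by
    intro f hf
    rw [mem_boolWords] at hf ⊢
    intro k hk
    rw [Function.update_of_ne (by omega)]
    exact hf k hk
  have h1 : ∑ f ∈ boolWords n, letterWeight (-Q') n f *
      ((if f 0 = true then 1 else -(Q * Q')) * y (Function.update f 0 (!f 0))) =
      ∑ f ∈ boolWords n, letterWeight (-Q') n (Function.update f 0 (!f 0)) *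
        ((if f 0 = true then -(Q * Q') else 1) * y f) := by
    refine Finset.sum_nbij' (fun f => Function.update f 0 (!f 0))
      (fun f => Function.update f 0 (!f 0)) hmem hmem (fun f _ => update_not_involutive f 0)
      (fun f _ => update_not_involutive f 0) (fun f _ => ?_)
    rw [update_not_involutive]
    cases h : f 0 <;> simp
  have h2 : ∀ f : ℕ → Bool, f 0 = false →
      letterWeight (-Q') n (Function.update f 0 true) = -Q' * letterWeight (-Q') n f := by
    intro f hf
    obtain ⟨m, rfl⟩ : ∃ m, n = m + 1 := ⟨n - 1, by omega⟩
    simp [letterWeight, Finset.prod_range_succ', hf, mul_comm]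
  simp only [flipFirst_apply, mul_add, Finset.sum_add_distrib, h1]
  rw [← Finset.sum_add_distrib, Finset.mul_sum]
  refine Finset.sum_congr rfl fun f _ => ?_
  cases h : f 0 with
  | false =>
    have := h2 f h
    simp only [Bool.not_false, this, Bool.false_eq_true, if_false]
    ring
  | true =>
    have := h2 (Function.update f 0 false) (by simp)
    rw [Function.update_idem, ← h, Function.update_eq_self] at this
    simp only [Bool.not_true, if_true]
    rw [this]
    ring

/-- In the module of words in two letters, an invariant vector takes under the weighted sum a value
divisible by `∏ (w x * q⁻¹ ^ k - w y)`, and semisimplicity provides one with value `1`. -/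
theorem ratio_ne_of_isSemisimpleRing {r : ℕ} {u : Fin r → ℂ} (hq : q ≠ 0)
    (huw : ∏ k, (Polynomial.X - Polynomial.C (u k)) = ∏ x, (Polynomial.X - Polynomial.C (w x)))
    (hss : IsSemisimpleRing (CycHecke n u q)) {x y : ι} (hxy : x ≠ y) (k : ℕ) (hk : k < n) :
    w x ≠ q ^ k * w y := by
  classical
  have hT : HeckeFamily n w q (wordFamily (flipFirst (w x) (w y)) q) := by
    refine heckeFamily_word n w _ q (flipFirst_comm _ _) (flipFirst_four _ _) ?_
    rw [← Finset.mul_prod_erase _ _ (Finset.mem_univ x), ← Finset.mul_prod_erase _ _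
      (Finset.mem_erase.2 ⟨hxy.symm, Finset.mem_univ y⟩), ← mul_assoc, map_mul, map_mul, map_sub,
      map_sub, Polynomial.aeval_X, Polynomial.aeval_C, Polynomial.aeval_C, flipFirst_sq, zero_mul]
  let ε : ((ℕ → Bool) →₀ ℂ) →ₗ[ℂ] ℂ :=
    ∑ f ∈ boolWords n, letterWeight (-w y) n f • Finsupp.lapply f
  have hε : ∀ z, ε z = ∑ f ∈ boolWords n, letterWeight (-w y) n f * z f := by intro y; simp [ε]
  have hmem : (fun _ => false) ∈ boolWords n := mem_boolWords.2 fun _ _ => rfl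
  obtain ⟨z, hz1, hz0, hz⟩ := exists_invariant huw hss hT x ε (by
      intro h
      have := hε (Finsupp.single (fun _ => false) 1)
      rw [h, Finset.sum_eq_single_of_mem _ hmem fun g _ hg => by
        rw [Finsupp.single_eq_of_ne hg, mul_zero]] at this
      simp [letterWeight] at this)
    (fun hn z => by rw [hε, hε]; exact sum_flipFirst_boolWords hn z)
    (fun i hi z => by rw [hε, hε]; exact sum_exchange_boolWords hi z)
  have hY : InvariantCoeff q (w x) n z := by
    refine ⟨fun i hi g h1 h2 => word_invariant_apply (hz i hi) (by rw [h1, h2]; decide),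
      fun hn g => ?_⟩
    have := flipFirst_apply (w x) (w y) z (Function.update g 0 true)
    have h0 : flipFirst (w x) (w y) z = w x • z := hz0 hn
    rw [h0] at this
    simpa using this.symm
  rw [hε, hY.sum_eq hq] at hz1
  intro h
  rw [Finset.prod_eq_zero (Finset.mem_range.2 hk), zero_mul] at hz1
  · simp at hz1
  · rw [h, inv_pow]
    field_simp
    simp

theorem genericParameters_of_isSemisimpleRing [Nonempty ι] {r : ℕ} {u : Fin r → ℂ} (hq : q ≠ 0)
    (huw : ∏ k, (Polynomial.X - Polynomial.C (u k)) = ∏ x, (Polynomial.X - Polynomial.C (w x)))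
    (hss : IsSemisimpleRing (CycHecke n u q)) : GenericParameters n w q where
  q_ne := hq
  qInteger_ne := qInteger_ne_zero_of_isSemisimpleRing hq huw hss
  ratio_ne _ _ hxy k hk := ratio_ne_of_isSemisimpleRing hq huw hss hxy k hk
end

/-! ### Standard sequences of cells -/

section Cells

variable {ι : Type}

/-- The cell `x` lies weakly above and to the left of `y` in the same diagram. -/
def CellLE (x y : ι × ℕ × ℕ) : Prop := x.1 = y.1 ∧ x.2 ≤ y.2

theorem CellLE.refl (x : ι × ℕ × ℕ) : CellLE x x := ⟨rfl, le_rfl⟩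

theorem CellLE.trans {x y z : ι × ℕ × ℕ} (h : CellLE x y) (h' : CellLE y z) : CellLE x z :=
  ⟨h.1.trans h'.1, h.2.trans h'.2⟩

theorem CellLE.antisymm {x y : ι × ℕ × ℕ} (h : CellLE x y) (h' : CellLE y x) : x = y :=
  Prod.ext h.1 (le_antisymm h.2 h'.2)

theorem CellLE.mk {x y : ι × ℕ × ℕ} (h : x.1 = y.1) (h1 : x.2.1 ≤ y.2.1) (h2 : x.2.2 ≤ y.2.2) :
    CellLE x y := ⟨h, h1, h2⟩

/-- The content `column - row` of a cell. -/
def content (x : ι × ℕ × ℕ) : ℤ := (x.2.2 : ℤ) - (x.2.1 : ℤ)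

/-- Finite sets of cells that are families of Young diagrams. -/
def IsDiagram (L : Finset (ι × ℕ × ℕ)) : Prop := ∀ x y, CellLE x y → y ∈ L → x ∈ L

/-- The first `n` members of the sequence `h` form a standard tableau: they increase along rows and
columns and fill a family of Young diagrams. -/
structure StdSeq (n : ℕ) (h : ℕ → ι × ℕ × ℕ) : Prop where
  le_of_cellLE : ∀ a < n, ∀ b < n, CellLE (h a) (h b) → a ≤ b
  exists_eq : ∀ b < n, ∀ x, CellLE x (h b) → ∃ a < n, h a = x

theorem StdSeq.injOn {n : ℕ} {h : ℕ → ι × ℕ × ℕ} (hh : StdSeq n h) {a b : ℕ} (ha : a < n)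
    (hb : b < n) (hab : h a = h b) : a = b :=
  le_antisymm (hh.le_of_cellLE a ha b hb (hab ▸ CellLE.refl _))
    (hh.le_of_cellLE b hb a ha (hab ▸ CellLE.refl _))

theorem StdSeq.mono {n m : ℕ} {h : ℕ → ι × ℕ × ℕ} (hh : StdSeq n h) (hm : m ≤ n) : StdSeq m h where
  le_of_cellLE a ha b hb := hh.le_of_cellLE a (by omega) b (by omega)
  exists_eq b hb x hx := by
    obtain ⟨a, ha, rfl⟩ := hh.exists_eq b (by omega) x hx
    exact ⟨a, (hh.le_of_cellLE a ha b (by omega) hx).trans_lt hb, rfl⟩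

theorem StdSeq.congr {n : ℕ} {h h' : ℕ → ι × ℕ × ℕ} (hh : StdSeq n h) (H : ∀ k < n, h' k = h k) :
    StdSeq n h' where
  le_of_cellLE a ha b hb := by rw [H a ha, H b hb]; exact hh.le_of_cellLE a ha b hb
  exists_eq b hb x hx := by
    rw [H b hb] at hx
    obtain ⟨a, ha, h1⟩ := hh.exists_eq b hb x hx
    exact ⟨a, ha, (H a ha).trans h1⟩

theorem swap_lt {n i : ℕ} (hi : i + 1 < n) {a : ℕ} (ha : a < n) : Equiv.swap i (i + 1) a < n := by
  rw [Equiv.swap_apply_def]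
  split_ifs <;> omega

theorem StdSeq.swap {n i : ℕ} {h : ℕ → ι × ℕ × ℕ} (hh : StdSeq n h) (hi : i + 1 < n)
    (hle : ¬ CellLE (h i) (h (i + 1))) : StdSeq n (h ∘ Equiv.swap i (i + 1)) where
  le_of_cellLE a ha b hb hab := by
    have h1 := hh.le_of_cellLE _ (swap_lt hi ha) _ (swap_lt hi hb) hab
    by_contra! h2
    simp only [Equiv.swap_apply_def] at h1
    -- A transposition of neighbours reverses the order of this one pair only, and that pair is
    -- incomparable.
    have h3 : a = i + 1 ∧ b = i := by
      split_ifs at h1 <;> omega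
    rw [h3.1, h3.2] at hab
    simp only [Function.comp_apply, Equiv.swap_apply_left, Equiv.swap_apply_right] at hab
    exact hle hab
  exists_eq b hb x hx := by
    obtain ⟨a, ha, h1⟩ := hh.exists_eq _ (swap_lt hi hb) x hx
    exact ⟨Equiv.swap i (i + 1) a, swap_lt hi ha, by simpa using h1⟩

/-- If the contents agree, `h j` lies strictly below `h i` on the same diagonal. The cells
immediately to the left of and above `h j` then have two distinct places strictly between `i` and
`j`, too many for `j ≤ i + 2`. -/
theorem StdSeq.content_ne {n : ℕ} {h : ℕ → ι × ℕ × ℕ} (hh : StdSeq n h) {i j : ℕ} (hij : i < j)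
    (hj : j < n) (hji : j ≤ i + 2) (hc : (h i).1 = (h j).1) : content (h i) ≠ content (h j) := by
  intro h0
  unfold content at h0
  have hle : ¬ CellLE (h j) (h i) := fun H => by
    have := hh.le_of_cellLE j hj i (by omega) H
    omega
  have h1 : (h i).2.1 < (h j).2.1 := by
    by_contra! H
    exact hle (CellLE.mk hc.symm H (by omega))
  obtain ⟨a, ha, ha'⟩ := hh.exists_eq j hj ((h j).1, (h j).2.1, (h j).2.2 - 1)
    (CellLE.mk rfl le_rfl (Nat.sub_le _ _))
  obtain ⟨b, hb, hb'⟩ := hh.exists_eq j hj ((h j).1, (h j).2.1 - 1, (h j).2.2)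
    (CellLE.mk rfl (Nat.sub_le _ _) le_rfl)
  have hia : i ≤ a := hh.le_of_cellLE i (by omega) a ha
    (ha' ▸ CellLE.mk hc h1.le (by change _ ≤ (h j).2.2 - 1; omega))
  have hib : i ≤ b := hh.le_of_cellLE i (by omega) b hb
    (hb' ▸ CellLE.mk hc (by change _ ≤ (h j).2.1 - 1; omega) (by change _ ≤ (h j).2.2; omega))
  have haj : a ≤ j := hh.le_of_cellLE a ha j hj (ha' ▸ CellLE.mk rfl le_rfl (Nat.sub_le _ _))
  have hbj : b ≤ j := hh.le_of_cellLE b hb j hj (hb' ▸ CellLE.mk rfl (Nat.sub_le _ _) le_rfl)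
  have ha2 := congrArg (fun x => x.2.2) ha'
  have hb2 := congrArg (fun x => x.2.1) hb'
  have ha3 := congrArg (fun x => x.2.1) ha'
  have hb3 := congrArg (fun x => x.2.2) hb'
  simp only at ha2 hb2 ha3 hb3
  have n1 : a ≠ i := by rintro rfl; omega
  have n2 : b ≠ i := by rintro rfl; omega
  have n3 : a ≠ j := by rintro rfl; omega
  have n4 : b ≠ j := by rintro rfl; omega
  have n5 : a ≠ b := by rintro rfl; omega
  omega

variable [DecidableEq ι]

/-- The set of the first `n` members of a sequence of cells. -/
def shape (n : ℕ) (h : ℕ → ι × ℕ × ℕ) : Finset (ι × ℕ × ℕ) := (Finset.range n).image h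

theorem mem_shape {n : ℕ} {h : ℕ → ι × ℕ × ℕ} {x : ι × ℕ × ℕ} :
    x ∈ shape n h ↔ ∃ a < n, h a = x := by
  simp [shape]

theorem mem_shape_of_lt {n : ℕ} {h : ℕ → ι × ℕ × ℕ} {a : ℕ} (ha : a < n) : h a ∈ shape n h :=
  mem_shape.2 ⟨a, ha, rfl⟩

theorem shape_succ (n : ℕ) (h : ℕ → ι × ℕ × ℕ) : shape (n + 1) h = insert (h n) (shape n h) := by
  simp [shape, Finset.range_add_one]

theorem shape_congr {n : ℕ} {h h' : ℕ → ι × ℕ × ℕ} (H : ∀ k < n, h' k = h k) :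
    shape n h' = shape n h :=
  Finset.image_congr fun k hk => H k (by simpa using hk)

theorem StdSeq.card_shape {n : ℕ} {h : ℕ → ι × ℕ × ℕ} (hh : StdSeq n h) : (shape n h).card = n := by
  rw [shape, Finset.card_image_of_injOn, Finset.card_range]
  intro a ha b hb hab
  exact hh.injOn (by simpa using ha) (by simpa using hb) hab

theorem StdSeq.isDiagram {n : ℕ} {h : ℕ → ι × ℕ × ℕ} (hh : StdSeq n h) : IsDiagram (shape n h) := by
  intro x y hxy hy
  obtain ⟨b, hb, rfl⟩ := mem_shape.1 hy
  exact mem_shape.2 (hh.exists_eq b hb x hxy)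

theorem shape_swap {n i : ℕ} (hi : i + 1 < n) (h : ℕ → ι × ℕ × ℕ) :
    shape n (h ∘ Equiv.swap i (i + 1)) = shape n h := by
  ext x
  simp only [mem_shape]
  constructor
  · rintro ⟨a, ha, rfl⟩
    exact ⟨_, swap_lt hi ha, rfl⟩
  · rintro ⟨a, ha, rfl⟩
    exact ⟨Equiv.swap i (i + 1) a, swap_lt hi ha, by simp⟩

theorem StdSeq.notMem_shape {n : ℕ} {h : ℕ → ι × ℕ × ℕ} (hh : StdSeq (n + 1) h) :
    h n ∉ shape n h := by
  intro H
  obtain ⟨a, ha, h1⟩ := mem_shape.1 H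
  have := hh.injOn (by omega) (by omega) h1
  omega

theorem StdSeq.shape_eq_erase {n : ℕ} {h : ℕ → ι × ℕ × ℕ} (hh : StdSeq (n + 1) h) :
    shape n h = (shape (n + 1) h).erase (h n) := by
  rw [shape_succ, Finset.erase_insert hh.notMem_shape]

theorem StdSeq.snoc {n : ℕ} {h : ℕ → ι × ℕ × ℕ} (hh : StdSeq n h) (h1 : h n ∉ shape n h)
    (h2 : IsDiagram (insert (h n) (shape n h))) : StdSeq (n + 1) h where
  le_of_cellLE a ha b hb hab := by
    rcases Nat.lt_succ_iff_lt_or_eq.1 ha with ha | rfl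
    · rcases Nat.lt_succ_iff_lt_or_eq.1 hb with hb | rfl
      · exact hh.le_of_cellLE a ha b hb hab
      · exact ha.le
    · rcases Nat.lt_succ_iff_lt_or_eq.1 hb with hb | rfl
      · exact absurd (hh.isDiagram _ _ hab (mem_shape_of_lt hb)) h1
      · exact le_rfl
  exists_eq b hb x hx := by
    rw [← mem_shape, shape_succ]
    refine h2 _ _ hx ?_
    rw [← shape_succ]
    exact mem_shape_of_lt hb

theorem update_lt {C : Type*} {n : ℕ} (h : ℕ → C) (x : C) : ∀ k < n, Function.update h n x k = h k :=
  fun _ hk => Function.update_of_ne hk.ne _ _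

theorem StdSeq.update {n : ℕ} {h : ℕ → ι × ℕ × ℕ} (hh : StdSeq n h) {x : ι × ℕ × ℕ}
    (h1 : x ∉ shape n h) (h2 : IsDiagram (insert x (shape n h))) :
    StdSeq (n + 1) (Function.update h n x) := by
  refine (hh.congr (update_lt h x)).snoc ?_ ?_ <;>
    rwa [Function.update_self, shape_congr (update_lt h x)]

theorem shape_update (n : ℕ) (h : ℕ → ι × ℕ × ℕ) (x : ι × ℕ × ℕ) :
    shape (n + 1) (Function.update h n x) = insert x (shape n h) := by
  rw [shape_succ, Function.update_self, shape_congr (update_lt h x)]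

/-- The top row up to the column of `x` and the left column down to the row of `y` consist of cells
of `L`. This bounds differences of contents by the number of cells, so that genericity applies. -/
theorem IsDiagram.hook_le {L : Finset (ι × ℕ × ℕ)} (hL : IsDiagram L) {x y : ι × ℕ × ℕ} (hx : x ∈ L)
    (hy : y ∈ L) : x.2.2 + y.2.1 + (if x.1 = y.1 then 1 else 2) ≤ L.card := by
  let s : Finset (ι × ℕ × ℕ) := (Finset.range (x.2.2 + 1)).image fun j => (x.1, 0, j)
  let t : Finset (ι × ℕ × ℕ) :=
    -- In a common diagram the corner already belongs to the row, so the column starts at `1`.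
    (Finset.Ico (if x.1 = y.1 then 1 else 0) (y.2.1 + 1)).image fun i => (y.1, i, 0)
  have hs : s.card = x.2.2 + 1 := by
    rw [Finset.card_image_of_injective _ (fun a b h => by simpa using h), Finset.card_range]
  have ht : t.card = y.2.1 + 1 - (if x.1 = y.1 then 1 else 0) := by
    rw [Finset.card_image_of_injective _ (fun a b h => by simpa using h), Nat.card_Ico]
  have hst : Disjoint s t := by
    rw [Finset.disjoint_left]
    intro z hz hz'
    obtain ⟨j, -, rfl⟩ := Finset.mem_image.1 hz
    obtain ⟨i, hi, h⟩ := Finset.mem_image.1 hz'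
    simp only [Prod.mk.injEq] at h
    rw [if_pos h.1.symm, Finset.mem_Ico] at hi
    omega
  have hsub : s ∪ t ⊆ L := by
    intro z hz
    rcases Finset.mem_union.1 hz with hz | hz
    · obtain ⟨j, hj, rfl⟩ := Finset.mem_image.1 hz
      rw [Finset.mem_range] at hj
      exact hL _ x (CellLE.mk rfl (Nat.zero_le _) (by simp only; omega)) hx
    · obtain ⟨i, hi, rfl⟩ := Finset.mem_image.1 hz
      rw [Finset.mem_Ico] at hi
      exact hL _ y (CellLE.mk rfl (by simp only; omega) (Nat.zero_le _)) hy
  have := Finset.card_le_card hsub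
  rw [Finset.card_union_of_disjoint hst, hs, ht] at this
  split_ifs at * <;> omega

theorem IsDiagram.inter {L L' : Finset (ι × ℕ × ℕ)} (hL : IsDiagram L) (hL' : IsDiagram L') :
    IsDiagram (L ∩ L') := fun x y hxy hy => by
  rw [Finset.mem_inter] at hy ⊢
  exact ⟨hL x y hxy hy.1, hL' x y hxy hy.2⟩

theorem IsDiagram.union {L L' : Finset (ι × ℕ × ℕ)} (hL : IsDiagram L) (hL' : IsDiagram L') :
    IsDiagram (L ∪ L') := fun x y hxy hy => by
  rw [Finset.mem_union] at hy ⊢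
  exact hy.imp (hL x y hxy) (hL' x y hxy)

/-- Every cell of a family of diagrams lies above some removable cell. -/
theorem IsDiagram.exists_removable {L : Finset (ι × ℕ × ℕ)} (hL : IsDiagram L) {x : ι × ℕ × ℕ}
    (hx : x ∈ L) : ∃ y ∈ L, CellLE x y ∧ IsDiagram (L.erase y) := by
  classical
  -- A cell maximizing row plus column among those below `x` has nothing further below it, hence is
  -- removable.
  obtain ⟨y, hy, hmax⟩ := (L.filter (CellLE x)).exists_max_image (fun y => y.2.1 + y.2.2)
    ⟨x, Finset.mem_filter.2 ⟨hx, CellLE.refl x⟩⟩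
  rw [Finset.mem_filter] at hy
  refine ⟨y, hy.1, hy.2, fun z t hzt ht => ?_⟩
  rw [Finset.mem_erase] at ht ⊢
  refine ⟨?_, hL z t hzt ht.2⟩
  rintro rfl
  have h1 := hmax t (Finset.mem_filter.2 ⟨ht.2, hy.2.trans hzt⟩)
  obtain ⟨h2, h3, h4⟩ := hzt
  exact ht.1 (CellLE.antisymm (CellLE.mk h2.symm (by omega) (by omega)) ⟨h2, h3, h4⟩)

variable [Inhabited ι]

/-- The standard sequences with a given set of members, continued by a fixed cell. -/
def tableaux (n : ℕ) (L : Finset (ι × ℕ × ℕ)) : Set (ℕ → ι × ℕ × ℕ) :=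
  {h | StdSeq n h ∧ shape n h = L ∧ ∀ k, n ≤ k → h k = default}

theorem update_mem_tableaux {n : ℕ} {L : Finset (ι × ℕ × ℕ)} {h : ℕ → ι × ℕ × ℕ}
    (hh : h ∈ tableaux n L) {x : ι × ℕ × ℕ} (hx : x ∉ L) (hL : IsDiagram (insert x L)) :
    Function.update h n x ∈ tableaux (n + 1) (insert x L) := by
  obtain ⟨h1, rfl, h2⟩ := hh
  refine ⟨h1.update hx hL, shape_update n h x, fun k hk => ?_⟩
  rw [Function.update_of_ne (by omega)]
  exact h2 k (by omega)

theorem update_default_mem_tableaux {n : ℕ} {L : Finset (ι × ℕ × ℕ)} {h : ℕ → ι × ℕ × ℕ}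
    (hh : h ∈ tableaux (n + 1) L) :
    Function.update h n default ∈ tableaux n (L.erase (h n)) := by
  obtain ⟨h1, rfl, h2⟩ := hh
  refine ⟨(h1.mono (Nat.le_succ n)).congr (update_lt _ _), ?_, fun k hk => ?_⟩
  · rw [shape_congr (update_lt _ _), h1.shape_eq_erase]
  · rcases hk.eq_or_lt with rfl | hk
    · simp
    · rw [Function.update_of_ne hk.ne']; exact h2 k hk

theorem swap_mem_tableaux {n i : ℕ} {L : Finset (ι × ℕ × ℕ)} {h : ℕ → ι × ℕ × ℕ}
    (hh : h ∈ tableaux n L) (hi : i + 1 < n) (hle : ¬ CellLE (h i) (h (i + 1))) :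
    h ∘ Equiv.swap i (i + 1) ∈ tableaux n L := by
  obtain ⟨h1, rfl, h2⟩ := hh
  refine ⟨h1.swap hi hle, shape_swap hi h, fun k hk => ?_⟩
  rw [Function.comp_apply, Equiv.swap_apply_of_ne_of_ne (by omega) (by omega)]
  exact h2 k hk

theorem tableaux_nonempty {n : ℕ} {L : Finset (ι × ℕ × ℕ)} (hL : IsDiagram L) (hn : L.card = n) :
    (tableaux n L).Nonempty := by
  induction n generalizing L with
  | zero =>
    refine ⟨fun _ => default, ⟨by simp, by simp⟩, ?_, fun _ _ => rfl⟩
    rw [Finset.card_eq_zero.1 hn]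
    simp [shape]
  | succ n ih =>
    obtain ⟨x, hx⟩ := Finset.card_pos.1 (show 0 < L.card by omega)
    obtain ⟨y, hy, -, hLy⟩ := hL.exists_removable hx
    obtain ⟨h, hh⟩ := ih hLy (by rw [Finset.card_erase_of_mem hy, hn]; rfl)
    have := update_mem_tableaux hh (Finset.notMem_erase y L) (by rwa [Finset.insert_erase hy])
    rw [Finset.insert_erase hy] at this
    exact ⟨_, this⟩

theorem exists_tableau_last {n : ℕ} {L : Finset (ι × ℕ × ℕ)} (hn : L.card = n + 1)
    {x : ι × ℕ × ℕ} (hx : x ∈ L) (hL : IsDiagram L) (hLx : IsDiagram (L.erase x)) :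
    ∃ h ∈ tableaux (n + 1) L, h n = x := by
  obtain ⟨h, hh⟩ := tableaux_nonempty hLx (n := n) (by rw [Finset.card_erase_of_mem hx, hn]; rfl)
  refine ⟨Function.update h n x, ?_, by simp⟩
  have := update_mem_tableaux hh (Finset.notMem_erase x L) (by rwa [Finset.insert_erase hx])
  rwa [Finset.insert_erase hx] at this

theorem finite_tableaux (n : ℕ) (L : Finset (ι × ℕ × ℕ)) : (tableaux n L).Finite := by
  refine Set.Finite.of_injOn (f := fun h (k : Fin n) => h k)
    (t := Set.pi Set.univ fun _ => (L : Set (ι × ℕ × ℕ))) ?_ ?_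
    (Set.Finite.pi fun _ => L.finite_toSet)
  · rintro h ⟨-, rfl, -⟩ k -
    exact mem_shape_of_lt k.2
  · rintro h ⟨-, -, h1⟩ h' ⟨-, -, h2⟩ heq
    ext1 k
    by_cases hk : k < n
    · exact congrFun heq ⟨k, hk⟩
    · rw [h1 k (by omega), h2 k (by omega)]

end Cells

/-! ### The seminormal operators -/

section qIntegers

variable {q : ℂ}

theorem one_sub_zpow (q : ℂ) (k : ℤ) : 1 - q ^ k = (1 - q) * qInteger q k := by
  unfold qInteger
  split_ifs with h
  · simp [h]
  · rw [mul_div_cancel₀ _ (sub_ne_zero.2 (Ne.symm h))]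

theorem qInteger_add (hq : q ≠ 0) (k l : ℤ) :
    qInteger q (k + l) = qInteger q k + q ^ k * qInteger q l := by
  unfold qInteger
  split_ifs with h
  · simp [h]
  · rw [zpow_add₀ hq]; ring

/-- This symmetric form is free of powers of `q` and also covers `q = 1`; it yields the identities
between diagonal coefficients within one diagram. -/
theorem qInteger_add' (hq : q ≠ 0) (k l : ℤ) :
    qInteger q (k + l) = qInteger q k + qInteger q l - (1 - q) * qInteger q k * qInteger q l := by
  rw [qInteger_add hq]
  linear_combination (-qInteger q l) * one_sub_zpow q k

theorem qInteger_zero (q : ℂ) : qInteger q 0 = 0 := by simp [qInteger]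

theorem qInteger_one (q : ℂ) : qInteger q 1 = 1 := by
  unfold qInteger
  split_ifs with h
  · simp
  · rw [zpow_one, div_self (sub_ne_zero.2 (Ne.symm h))]

theorem qInteger_neg (hq : q ≠ 0) (k : ℤ) : qInteger q (-k) = -(q ^ (-k) * qInteger q k) := by
  have := qInteger_add hq (-k) k
  rw [neg_add_cancel, qInteger_zero] at this
  linear_combination -this

theorem GenericParameters.qInteger_ne_zero {ι : Type*} {n : ℕ} {w : ι → ℂ}
    (hG : GenericParameters n w q) {k : ℤ} (h0 : k ≠ 0) (h1 : k ≤ n) (h2 : -(n : ℤ) ≤ k) :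
    qInteger q k ≠ 0 := by
  rcases lt_or_gt_of_ne h0 with h | h
  · obtain ⟨m, rfl⟩ : ∃ m : ℕ, k = -(m : ℤ) := ⟨k.natAbs, by omega⟩
    rw [qInteger_neg hG.q_ne]
    exact neg_ne_zero.2 (mul_ne_zero (zpow_ne_zero _ hG.q_ne) (hG.qInteger_ne m (by omega) (by omega)))
  · obtain ⟨m, rfl⟩ : ∃ m : ℕ, k = (m : ℤ) := ⟨k.natAbs, by omega⟩
    exact hG.qInteger_ne m (by omega) (by omega)

theorem GenericParameters.ratio_ne_zpow {ι : Type*} {n : ℕ} {w : ι → ℂ}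
    (hG : GenericParameters n w q) {x y : ι} (hxy : x ≠ y) {k : ℤ} (h1 : k < n) (h2 : -(n : ℤ) < k) :
    w x ≠ q ^ k * w y := by
  rcases le_or_gt 0 k with h | h
  · obtain ⟨m, rfl⟩ : ∃ m : ℕ, k = (m : ℤ) := ⟨k.natAbs, by omega⟩
    simpa using hG.ratio_ne x y hxy m (by omega)
  · obtain ⟨m, rfl⟩ : ∃ m : ℕ, k = -(m : ℤ) := ⟨k.natAbs, by omega⟩
    intro H
    refine hG.ratio_ne y x hxy.symm m (by omega) ?_
    rw [H, zpow_neg, zpow_natCast, mul_inv_cancel_left₀ (pow_ne_zero _ hG.q_ne)]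

end qIntegers

/-! ### Identities between the coefficients of the seminormal form -/

section Coefficients

variable {ι : Type} (w : ι → ℂ) (q : ℂ)

/-- The residue of a cell. -/
noncomputable def residue (x : ι × ℕ × ℕ) : ℂ := w x.1 * q ^ (-content x)

open Classical in
/-- The diagonal coefficient of the exchange of two consecutive letters in the cells `x` and `y`. -/
noncomputable def cellDiag (x y : ι × ℕ × ℕ) : ℂ :=
  if x.1 = y.1 then (qInteger q (content y - content x))⁻¹
  else (1 - q) * residue w q y / (residue w q y - residue w q x)

open Classical in
/-- The off-diagonal coefficient of the exchange of two consecutive letters in the cells `x`, `y`. -/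
noncomputable def cellOff (x y : ι × ℕ × ℕ) : ℂ := if CellLE x y then 0 else cellDiag w q x y + q

/-- The denominator of `cellDiag` does not vanish. -/
def Separated (x y : ι × ℕ × ℕ) : Prop :=
  (x.1 = y.1 → qInteger q (content y - content x) ≠ 0) ∧
    (x.1 ≠ y.1 → residue w q y - residue w q x ≠ 0)

variable {w q}

/-- Written with a `q`-integer, the relation between residues in one diagram remains usable when
they vanish or `q = 1`, where the quotient formula for the diagonal coefficient breaks down. -/
theorem residue_eq (hq : q ≠ 0) {x y : ι × ℕ × ℕ} (h : x.1 = y.1) :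
    residue w q x = (1 - (1 - q) * qInteger q (content y - content x)) * residue w q y := by
  rw [← one_sub_zpow, residue, residue, h, sub_sub_cancel, mul_left_comm, ← zpow_add₀ hq]
  congr 2
  ring

theorem Separated.symm (hq : q ≠ 0) {x y : ι × ℕ × ℕ} (h : Separated w q x y) :
    Separated w q y x := by
  refine ⟨fun h1 => ?_, fun h1 => ?_⟩
  · rw [← neg_sub, qInteger_neg hq]
    exact neg_ne_zero.2 (mul_ne_zero (zpow_ne_zero _ hq) (h.1 h1.symm))
  · rw [← neg_sub]
    exact neg_ne_zero.2 (h.2 (Ne.symm h1))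

theorem cellDiag_mul_sub (hq : q ≠ 0) {x y : ι × ℕ × ℕ} (h : Separated w q x y) :
    cellDiag w q x y * (residue w q y - residue w q x) = (1 - q) * residue w q y := by
  unfold cellDiag
  split_ifs with h1
  · rw [residue_eq hq h1]
    have := h.1 h1
    field_simp
    ring
  · exact div_mul_cancel₀ _ (h.2 h1)

theorem cellDiag_add (hq : q ≠ 0) {x y : ι × ℕ × ℕ} (h : Separated w q x y) :
    cellDiag w q x y + cellDiag w q y x = 1 - q := by
  have h' := h.symm hq
  unfold cellDiag
  split_ifs with h1 h2 h2
  · have h3 := h.1 h1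
    have h4 := h'.1 h2
    have h5 := qInteger_add' hq (content y - content x) (content x - content y)
    rw [sub_add_sub_cancel, sub_self, qInteger_zero] at h5
    field_simp
    linear_combination -h5
  · exact absurd h1.symm h2
  · exact absurd h2.symm h1
  · have h3 := h.2 h1
    rw [← neg_sub (residue w q y), div_neg, ← sub_eq_add_neg, div_sub_div_same, ← mul_sub,
      mul_div_cancel_right₀ _ h3]

/-- For three different diagrams this is the partial fraction identity for `(1 - q) y / (y - x)`.
For one diagram it is addition of `q`-integers; the mixed cases follow by expressing one residue
through another. The braid relation rests on it. -/
theorem cellDiag_mul (hq : q ≠ 0) {x y z : ι × ℕ × ℕ} (hxy : Separated w q x y)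
    (hyz : Separated w q y z) (hxz : Separated w q x z) :
    cellDiag w q x y * cellDiag w q y z =
      cellDiag w q x z * (cellDiag w q x y + cellDiag w q y z - (1 - q)) := by
  unfold cellDiag
  by_cases h1 : x.1 = y.1 <;> by_cases h2 : y.1 = z.1
  · have h3 := h1.trans h2
    have e1 := hxy.1 h1
    have e2 := hyz.1 h2
    have e3 := hxz.1 h3
    have e4 := qInteger_add' hq (content y - content x) (content z - content y)
    rw [show content y - content x + (content z - content y) = content z - content x by ring] at e4
    rw [if_pos h1, if_pos h2, if_pos h3]
    field_simp
    linear_combination e4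
  · have h3 : ¬ x.1 = z.1 := fun h => h2 (h1.symm.trans h)
    have e1 := hxy.1 h1
    have e2 := hyz.2 h2
    have e3 := hxz.2 h3
    have e4 := residue_eq (w := w) hq h1
    rw [if_pos h1, if_neg h2, if_neg h3]
    have e5 : (qInteger q (content y - content x))⁻¹ +
        (1 - q) * residue w q z / (residue w q z - residue w q y) - (1 - q) =
        (qInteger q (content y - content x))⁻¹ * (residue w q z - residue w q x) /
          (residue w q z - residue w q y) := by
      rw [e4]; field_simp; ring
    rw [e5]; field_simp
  · have h3 : ¬ x.1 = z.1 := fun h => h1 (h.trans h2.symm)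
    have e1 := hxy.2 h1
    have e2 := hyz.1 h2
    have e3 := hxz.2 h3
    have e4 := residue_eq (w := w) hq h2
    rw [if_neg h1, if_pos h2, if_neg h3]
    rw [e4] at e1 ⊢
    field_simp
    ring
  · have e1 := hxy.2 h1
    have e2 := hyz.2 h2
    rw [if_neg h1, if_neg h2]
    split_ifs with h3
    · have e3 := hxz.1 h3
      have e4 := residue_eq (w := w) hq h3
      rw [e4] at e1 ⊢
      field_simp
      ring
    · have e3 := hxz.2 h3
      field_simp
      ring

/-- Two distinct consecutive cells of a standard sequence that are comparable are neighbours. -/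
theorem StdSeq.content_eq {n i : ℕ} {h : ℕ → ι × ℕ × ℕ} (hh : StdSeq n h) (hi : i + 1 < n)
    (hle : CellLE (h i) (h (i + 1))) : content (h (i + 1)) - content (h i) = 1 ∨
      content (h (i + 1)) - content (h i) = -1 := by
  have hne : h i ≠ h (i + 1) := fun H => by
    have := hh.injOn (by omega) hi H
    omega
  obtain ⟨h0, h1, h2⟩ := hle
  -- No cell lies between two comparable consecutive cells, since it would need a place strictly
  -- between `i` and `i + 1`.
  have key : ∀ y : ι × ℕ × ℕ, CellLE (h i) y → CellLE y (h (i + 1)) → y ≠ h (i + 1) → h i = y := by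
    intro y hy1 hy2 hy3
    obtain ⟨a, ha, rfl⟩ := hh.exists_eq _ hi y hy2
    have a1 := hh.le_of_cellLE i (by omega) a ha hy1
    have a2 := hh.le_of_cellLE a ha _ hi hy2
    have a3 : a ≠ i + 1 := fun H => hy3 (by rw [H])
    rw [show a = i by omega]
  unfold content
  by_cases h3 : (h i).2.1 < (h (i + 1)).2.1
  · have := key ((h (i + 1)).1, (h (i + 1)).2.1 - 1, (h (i + 1)).2.2)
      (CellLE.mk h0 (by simp only; omega) h2) (CellLE.mk rfl (Nat.sub_le _ _) le_rfl)
      (fun H => by have := congrArg (fun x => x.2.1) H; simp only at this; omega)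
    rw [this]
    simp only
    omega
  · have h4 : (h i).2.2 < (h (i + 1)).2.2 := by
      by_contra! H
      exact hne (CellLE.antisymm ⟨h0, h1, h2⟩ (CellLE.mk h0.symm (by omega) H))
    have := key ((h (i + 1)).1, (h (i + 1)).2.1, (h (i + 1)).2.2 - 1)
      (CellLE.mk h0 h1 (by simp only; omega)) (CellLE.mk rfl le_rfl (Nat.sub_le _ _))
      (fun H => by have := congrArg (fun x => x.2.2) H; simp only at this; omega)
    rw [this]
    simp only
    omega

/-- For incomparable cells the two diagonal coefficients add up to `1 - q`. For comparable ones the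
coefficient is `1` (in a row) or `-q` (in a column), so both sides vanish. -/
theorem StdSeq.cellOff_mul_cellOff (hq : q ≠ 0) {n i : ℕ} {h : ℕ → ι × ℕ × ℕ} (hh : StdSeq n h)
    (hi : i + 1 < n) (hsep : Separated w q (h i) (h (i + 1))) :
    cellOff w q (h i) (h (i + 1)) * cellOff w q (h (i + 1)) (h i) =
      (cellDiag w q (h i) (h (i + 1)) + q) * (1 - cellDiag w q (h i) (h (i + 1))) := by
  unfold cellOff
  split_ifs with h1 h2 h2
  · have := hh.le_of_cellLE _ hi _ (by omega) h2
    omega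
  · have h3 : cellDiag w q (h i) (h (i + 1)) = 1 ∨ cellDiag w q (h i) (h (i + 1)) = -q := by
      unfold cellDiag
      rw [if_pos h1.1]
      rcases hh.content_eq hi h1 with h4 | h4
      · left; rw [h4, qInteger_one, inv_one]
      · right; rw [h4, qInteger_neg hq, qInteger_one, zpow_neg_one, mul_one, inv_neg, inv_inv]
    rcases h3 with h3 | h3 <;> rw [h3] <;> ring
  · have := hh.le_of_cellLE _ hi _ (by omega) h2
    omega
  · rw [show cellDiag w q (h (i + 1)) (h i) = 1 - q - cellDiag w q (h i) (h (i + 1)) by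
      linear_combination cellDiag_add hq hsep]
    ring

/-- The hook bounds keep differences of contents within the range where `q`-integers do not vanish
and `q`-powers do not identify two parameters. -/
theorem IsDiagram.separated [DecidableEq ι] {n : ℕ} (hG : GenericParameters n w q)
    {L : Finset (ι × ℕ × ℕ)} (hL : IsDiagram L) (hn : L.card ≤ n) {x y : ι × ℕ × ℕ} (hx : x ∈ L)
    (hy : y ∈ L) (hxy : x.1 = y.1 → content x ≠ content y) : Separated w q x y := by
  have h1 := hL.hook_le hx hy
  have h2 := hL.hook_le hy hx
  unfold content at hxy
  refine ⟨fun h => ?_, fun h => ?_⟩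
  · have := hxy h
    rw [if_pos h] at h1
    rw [if_pos h.symm] at h2
    unfold content
    refine hG.qInteger_ne_zero ?_ ?_ ?_ <;> omega
  · rw [if_neg h] at h1
    rw [if_neg (Ne.symm h)] at h2
    have := hG.ratio_ne_zpow (Ne.symm h) (k := content y - content x) (by unfold content; omega)
      (by unfold content; omega)
    intro H
    apply this
    have h3 : w y.1 = residue w q y * q ^ content y := by
      rw [residue, mul_assoc, ← zpow_add₀ hG.q_ne, neg_add_cancel, zpow_zero, mul_one]
    rw [h3, sub_eq_zero.1 H, residue, mul_assoc, ← zpow_add₀ hG.q_ne, mul_comm]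
    congr 2
    ring

theorem StdSeq.separated {n : ℕ} (hG : GenericParameters n w q) {h : ℕ → ι × ℕ × ℕ}
    (hh : StdSeq n h) {i j : ℕ} (hij : i < j) (hj : j < n) (hji : j ≤ i + 2) :
    Separated w q (h i) (h j) := by
  classical
  exact hh.isDiagram.separated hG hh.card_shape.le (mem_shape_of_lt (by omega)) (mem_shape_of_lt hj)
    (hh.content_ne hij hj hji)

end Coefficients

/-! ### Hecke relations on an invariant subspace -/

/-- The operators `T i`, `i < n`, preserve the subspace `p` and satisfy the relations of the
cyclotomic Hecke algebra on it. -/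
structure HeckeOn {V : Type*} [AddCommGroup V] [Module ℂ V] {ι : Type*} [Fintype ι] (n : ℕ)
    (w : ι → ℂ) (q : ℂ) (T : ℕ → Module.End ℂ V) (p : Submodule ℂ V) : Prop where
  mem : ∀ i < n, ∀ x ∈ p, T i x ∈ p
  comm : ∀ i j, i + 1 < j → j < n → ∀ x ∈ p, T i (T j x) = T j (T i x)
  braid : ∀ i, 1 ≤ i → i + 1 < n → ∀ x ∈ p,
    T i (T (i + 1) (T i x)) = T (i + 1) (T i (T (i + 1) x))
  braid_four : 1 < n → ∀ x ∈ p, T 0 (T 1 (T 0 (T 1 x))) = T 1 (T 0 (T 1 (T 0 x)))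
  cyclotomic : 0 < n → ∀ x ∈ p,
    Polynomial.aeval (T 0) (∏ x, (Polynomial.X - Polynomial.C (w x))) x = 0
  quadratic : ∀ i, 1 ≤ i → i < n → ∀ x ∈ p, T i (T i x) = (1 - q) • T i x + q • x

section HeckeOn

variable {V : Type*} [AddCommGroup V] [Module ℂ V] {ι : Type*} [Fintype ι] {n : ℕ} {w : ι → ℂ}
  {q : ℂ} {T : ℕ → Module.End ℂ V}

theorem aeval_mul_X_apply (f : Module.End ℂ V) (P : Polynomial ℂ) (x : V) :
    Polynomial.aeval f (P * Polynomial.X) x = Polynomial.aeval f P (f x) := by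
  rw [map_mul, Polynomial.aeval_X, Module.End.mul_apply]

theorem HeckeFamily.heckeOn (h : HeckeFamily n w q T) : HeckeOn n w q T ⊤ where
  mem _ _ _ _ := trivial
  comm i j hij hj x _ := LinearMap.congr_fun (h.comm i j hij hj) x
  braid i hi hj x _ := LinearMap.congr_fun (h.braid i hi hj) x
  braid_four hn x _ := LinearMap.congr_fun (h.braid_four hn) x
  cyclotomic hn x _ := LinearMap.congr_fun (h.cyclotomic hn) x
  quadratic i hi hn x _ := LinearMap.congr_fun (h.quadratic i hi hn) x

theorem HeckeOn.of_le {p p' : Submodule ℂ V} (h : HeckeOn n w q T p) (hp : p' ≤ p)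
    (hmem : ∀ i < n, ∀ x ∈ p', T i x ∈ p') : HeckeOn n w q T p' where
  mem := hmem
  comm i j hij hj x hx := h.comm i j hij hj x (hp hx)
  braid i hi hj x hx := h.braid i hi hj x (hp hx)
  braid_four hn x hx := h.braid_four hn x (hp hx)
  cyclotomic hn x hx := h.cyclotomic hn x (hp hx)
  quadratic i hi hn x hx := h.quadratic i hi hn x (hp hx)

theorem HeckeOn.prod {V' : Type*} [AddCommGroup V'] [Module ℂ V'] {T' : ℕ → Module.End ℂ V'}
    {p : Submodule ℂ V} {p' : Submodule ℂ V'} (h : HeckeOn n w q T p) (h' : HeckeOn n w q T' p') :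
    HeckeOn n w q (fun i => (T i).prodMap (T' i)) (p.prod p') where
  mem i hi x hx := ⟨h.mem i hi _ hx.1, h'.mem i hi _ hx.2⟩
  comm i j hij hj x hx := Prod.ext (h.comm i j hij hj _ hx.1) (h'.comm i j hij hj _ hx.2)
  braid i hi hj x hx := Prod.ext (h.braid i hi hj _ hx.1) (h'.braid i hi hj _ hx.2)
  braid_four hn x hx := Prod.ext (h.braid_four hn _ hx.1) (h'.braid_four hn _ hx.2)
  cyclotomic hn x hx := by
    have key : ∀ (P : Polynomial ℂ) (x : V × V'), Polynomial.aeval ((T 0).prodMap (T' 0)) P x =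
        (Polynomial.aeval (T 0) P x.1, Polynomial.aeval (T' 0) P x.2) := by
      intro P
      induction P using Polynomial.induction_on with
      | C a => intro x; ext <;> simp [Algebra.algebraMap_eq_smul_one]
      | add a b ha hb => intro x; simp only [map_add, LinearMap.add_apply, ha, hb]; rfl
      | monomial k a h =>
        intro x
        rw [pow_succ, ← mul_assoc, aeval_mul_X_apply, aeval_mul_X_apply, aeval_mul_X_apply, h]
        rfl
    rw [key, h.cyclotomic hn _ hx.1, h'.cyclotomic hn _ hx.2]
    rfl
  quadratic i hi hn x hx := Prod.ext (h.quadratic i hi hn _ hx.1) (h'.quadratic i hi hn _ hx.2)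

/-- The operators of a family induced on an invariant subspace. -/
noncomputable def restrictFamily (T : ℕ → Module.End ℂ V) (p : Submodule ℂ V) (i : ℕ) :
    Module.End ℂ p :=
  open Classical in if h : ∀ x ∈ p, T i x ∈ p then (T i).restrict h else 0

theorem HeckeOn.coe_restrictFamily {p : Submodule ℂ V} (h : HeckeOn n w q T p) {i : ℕ} (hi : i < n)
    (x : p) : (restrictFamily T p i x : V) = T i x := by
  rw [restrictFamily, dif_pos (h.mem i hi)]
  rfl

/-- The seminormal operators satisfy the relations only on standard sequences; restriction makes
them a genuine representation. -/
theorem HeckeOn.heckeFamily {p : Submodule ℂ V} (h : HeckeOn n w q T p) :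
    HeckeFamily n w q (restrictFamily T p) where
  comm i j hij hj := by
    ext x
    simp only [Module.End.mul_apply, h.coe_restrictFamily hj,
      h.coe_restrictFamily (show i < n by omega)]
    exact h.comm i j hij hj x x.2
  braid i hi hj := by
    ext x
    simp only [Module.End.mul_apply, h.coe_restrictFamily hj,
      h.coe_restrictFamily (show i < n by omega)]
    exact h.braid i hi hj x x.2
  braid_four hn := by
    ext x
    simp only [Module.End.mul_apply, h.coe_restrictFamily hn,
      h.coe_restrictFamily (show 0 < n by omega)]
    exact h.braid_four hn x x.2
  cyclotomic hn := by
    have key : ∀ (P : Polynomial ℂ) (x : p), (Polynomial.aeval (restrictFamily T p 0) P x : V) =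
        Polynomial.aeval (T 0) P x := by
      intro P
      induction P using Polynomial.induction_on with
      | C a => intro x; simp [Algebra.algebraMap_eq_smul_one]
      | add a b ha hb => intro x; simp only [map_add, LinearMap.add_apply, Submodule.coe_add, ha, hb]
      | monomial k a H =>
        intro x
        rw [pow_succ, ← mul_assoc, aeval_mul_X_apply, aeval_mul_X_apply, H,
          h.coe_restrictFamily hn]
    ext x
    rw [key, h.cyclotomic hn x x.2]
    rfl
  quadratic i hi hn := by
    ext x
    simp only [Module.End.mul_apply, LinearMap.add_apply, LinearMap.smul_apply, Module.End.one_apply,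
      Submodule.coe_add, Submodule.coe_smul, h.coe_restrictFamily hn]
    exact h.quadratic i hi hn x x.2

end HeckeOn

/-! ### The Hecke relations for the seminormal operators -/

section Seminormal

open Finsupp

variable {ι : Type} (w : ι → ℂ) (q : ℂ)

/-- The operators of the seminormal form on sequences of cells. -/
noncomputable def seminormal : ℕ → Module.End ℂ ((ℕ → ι × ℕ × ℕ) →₀ ℂ)
  | 0 => Finsupp.linearCombination ℂ fun h => w (h 0).1 • single h (1 : ℂ)
  | i + 1 => exchange (cellDiag w q) (cellOff w q) i

variable {w q}

theorem seminormal_zero_single (h : ℕ → ι × ℕ × ℕ) :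
    seminormal w q 0 (single h 1) = w (h 0).1 • single h (1 : ℂ) := by
  simp [seminormal]

theorem seminormal_succ_single (i : ℕ) (h : ℕ → ι × ℕ × ℕ) :
    seminormal w q (i + 1) (single h 1) = cellDiag w q (h i) (h (i + 1)) • single h (1 : ℂ) +
      cellOff w q (h i) (h (i + 1)) • single (h ∘ Equiv.swap i (i + 1)) (1 : ℂ) :=
  exchange_single _ _ _ _

theorem seminormal_comm_single {i j : ℕ} (hij : i + 1 < j) (h : ℕ → ι × ℕ × ℕ) :
    seminormal w q i (seminormal w q j (single h 1)) =
      seminormal w q j (seminormal w q i (single h 1)) := by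
  rcases i with _ | i <;> rcases j with _ | j
  any_goals omega
  · have h0 : Equiv.swap j (j + 1) 0 = 0 :=
      Equiv.swap_apply_of_ne_of_ne (by omega) (by omega)
    simp only [seminormal_zero_single, seminormal_succ_single, map_add, map_smul,
      Function.comp_apply, h0]
    module
  · exact exchange_comm_single _ _ (by omega) h

variable {n : ℕ} (hG : GenericParameters n w q)

include hG in
theorem seminormal_quadratic_single {h : ℕ → ι × ℕ × ℕ} (hh : StdSeq n h) {i : ℕ} (hi : i + 1 < n) :
    seminormal w q (i + 1) (seminormal w q (i + 1) (single h 1)) =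
      (1 - q) • seminormal w q (i + 1) (single h 1) + q • single h 1 := by
  have hs := hh.separated hG (Nat.lt_succ_self i) hi (by omega)
  refine exchange_quadratic_single _ _ q i h ?_ (hh.cellOff_mul_cellOff hG.q_ne hi hs)
  rw [cellDiag_add hG.q_ne hs, sub_self, mul_zero]

/-- The conditions of `exchange_braid_single` are multiples of the three-term relation, once the
products of off-diagonal coefficients are expressed through diagonal ones. -/
theorem seminormal_braid_single (hG : GenericParameters n w q) {h : ℕ → ι × ℕ × ℕ}
    (hh : StdSeq n h) {i : ℕ} (hi : i + 2 < n) :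
    seminormal w q (i + 1) (seminormal w q (i + 2) (seminormal w q (i + 1) (single h 1))) =
      seminormal w q (i + 2) (seminormal w q (i + 1) (seminormal w q (i + 2) (single h 1))) := by
  have hq := hG.q_ne
  have s1 := hh.separated hG (Nat.lt_succ_self i) (by omega) (by omega)
  have s2 := hh.separated hG (Nat.lt_succ_self (i + 1)) hi (by omega)
  have s3 := hh.separated hG (show i < i + 2 by omega) hi le_rfl
  have r1 := cellDiag_add hq s1
  have r2 := cellDiag_add hq s2
  have r3 := cellDiag_mul hq s1 s2 s3
  have n1 := hh.cellOff_mul_cellOff hq (by omega) s1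
  have n2 := hh.cellOff_mul_cellOff hq (show i + 1 + 1 < n from hi) s2
  simp only [show i + 1 + 1 = i + 2 by omega, Nat.succ_eq_add_one] at r1 r2 r3 n1 n2
  refine exchange_braid_single _ _ i h rfl rfl rfl ?_ ?_ ?_
  · linear_combination cellOff w q (h i) (h (i + 1)) * (r3 + cellDiag w q (h i) (h (i + 2)) * r1)
  · linear_combination cellOff w q (h (i + 1)) (h (i + 2)) *
      (-r3 - cellDiag w q (h i) (h (i + 2)) * r2)
  · rw [n1, n2]
    linear_combination (cellDiag w q (h i) (h (i + 1)) - cellDiag w q (h (i + 1)) (h (i + 2))) * r3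

/-- A cell off the corner needs an earlier cell of its own diagram, so the first two letters occupy
corners when their diagrams differ. -/
theorem StdSeq.content_eq_zero {h : ℕ → ι × ℕ × ℕ} (hh : StdSeq n h) (hn : 1 < n)
    (h01 : (h 0).1 ≠ (h 1).1) : content (h 0) = 0 ∧ content (h 1) = 0 := by
  constructor
  · obtain ⟨a, ha, h1⟩ := hh.exists_eq 0 (by omega) ((h 0).1, 0, 0)
      (CellLE.mk rfl (Nat.zero_le _) (Nat.zero_le _))
    have := hh.le_of_cellLE a ha 0 (by omega) (h1 ▸ CellLE.mk rfl (Nat.zero_le _) (Nat.zero_le _))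
    rw [Nat.le_zero.1 this] at h1
    rw [h1]; rfl
  · obtain ⟨a, ha, h1⟩ := hh.exists_eq 1 hn ((h 1).1, 0, 0)
      (CellLE.mk rfl (Nat.zero_le _) (Nat.zero_le _))
    have := hh.le_of_cellLE a ha 1 hn (h1 ▸ CellLE.mk rfl (Nat.zero_le _) (Nat.zero_le _))
    rcases Nat.le_one_iff_eq_zero_or_eq_one.1 this with rfl | rfl
    · exact absurd (congrArg Prod.fst h1) h01
    · rw [h1]; rfl

theorem seminormal_braid_four_single (hG : GenericParameters n w q) {h : ℕ → ι × ℕ × ℕ}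
    (hh : StdSeq n h) (hn : 1 < n) :
    seminormal w q 0 (seminormal w q 1 (seminormal w q 0 (seminormal w q 1 (single h 1)))) =
      seminormal w q 1 (seminormal w q 0 (seminormal w q 1 (seminormal w q 0 (single h 1)))) := by
  have hs := comp_swap_swap h 0
  have h1 := fun h => seminormal_succ_single (w := w) (q := q) 0 h
  simp only [zero_add] at h1 hs
  -- Only the coefficient of the exchanged sequence is in question. In one diagram `T₁` acts by the
  -- same scalar on both sequences; in different diagrams the contents are `0` and the formula for
  -- the diagonal coefficient applies.
  have key : (w (h 1).1 - w (h 0).1) * (cellDiag w q (h 0) (h 1) * w (h 0).1 +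
      cellDiag w q (h 1) (h 0) * w (h 1).1) = 0 := by
    by_cases h01 : (h 0).1 = (h 1).1
    · rw [h01, sub_self, zero_mul]
    · have s := hh.separated hG (show 0 < 1 by omega) hn (by omega)
      obtain ⟨c0, c1⟩ := hh.content_eq_zero hn h01
      have r0 := cellDiag_mul_sub hG.q_ne s
      have r1 := cellDiag_add hG.q_ne s
      simp only [residue, c0, c1, neg_zero, zpow_zero, mul_one] at r0
      linear_combination (w (h 1).1 - w (h 0).1) * (w (h 1).1 * r1 - r0)
  simp only [h1, seminormal_zero_single, map_add, map_smul, Function.comp_apply, hs,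
    Equiv.swap_apply_left, Equiv.swap_apply_right]
  linear_combination (norm := module)
    (cellOff w q (h 0) (h 1) * key) • (single (h ∘ Equiv.swap 0 1) (1 : ℂ))

theorem seminormal_cyclotomic [Fintype ι] :
    Polynomial.aeval (seminormal w q 0) (∏ x, (Polynomial.X - Polynomial.C (w x))) = 0 := by
  refine Finsupp.lhom_ext' fun h => LinearMap.ext_ring ?_
  simp only [LinearMap.comp_apply, lsingle_apply, LinearMap.zero_apply]
  rw [Module.End.aeval_apply_of_hasEigenvector (μ := w (h 0).1)]
  · rw [Polynomial.eval_prod, Finset.prod_eq_zero (Finset.mem_univ (h 0).1) (by simp), zero_smul]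
  · exact Module.End.hasEigenvector_iff.2 ⟨Module.End.mem_eigenspace_iff.2 (seminormal_zero_single h),
      by simp⟩

theorem cellOff_smul_mem {p : Submodule ℂ ((ℕ → ι × ℕ × ℕ) →₀ ℂ)} {h : ℕ → ι × ℕ × ℕ} {i : ℕ}
    (H : ¬ CellLE (h i) (h (i + 1)) → single (h ∘ Equiv.swap i (i + 1)) (1 : ℂ) ∈ p) :
    cellOff w q (h i) (h (i + 1)) • single (h ∘ Equiv.swap i (i + 1)) (1 : ℂ) ∈ p := by
  by_cases hle : CellLE (h i) (h (i + 1))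
  · rw [cellOff, if_pos hle, zero_smul]
    exact p.zero_mem
  · exact p.smul_mem _ (H hle)

/-- The span of the standard sequences. -/
def stdSpan (ι : Type) (n : ℕ) : Submodule ℂ ((ℕ → ι × ℕ × ℕ) →₀ ℂ) :=
  Finsupp.supported ℂ ℂ {h | StdSeq n h}

theorem stdSpan_eq_span (n : ℕ) : stdSpan ι n =
    Submodule.span ℂ ((fun h => single h (1 : ℂ)) '' {h | StdSeq n h}) :=
  Finsupp.supported_eq_span_single ℂ _

theorem single_mem_stdSpan {h : ℕ → ι × ℕ × ℕ} (hh : StdSeq n h) :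
    single h (1 : ℂ) ∈ stdSpan ι n :=
  Finsupp.single_mem_supported ℂ 1 hh

theorem seminormal_mem_stdSpan (w : ι → ℂ) (q : ℂ) {i : ℕ} (hi : i < n) :
    ∀ x ∈ stdSpan ι n, seminormal w q i x ∈ stdSpan ι n := by
  rw [stdSpan_eq_span]
  intro x hx
  refine (Submodule.span_le (p := (Submodule.span ℂ _).comap (seminormal w q i))).2 ?_ hx
  rw [← stdSpan_eq_span]
  rintro _ ⟨h, hh, rfl⟩
  change seminormal w q i (single h 1) ∈ stdSpan ι n
  rcases i with _ | i
  · rw [seminormal_zero_single]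
    exact Submodule.smul_mem _ _ (single_mem_stdSpan hh)
  · rw [seminormal_succ_single]
    exact add_mem (Submodule.smul_mem _ _ (single_mem_stdSpan hh))
      (cellOff_smul_mem fun hle => single_mem_stdSpan (StdSeq.swap hh hi hle))

theorem eq_on_stdSpan {f g : Module.End ℂ ((ℕ → ι × ℕ × ℕ) →₀ ℂ)}
    (H : ∀ h, StdSeq n h → f (single h 1) = g (single h 1)) : ∀ x ∈ stdSpan ι n, f x = g x := by
  intro x hx
  rw [stdSpan_eq_span] at hx
  refine LinearMap.eqOn_span (f := f) (g := g) ?_ hx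
  rintro _ ⟨h, hh, rfl⟩
  exact H h hh

theorem heckeOn_seminormal [Fintype ι] (hG : GenericParameters n w q) :
    HeckeOn n w q (seminormal w q) (stdSpan ι n) where
  mem i hi x hx := seminormal_mem_stdSpan w q hi x hx
  comm i j hij _ := eq_on_stdSpan (f := seminormal w q i * seminormal w q j)
      (g := seminormal w q j * seminormal w q i)
      (fun h _ => seminormal_comm_single hij h)
  braid i hi hj := by
    obtain ⟨i, rfl⟩ : ∃ k, i = k + 1 := ⟨i - 1, by omega⟩
    exact eq_on_stdSpan
      (f := seminormal w q (i + 1) * seminormal w q (i + 2) * seminormal w q (i + 1))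
      (g := seminormal w q (i + 2) * seminormal w q (i + 1) * seminormal w q (i + 2))
      (fun h hh => seminormal_braid_single hG hh hj)
  braid_four hn := eq_on_stdSpan
      (f := seminormal w q 0 * seminormal w q 1 * seminormal w q 0 * seminormal w q 1)
      (g := seminormal w q 1 * seminormal w q 0 * seminormal w q 1 * seminormal w q 0)
      (fun h hh => seminormal_braid_four_single hG hh hn)
  cyclotomic _ x _ := by rw [seminormal_cyclotomic]; rfl
  quadratic i hi hin := by
    obtain ⟨i, rfl⟩ : ∃ k, i = k + 1 := ⟨i - 1, by omega⟩
    exact eq_on_stdSpan (f := seminormal w q (i + 1) * seminormal w q (i + 1))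
      (g := (1 - q) • seminormal w q (i + 1) + q • 1)
      (fun h hh => seminormal_quadratic_single hG hh hin)

end Seminormal

/-! ### Matrix units -/

section MatrixUnits

open Finsupp

variable {ι : Type} {w : ι → ℂ} {q : ℂ} {n : ℕ}

theorem GenericParameters.residue_ne (hG : GenericParameters n w q) {x y : ι × ℕ × ℕ}
    (hxy : x.1 ≠ y.1) {k : ℤ} (h1 : content y - content x + k < n)
    (h2 : -(n : ℤ) < content y - content x + k) : residue w q y ≠ q ^ k * residue w q x := by
  intro H
  refine hG.ratio_ne_zpow hxy.symm h1 h2 ?_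
  have h3 : w y.1 = residue w q y * q ^ content y := by
    rw [residue, mul_assoc, ← zpow_add₀ hG.q_ne, neg_add_cancel, zpow_zero, mul_one]
  rw [h3, H, residue, mul_right_comm, mul_left_comm, ← zpow_add₀ hG.q_ne]
  rw [← zpow_add₀ hG.q_ne, mul_comm]
  congr 2
  ring

/-- Clearing denominators, the coefficient vanishes only if the `q`-integer of one plus the
difference of contents is zero, or, for different diagrams, if one residue is `q` times the other.
The hook bounds leave room for this extra unit. -/
theorem GenericParameters.cellOff_ne_zero [DecidableEq ι] (hG : GenericParameters n w q)
    {L : Finset (ι × ℕ × ℕ)} (hL : IsDiagram L) (hn : L.card ≤ n) {x y : ι × ℕ × ℕ} (hx : x ∈ L)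
    (hy : y ∈ L) (hxy : ¬ CellLE x y) (hyx : ¬ CellLE y x) : cellOff w q x y ≠ 0 := by
  have h1 := hL.hook_le hx hy
  have h2 := hL.hook_le hy hx
  rw [cellOff, if_neg hxy, cellDiag]
  split_ifs with h
  · rw [if_pos h] at h1
    rw [if_pos h.symm] at h2
    have hc : (x.2.1 < y.2.1 ∧ y.2.2 < x.2.2) ∨ (y.2.1 < x.2.1 ∧ x.2.2 < y.2.2) := by
      by_contra! H
      rcases lt_trichotomy x.2.1 y.2.1 with h3 | h3 | h3
      · exact hxy (CellLE.mk h h3.le (H.1 h3))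
      · rcases le_total x.2.2 y.2.2 with h4 | h4
        · exact hxy (CellLE.mk h h3.le h4)
        · exact hyx (CellLE.mk h.symm h3.ge h4)
      · exact hyx (CellLE.mk h.symm h3.le (H.2 h3))
    have h3 : qInteger q (content y - content x) ≠ 0 := by
      refine hG.qInteger_ne_zero ?_ ?_ ?_ <;> unfold content <;> omega
    have h4 : qInteger q (1 + (content y - content x)) ≠ 0 := by
      refine hG.qInteger_ne_zero ?_ ?_ ?_ <;> unfold content <;> omega
    rw [qInteger_add hG.q_ne, qInteger_one, zpow_one] at h4
    intro H
    apply h4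
    field_simp at H
    linear_combination H
  · rw [if_neg h] at h1
    rw [if_neg (Ne.symm h)] at h2
    have h3 := hG.residue_ne h (k := 0) (by unfold content; omega) (by unfold content; omega)
    have h4 := hG.residue_ne h (k := 1) (by unfold content; omega) (by unfold content; omega)
    rw [zpow_zero, one_mul] at h3
    rw [zpow_one] at h4
    have h5 := sub_ne_zero.2 h3
    intro H
    apply h4
    field_simp at H
    linear_combination H

variable (w q) in
/-- The algebra of operators generated by the first `n` seminormal operators. -/
noncomputable def seminormalAlgebra (n : ℕ) :
    Subalgebra ℂ (Module.End ℂ ((ℕ → ι × ℕ × ℕ) →₀ ℂ)) :=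
  Algebra.adjoin ℂ {E | ∃ i < n, seminormal w q i = E}

theorem seminormal_mem_seminormalAlgebra {i : ℕ} (hi : i < n) :
    seminormal w q i ∈ seminormalAlgebra w q n :=
  Algebra.subset_adjoin ⟨i, hi, rfl⟩

theorem seminormalAlgebra_mono {m : ℕ} (hm : m ≤ n) :
    seminormalAlgebra w q m ≤ seminormalAlgebra w q n :=
  Algebra.adjoin_mono fun _ ⟨i, hi, h⟩ => ⟨i, hi.trans_le hm, h⟩

theorem apply_mem_of_mem_seminormalAlgebra {U : Submodule ℂ ((ℕ → ι × ℕ × ℕ) →₀ ℂ)}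
    (hU : ∀ i < n, ∀ x ∈ U, seminormal w q i x ∈ U) {E : Module.End ℂ ((ℕ → ι × ℕ × ℕ) →₀ ℂ)}
    (hE : E ∈ seminormalAlgebra w q n) : ∀ x ∈ U, E x ∈ U := by
  induction hE using Algebra.adjoin_induction with
  | mem E hE =>
    obtain ⟨i, hi, rfl⟩ := hE
    exact hU i hi
  | algebraMap c =>
    intro x hx
    rw [Module.algebraMap_end_apply]
    exact U.smul_mem c hx
  | add E F _ _ hE hF => exact fun x hx => U.add_mem (hE x hx) (hF x hx)
  | mul E F _ _ hE hF => exact fun x hx => hE _ (hF x hx)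

variable (w q) in
/-- The Jucys-Murphy operators. -/
noncomputable def jucysMurphy : ℕ → Module.End ℂ ((ℕ → ι × ℕ × ℕ) →₀ ℂ)
  | 0 => seminormal w q 0
  | k + 1 => q⁻¹ • (seminormal w q (k + 1) * jucysMurphy k * seminormal w q (k + 1))

theorem jucysMurphy_mem {k : ℕ} (hk : k < n) : jucysMurphy w q k ∈ seminormalAlgebra w q n := by
  induction k with
  | zero => exact seminormal_mem_seminormalAlgebra hk
  | succ k ih =>
    exact Subalgebra.smul_mem _ (mul_mem (mul_mem (seminormal_mem_seminormalAlgebra hk)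
      (ih (by omega))) (seminormal_mem_seminormalAlgebra hk)) _

/-- Conjugation by the exchange moves the residue from the place `k` to `k + 1`: the off-diagonal
part cancels, and the diagonal part is `q` times the new residue. -/
theorem jucysMurphy_single (hG : GenericParameters n w q) {k : ℕ} (hk : k < n)
    {h : ℕ → ι × ℕ × ℕ} (hh : StdSeq n h) :
    jucysMurphy w q k (single h 1) = residue w q (h k) • single h 1 := by
  induction k generalizing h with
  | zero =>
    have hc : content (h 0) = 0 := by
      obtain ⟨a, ha, h1⟩ := hh.exists_eq 0 hk ((h 0).1, 0, 0)
        (CellLE.mk rfl (Nat.zero_le _) (Nat.zero_le _))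
      have := hh.le_of_cellLE a ha 0 hk (h1 ▸ CellLE.mk rfl (Nat.zero_le _) (Nat.zero_le _))
      rw [Nat.le_zero.1 this] at h1
      rw [h1]; rfl
    rw [jucysMurphy, seminormal_zero_single, residue, hc, neg_zero, zpow_zero, mul_one]
  | succ k ih =>
    have hq := hG.q_ne
    have hs := hh.separated hG (Nat.lt_succ_self k) hk (by omega)
    have r0 := cellDiag_mul_sub hq hs
    have r1 := cellDiag_add hq hs
    have r2 := hh.cellOff_mul_cellOff hq hk hs
    simp only [Nat.succ_eq_add_one] at r0 r1 r2
    have h1 := ih (by omega) hh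
    have h2 : cellOff w q (h k) (h (k + 1)) •
        jucysMurphy w q k (single (h ∘ Equiv.swap k (k + 1)) (1 : ℂ)) =
        cellOff w q (h k) (h (k + 1)) • residue w q (h (k + 1)) •
          single (h ∘ Equiv.swap k (k + 1)) (1 : ℂ) := by
      by_cases hle : CellLE (h k) (h (k + 1))
      · rw [cellOff, if_pos hle, zero_smul, zero_smul]
      · rw [ih (by omega) (hh.swap hk hle)]
        simp
    rw [jucysMurphy, LinearMap.smul_apply, Module.End.mul_apply, Module.End.mul_apply,
      seminormal_succ_single, map_add, map_smul, map_smul, h1, h2]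
    simp only [map_add, map_smul, seminormal_succ_single, Function.comp_apply, comp_swap_swap,
      Equiv.swap_apply_left, Equiv.swap_apply_right]
    have e1 : q⁻¹ * (cellDiag w q (h k) (h (k + 1)) * residue w q (h k) *
        cellDiag w q (h k) (h (k + 1)) + residue w q (h (k + 1)) *
        (cellOff w q (h k) (h (k + 1)) * cellOff w q (h (k + 1)) (h k))) =
        residue w q (h (k + 1)) := by
      rw [r2]
      field_simp
      linear_combination -cellDiag w q (h k) (h (k + 1)) * r0
    have e2 : cellDiag w q (h k) (h (k + 1)) * residue w q (h k) +
        residue w q (h (k + 1)) * cellDiag w q (h (k + 1)) (h k) = 0 := by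
      linear_combination residue w q (h (k + 1)) * r1 - r0
    linear_combination (norm := module) e1 • single h (1 : ℂ) +
      (q⁻¹ * cellOff w q (h k) (h (k + 1)) * e2) • single (h ∘ Equiv.swap k (k + 1)) (1 : ℂ)

/-- The sequence whose first `n` members are those of `g` and whose other members are those of `h`. -/
def splice {C : Type*} (n : ℕ) (g h : ℕ → C) (k : ℕ) : C := if k < n then g k else h k

theorem splice_of_lt {C : Type*} {g h : ℕ → C} {k : ℕ} (hk : k < n) : splice n g h k = g k :=
  if_pos hk

theorem splice_of_le {C : Type*} {g h : ℕ → C} {k : ℕ} (hk : n ≤ k) : splice n g h k = h k :=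
  if_neg hk.not_gt

theorem splice_splice {C : Type*} (f g h : ℕ → C) : splice n f (splice n g h) = splice n f h := by
  ext1 k
  unfold splice
  split_ifs <;> rfl

theorem splice_eq {C : Type*} {g h : ℕ → C} (H : ∀ k < n, h k = g k) : splice n g h = h := by
  ext1 k
  unfold splice
  split_ifs with hk
  · exact (H k hk).symm
  · rfl

open Classical in
/-- `E` maps the standard sequences beginning like `f` to those beginning like `g`, and annihilates
the other ones. -/
def IsMatrixUnit (n : ℕ) (f g : ℕ → ι × ℕ × ℕ) (E : Module.End ℂ ((ℕ → ι × ℕ × ℕ) →₀ ℂ)) : Prop :=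
  ∀ h, StdSeq n h → E (single h 1) =
    if ∀ k < n, h k = f k then single (splice n g h) (1 : ℂ) else 0

theorem IsMatrixUnit.apply_pos {f g : ℕ → ι × ℕ × ℕ} {E : Module.End ℂ ((ℕ → ι × ℕ × ℕ) →₀ ℂ)}
    (hE : IsMatrixUnit n f g E) {h : ℕ → ι × ℕ × ℕ} (hh : StdSeq n h) (H : ∀ k < n, h k = f k) :
    E (single h 1) = single (splice n g h) 1 := by
  rw [hE h hh, if_pos H]

theorem IsMatrixUnit.apply_neg {f g : ℕ → ι × ℕ × ℕ} {E : Module.End ℂ ((ℕ → ι × ℕ × ℕ) →₀ ℂ)}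
    (hE : IsMatrixUnit n f g E) {h : ℕ → ι × ℕ × ℕ} (hh : StdSeq n h) {k : ℕ} (hk : k < n)
    (H : h k ≠ f k) : E (single h 1) = 0 := by
  rw [hE h hh, if_neg fun h' => H (h' k hk)]

variable [DecidableEq ι]

theorem StdSeq.notMem_of_prefix {f h : ℕ → ι × ℕ × ℕ} (hh : StdSeq (n + 1) h)
    (H : ∀ k < n, h k = f k) : h n ∉ shape n f ∧ IsDiagram (insert (h n) (shape n f)) := by
  have h1 := hh.notMem_shape
  have h2 := hh.isDiagram
  rw [shape_succ] at h2
  rw [shape_congr H] at h1 h2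
  exact ⟨h1, h2⟩

theorem StdSeq.splice {g h : ℕ → ι × ℕ × ℕ} (hg : StdSeq n g) (h1 : h n ∉ shape n g)
    (h2 : IsDiagram (insert (h n) (shape n g))) : StdSeq (n + 1) (splice n g h) := by
  have hs : shape n (_root_.splice n g h) = shape n g := shape_congr fun k hk => splice_of_lt hk
  refine (hg.congr fun k hk => splice_of_lt hk).snoc ?_ ?_ <;>
    rwa [splice_of_le le_rfl, hs]

/-- Existence of matrix units for all pairs of standard sequences of the same shape. -/
def HasMatrixUnits (w : ι → ℂ) (q : ℂ) (n : ℕ) : Prop :=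
  ∀ f g : ℕ → ι × ℕ × ℕ, StdSeq n f → StdSeq n g → shape n f = shape n g →
    ∃ E ∈ seminormalAlgebra w q n, IsMatrixUnit n f g E

/-- On one diagonal of a diagram one cell is above the other, and the lower one cannot be added
before the upper one. -/
theorem content_ne_of_addable {L : Finset (ι × ℕ × ℕ)} {x y : ι × ℕ × ℕ} (hx : x ∉ L) (hy : y ∉ L)
    (hLx : IsDiagram (insert x L)) (hLy : IsDiagram (insert y L)) (hxy : x ≠ y) (h1 : x.1 = y.1) :
    content x ≠ content y := by
  intro h
  unfold content at h
  rcases le_total x.2.1 y.2.1 with h2 | h2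
  · exact hx (Finset.mem_of_mem_insert_of_ne (hLy x y (CellLE.mk h1 h2 (by omega))
      (Finset.mem_insert_self _ _)) hxy)
  · exact hy (Finset.mem_of_mem_insert_of_ne (hLx y x (CellLE.mk h1.symm h2 (by omega))
      (Finset.mem_insert_self _ _)) hxy.symm)

/-- Two cells addable to the shape of `f` can be told apart by some operator. -/
theorem exists_separating (hG : GenericParameters (n + 1) w q) (hM : HasMatrixUnits w q n)
    {f : ℕ → ι × ℕ × ℕ} (hf : StdSeq (n + 1) f) {B : ι × ℕ × ℕ} (hB : B ∉ shape n f)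
    (hB' : IsDiagram (insert B (shape n f))) (hne : f n ≠ B) :
    ∃ Z ∈ seminormalAlgebra w q (n + 1), ∃ ζ : ι × ℕ × ℕ → ℂ, ζ (f n) ≠ ζ B ∧
      ∀ h, StdSeq (n + 1) h → (∀ k < n, h k = f k) → Z (single h 1) = ζ (h n) • single h (1 : ℂ) := by
  have hf' := hf.mono (Nat.le_succ n)
  obtain ⟨hA, hA'⟩ := hf.notMem_of_prefix (fun _ _ => rfl)
  have hU := hA'.union hB'
  have hcard : (insert (f n) (shape n f) ∪ insert B (shape n f)).card ≤ n + 2 := by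
    have : insert (f n) (shape n f) ∪ insert B (shape n f) = insert (f n) (insert B (shape n f)) := by
      ext; simp only [Finset.mem_union, Finset.mem_insert]; tauto
    rw [this]
    refine (Finset.card_insert_le _ _).trans (Nat.succ_le_succ ((Finset.card_insert_le _ _).trans ?_))
    rw [hf'.card_shape]
  have h1 := (hU.hook_le (x := f n) (y := B) (by simp) (by simp)).trans hcard
  have h2 := (hU.hook_le (x := B) (y := f n) (by simp) (by simp)).trans hcard
  -- In different diagrams the residues differ, so a Jucys-Murphy operator works. In one diagram the
  -- residues may coincide, for instance when `q = 1` or the parameter is `0`; there an exchange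
  -- coefficient is used instead.
  by_cases hc : (f n).1 = B.1
  · rw [if_pos hc] at h1
    rw [if_pos hc.symm] at h2
    have h00 : ((f n).1, 0, 0) ∈ shape n f := by
      have m1 := hA' ((f n).1, 0, 0) (f n) (CellLE.mk rfl (Nat.zero_le _) (Nat.zero_le _))
        (Finset.mem_insert_self _ _)
      have m2 := hB' ((f n).1, 0, 0) B (CellLE.mk hc (Nat.zero_le _) (Nat.zero_le _))
        (Finset.mem_insert_self _ _)
      rcases Finset.mem_insert.1 m1 with m1 | m1
      · exact Finset.mem_of_mem_insert_of_ne m2 (m1 ▸ hne)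
      · exact m1
    obtain ⟨x, hx, hx1, hx2⟩ := hf'.isDiagram.exists_removable h00
    obtain ⟨m, rfl⟩ : ∃ m, n = m + 1 := by
      refine ⟨n - 1, ?_⟩
      obtain ⟨a, ha, -⟩ := mem_shape.1 h00
      omega
    -- The distinguished cell only continues finite tableaux to infinite sequences, so any index
    -- will do.
    have : Inhabited ι := ⟨(f 0).1⟩
    obtain ⟨g, ⟨hg, hgs, -⟩, hgx⟩ := exists_tableau_last hf'.card_shape hx hf'.isDiagram hx2
    obtain ⟨E, hE, hE'⟩ := hM f g hf' hg hgs.symm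
    obtain ⟨F, hF, hF'⟩ := hM g f hg hf' hgs
    -- Change the prefix `f` into `g`, which ends in a removable cell `x` of the same diagram,
    -- exchange the last two letters, and change back. The resulting scalar is the diagonal
    -- coefficient at `x` and the new cell, and its inverse `q`-integer determines the content.
    refine ⟨F * seminormal w q (m + 1) * E, mul_mem (mul_mem
      (seminormalAlgebra_mono (Nat.le_succ _) hF) (seminormal_mem_seminormalAlgebra (by omega)))
      (seminormalAlgebra_mono (Nat.le_succ _) hE), fun c => cellDiag w q x c, ?_, fun h hh H => ?_⟩
    · have hx1 : x.1 = (f (m + 1)).1 := hx1.1.symm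
      simp only [cellDiag]
      rw [if_pos hx1, if_pos (hx1.trans hc)]
      intro h
      have h := inv_injective h
      rw [show content (f (m + 1)) - content x = content B - content x +
        (content (f (m + 1)) - content B) by ring, qInteger_add hG.q_ne, add_eq_left,
        mul_eq_zero] at h
      refine h.elim (zpow_ne_zero _ hG.q_ne) (hG.qInteger_ne_zero ?_ ?_ ?_)
      · exact sub_ne_zero.2 (content_ne_of_addable hA hB hA' hB' hne hc)
      · unfold content; push_cast; omega
      · unfold content; push_cast; omega
    · obtain ⟨p1, p2⟩ := hh.notMem_of_prefix H
      rw [← hgs] at p1 p2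
      have hs := hg.splice p1 p2
      rw [Module.End.mul_apply, Module.End.mul_apply,
        hE'.apply_pos (hh.mono (Nat.le_succ _)) H, seminormal_succ_single, map_add, map_smul,
        map_smul, hF'.apply_pos (hs.mono (Nat.le_succ _)) (fun k hk => splice_of_lt hk),
        splice_splice, splice_eq H, splice_of_lt (Nat.lt_succ_self m), splice_of_le le_rfl, hgx]
      -- The exchanged sequence has the new cell instead of `x` at the place `m`, so its prefix is
      -- not `g` and `F` kills it.
      by_cases hle : CellLE x (h (m + 1))
      · rw [cellOff, if_pos hle, zero_smul, add_zero]
      · rw [hF'.apply_neg (k := m), smul_zero, add_zero]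
        · refine StdSeq.mono (StdSeq.swap hs (by omega) ?_) (Nat.le_succ _)
          rwa [splice_of_lt (Nat.lt_succ_self m), splice_of_le le_rfl, hgx]
        · omega
        · rw [Function.comp_apply, Equiv.swap_apply_left, splice_of_le le_rfl]
          intro h3
          exact p1 (h3 ▸ mem_shape_of_lt (Nat.lt_succ_self m))
  · rw [if_neg hc] at h1
    rw [if_neg (Ne.symm hc)] at h2
    refine ⟨jucysMurphy w q n, jucysMurphy_mem (Nat.lt_succ_self n), residue w q, fun h => ?_,
      fun h hh _ => jucysMurphy_single hG (Nat.lt_succ_self n) hh⟩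
    refine hG.residue_ne hc (k := 0) ?_ ?_ ?_
    · unfold content; push_cast; omega
    · unfold content; push_cast; omega
    · rw [zpow_zero, one_mul, h]

variable [Fintype ι]

open Classical in
/-- The cells that can be added to a family of diagrams. -/
noncomputable def addable (L : Finset (ι × ℕ × ℕ)) : Finset (ι × ℕ × ℕ) :=
  (Finset.univ ×ˢ (Finset.range (L.card + 1) ×ˢ Finset.range (L.card + 1))).filter
    fun x => x ∉ L ∧ IsDiagram (insert x L)

theorem mem_addable {L : Finset (ι × ℕ × ℕ)} {x : ι × ℕ × ℕ} :
    x ∈ addable L ↔ x ∉ L ∧ IsDiagram (insert x L) := by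
  unfold addable
  rw [@Finset.mem_filter, and_iff_right_iff_imp]
  rintro ⟨h1, h2⟩
  -- The hook bound puts every addable cell into the finite box used in the definition.
  have := h2.hook_le (Finset.mem_insert_self x L) (Finset.mem_insert_self x L)
  rw [if_pos rfl, Finset.card_insert_of_notMem h1] at this
  simp only [Finset.mem_product, Finset.mem_univ, Finset.mem_range, true_and]
  omega

/-- Lagrange interpolation: multiply, over the cells `B` of `s`, the separating operators shifted to
vanish at `B` and normalized to be `1` at `f n`. -/
theorem exists_diagonal (hG : GenericParameters (n + 1) w q) (hM : HasMatrixUnits w q n)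
    {f : ℕ → ι × ℕ × ℕ} (hf : StdSeq (n + 1) f) (s : Finset (ι × ℕ × ℕ))
    (hs : ∀ B ∈ s, B ∈ addable (shape n f) ∧ f n ≠ B) :
    ∃ Z ∈ seminormalAlgebra w q (n + 1), ∃ ζ : ι × ℕ × ℕ → ℂ, ζ (f n) = 1 ∧ (∀ B ∈ s, ζ B = 0) ∧
      ∀ h, StdSeq (n + 1) h → (∀ k < n, h k = f k) → Z (single h 1) = ζ (h n) • single h (1 : ℂ) := by
  induction s using Finset.induction_on with
  | empty => exact ⟨1, one_mem _, fun _ => 1, rfl, by simp, by simp⟩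
  | insert B s _ ih =>
    obtain ⟨Z, hZ, ζ, h1, h2, h3⟩ := ih fun B hB => hs B (Finset.mem_insert_of_mem hB)
    obtain ⟨hB, hne⟩ := hs B (Finset.mem_insert_self _ _)
    rw [mem_addable] at hB
    obtain ⟨Y, hY, η, h4, h5⟩ := exists_separating hG hM hf hB.1 hB.2 hne
    refine ⟨(η (f n) - η B)⁻¹ • ((Y + (-η B) • 1) * Z), Subalgebra.smul_mem _ (mul_mem
      (add_mem hY (Subalgebra.smul_mem _ (one_mem _) _)) hZ) _,
      fun c => (η (f n) - η B)⁻¹ * (η c - η B) * ζ c, ?_, fun c hc => ?_, fun h hh H => ?_⟩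
    · simp only [h1, mul_one]
      exact inv_mul_cancel₀ (sub_ne_zero.2 h4)
    · rcases Finset.mem_insert.1 hc with rfl | hc
      · simp
      · simp [h2 c hc]
    · rw [LinearMap.smul_apply, Module.End.mul_apply, h3 h hh H, map_smul, LinearMap.add_apply,
        h5 h hh H, LinearMap.smul_apply, Module.End.one_apply]
      module

/-- First project to the prefix of length `n`, then to the last cell. Given the prefix, the last
cell is one of the finitely many addable cells, which `exists_diagonal` separates. -/
theorem exists_matrixUnit_self (hG : GenericParameters (n + 1) w q) (hM : HasMatrixUnits w q n)
    {f : ℕ → ι × ℕ × ℕ} (hf : StdSeq (n + 1) f) :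
    ∃ E ∈ seminormalAlgebra w q (n + 1), IsMatrixUnit (n + 1) f f E := by
  have hf' := hf.mono (Nat.le_succ n)
  obtain ⟨Z, hZ, ζ, h1, h2, h3⟩ := exists_diagonal hG hM hf ((addable (shape n f)).erase (f n))
    fun B hB => ⟨Finset.mem_of_mem_erase hB, (Finset.ne_of_mem_erase hB).symm⟩
  obtain ⟨E, hE, hE'⟩ := hM f f hf' hf' rfl
  refine ⟨Z * E, mul_mem hZ (seminormalAlgebra_mono (Nat.le_succ n) hE), fun h hh => ?_⟩
  rw [Module.End.mul_apply]
  by_cases H : ∀ k < n, h k = f k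
  · rw [hE'.apply_pos (hh.mono (Nat.le_succ n)) H, splice_eq H, h3 h hh H]
    by_cases hn : h n = f n
    · have H' : ∀ k < n + 1, h k = f k := fun k hk =>
        (Nat.lt_succ_iff_lt_or_eq.1 hk).elim (H k) fun h' => h' ▸ hn
      rw [if_pos H', splice_eq H', hn, h1, one_smul]
    · rw [if_neg fun H' => hn (H' n (Nat.lt_succ_self n)), h2, zero_smul]
      exact Finset.mem_erase.2 ⟨hn, mem_addable.2 (hh.notMem_of_prefix H)⟩
  · rw [if_neg fun H' => H fun k hk => H' k (by omega), hE' h (hh.mono (Nat.le_succ n)), if_neg H,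
      map_zero]

/-- With equal last cells the prefixes have equal shape, so a matrix unit of level `n` applied after
the projection to `f` suffices. -/
theorem exists_matrixUnit_of_eq (hG : GenericParameters (n + 1) w q) (hM : HasMatrixUnits w q n)
    {f g : ℕ → ι × ℕ × ℕ} (hf : StdSeq (n + 1) f) (hg : StdSeq (n + 1) g)
    (hfg : shape (n + 1) f = shape (n + 1) g) (hn : f n = g n) :
    ∃ E ∈ seminormalAlgebra w q (n + 1), IsMatrixUnit (n + 1) f g E := by
  have hf' := hf.mono (Nat.le_succ n)
  have hg' := hg.mono (Nat.le_succ n)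
  obtain ⟨F, hF, hF'⟩ := exists_matrixUnit_self hG hM hf
  obtain ⟨E, hE, hE'⟩ := hM f g hf' hg' (by rw [hf.shape_eq_erase, hg.shape_eq_erase, hfg, hn])
  refine ⟨E * F, mul_mem (seminormalAlgebra_mono (Nat.le_succ n) hE) hF, fun h hh => ?_⟩
  rw [Module.End.mul_apply]
  by_cases H : ∀ k < n + 1, h k = f k
  · rw [hF'.apply_pos hh H, if_pos H, splice_eq H,
      hE'.apply_pos (hh.mono (Nat.le_succ n)) fun k hk => H k (by omega)]
    congr 1
    ext1 k
    unfold splice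
    by_cases hk : k < n
    · rw [if_pos hk, if_pos (by omega)]
    · by_cases hk' : k = n
      · subst hk'
        rw [if_neg hk, if_pos (Nat.lt_succ_self k), H k (Nat.lt_succ_self k), hn]
      · rw [if_neg hk, if_neg (by omega)]
  · rw [hF' h hh, if_neg H, if_neg H, map_zero]

/-- If the last cells of `f` and `g` differ, both are removable and incomparable. Some tableau `k`
ends in `g n`, `f n`, and exchanging its last letters gives one ending in `g n`. The two tableaux
are linked by a nonzero off-diagonal coefficient, and `exists_matrixUnit_of_eq` links them to `f`
and `g`. -/
theorem hasMatrixUnits (hG : GenericParameters n w q) : HasMatrixUnits w q n := by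
  induction n with
  | zero =>
    refine fun f g _ _ _ => ⟨1, one_mem _, fun h _ => ?_⟩
    rw [if_pos (by simp), splice_eq (by simp)]
    rfl
  | succ n ih =>
    have hM := ih (hG.mono (Nat.le_succ n))
    intro f g hf hg hfg
    by_cases hn : f n = g n
    · exact exists_matrixUnit_of_eq hG hM hf hg hfg hn
    have hL := hf.isDiagram
    have hcard := hf.card_shape
    have hfm : f n ∈ shape (n + 1) f := mem_shape_of_lt (Nat.lt_succ_self n)
    have hgm : g n ∈ shape (n + 1) f := hfg ▸ mem_shape_of_lt (Nat.lt_succ_self n)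
    have hfe : IsDiagram ((shape (n + 1) f).erase (f n)) := by
      rw [← hf.shape_eq_erase]; exact (hf.mono (Nat.le_succ n)).isDiagram
    have hge : IsDiagram ((shape (n + 1) f).erase (g n)) := by
      rw [hfg, ← hg.shape_eq_erase]; exact (hg.mono (Nat.le_succ n)).isDiagram
    have hgf : ¬ CellLE (g n) (f n) := fun h =>
      Finset.notMem_erase _ _ (hge _ _ h (Finset.mem_erase.2 ⟨hn, hfm⟩))
    have hfg' : ¬ CellLE (f n) (g n) := fun h =>
      Finset.notMem_erase _ _ (hfe _ _ h (Finset.mem_erase.2 ⟨Ne.symm hn, hgm⟩))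
    have hb := hG.cellOff_ne_zero hL hcard.le hgm hfm hgf hfg'
    have : Inhabited ι := ⟨(f 0).1⟩
    have hgm' : g n ∈ (shape (n + 1) f).erase (f n) := Finset.mem_erase.2 ⟨Ne.symm hn, hgm⟩
    obtain ⟨m, rfl⟩ : ∃ m, n = m + 1 := by
      refine ⟨n - 1, ?_⟩
      have := Finset.card_pos.2 ⟨_, hgm'⟩
      rw [Finset.card_erase_of_mem hfm, hcard] at this
      omega
    obtain ⟨k₀, hk₀, hk₁⟩ := exists_tableau_last (n := m)
      (by rw [Finset.card_erase_of_mem hfm, hcard]; rfl) hgm' hfe (by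
        have : ((shape (m + 1 + 1) f).erase (f (m + 1))).erase (g (m + 1)) =
            (shape (m + 1 + 1) f).erase (f (m + 1)) ∩ (shape (m + 1 + 1) f).erase (g (m + 1)) := by
          ext; simp only [Finset.mem_erase, Finset.mem_inter]; tauto
        rw [this]
        exact hfe.inter hge)
    have hk := update_mem_tableaux hk₀ (Finset.notMem_erase _ _) (by rwa [Finset.insert_erase hfm])
    rw [Finset.insert_erase hfm] at hk
    set k := Function.update k₀ (m + 1) (f (m + 1)) with hkdef
    have hkn : k (m + 1) = f (m + 1) := Function.update_self _ _ _
    have hkm : k m = g (m + 1) := by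
      rw [← hk₁]; exact Function.update_of_ne (by omega) _ _
    obtain ⟨hk, hks, -⟩ := hk
    have hk' : StdSeq (m + 1 + 1) (k ∘ Equiv.swap m (m + 1)) :=
      hk.swap (by omega) (by rwa [hkm, hkn])
    have hks' : shape (m + 1 + 1) (k ∘ Equiv.swap m (m + 1)) = shape (m + 1 + 1) f := by
      rw [shape_swap (by omega), hks]
    have hkl : (k ∘ Equiv.swap m (m + 1)) (m + 1) = g (m + 1) := by
      rw [Function.comp_apply, Equiv.swap_apply_right, hkm]
    obtain ⟨E, hE, hE'⟩ := exists_matrixUnit_of_eq hG hM hf hk hks.symm hkn.symm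
    obtain ⟨F, hF, hF'⟩ := exists_matrixUnit_of_eq hG hM hk' hg (hks'.trans hfg) hkl
    refine ⟨(cellOff w q (g (m + 1)) (f (m + 1)))⁻¹ • (F * seminormal w q (m + 1) * E),
      Subalgebra.smul_mem _ (mul_mem (mul_mem hF (seminormal_mem_seminormalAlgebra (by omega))) hE) _,
      fun h hh => ?_⟩
    rw [LinearMap.smul_apply, Module.End.mul_apply, Module.End.mul_apply]
    by_cases H : ∀ j < m + 1 + 1, h j = f j
    · have hsp : ∀ j < m + 1 + 1, splice (m + 1 + 1) k h j = k j := fun j hj => splice_of_lt hj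
      have hs : StdSeq (m + 1 + 1) (splice (m + 1 + 1) k h) := hk.congr hsp
      have e1 : splice (m + 1 + 1) k h m = g (m + 1) := by rw [hsp m (by omega), hkm]
      have e2 : splice (m + 1 + 1) k h (m + 1) = f (m + 1) := by rw [hsp (m + 1) (by omega), hkn]
      have hs' : StdSeq (m + 1 + 1) (splice (m + 1 + 1) k h ∘ Equiv.swap m (m + 1)) :=
        hs.swap (by omega) (by rwa [e1, e2])
      rw [if_pos H, hE'.apply_pos hh H, seminormal_succ_single, map_add, map_smul, map_smul,
        hF'.apply_neg hs (k := m + 1) (by omega) (by rw [e2, hkl]; exact hn), smul_zero, zero_add,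
        hF'.apply_pos hs' (fun j hj => by
          rw [Function.comp_apply, Function.comp_apply, hsp _ (swap_lt (by omega) hj)]),
        e1, e2, inv_smul_smul₀ hb]
      congr 1
      ext1 j
      by_cases hj : j < m + 1 + 1
      · rw [splice_of_lt hj, splice_of_lt hj]
      · rw [splice_of_le (by omega), splice_of_le (by omega), Function.comp_apply,
          Equiv.swap_apply_of_ne_of_ne (by omega) (by omega), splice_of_le (by omega)]
    · rw [if_neg H, hE' h hh, if_neg H, map_zero, map_zero, smul_zero]

end MatrixUnits

/-! ### Counting standard tableaux -/

section Counting

variable {ι : Type} [DecidableEq ι]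

open Classical in
/-- The cells that can be removed from a family of diagrams. -/
noncomputable def removable (L : Finset (ι × ℕ × ℕ)) : Finset (ι × ℕ × ℕ) :=
  L.filter fun x => IsDiagram (L.erase x)

theorem mem_removable {L : Finset (ι × ℕ × ℕ)} {x : ι × ℕ × ℕ} :
    x ∈ removable L ↔ x ∈ L ∧ IsDiagram (L.erase x) := by
  unfold removable
  rw [@Finset.mem_filter]

theorem IsDiagram.exists_rowLen {L : Finset (ι × ℕ × ℕ)} (hL : IsDiagram L) :
    ∃ l : ι → ℕ → ℕ, (∀ i a b, (i, a, b) ∈ L ↔ b < l i a) ∧ ∀ i a, l i (a + 1) ≤ l i a := by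
  -- By the hook bound no cell of `L` has a column as large as the number of cells.
  have key : ∀ i a, ∃ b, (i, a, b) ∉ L := fun i a => ⟨L.card, fun h => by
    have := hL.hook_le h h
    simp only [if_true] at this
    omega⟩
  have hl : ∀ i a b, (i, a, b) ∈ L ↔ b < Nat.find (key i a) := by
    intro i a b
    rw [Nat.lt_find_iff]
    refine ⟨fun h m hm => ?_, fun h => by simpa using h b le_rfl⟩
    rw [not_not]
    exact hL (i, a, m) (i, a, b) (CellLE.mk rfl le_rfl hm) h
  refine ⟨fun i a => Nat.find (key i a), hl, fun i a => ?_⟩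
  by_contra! H
  have h1 := (hl i (a + 1) _).2 H
  exact lt_irrefl _ ((hl i a _).1 (hL (i, a, _) (i, a + 1, _)
    (CellLE.mk rfl (Nat.le_succ a) le_rfl) h1))

theorem mem_removable_iff {L : Finset (ι × ℕ × ℕ)} (hL : IsDiagram L) {l : ι → ℕ → ℕ}
    (hl : ∀ i a b, (i, a, b) ∈ L ↔ b < l i a) {i : ι} {a b : ℕ} :
    (i, a, b) ∈ removable L ↔ b + 1 = l i a ∧ l i (a + 1) < l i a := by
  rw [mem_removable]
  constructor
  · rintro ⟨h1, h2⟩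
    have h3 : ∀ c d, a ≤ c → b ≤ d → (c, d) ≠ (a, b) → ¬ d < l i c := by
      intro c d hc hd hne h
      refine Finset.notMem_erase (i, a, b) L (h2 (i, a, b) (i, c, d) (CellLE.mk rfl hc hd)
        (Finset.mem_erase.2 ⟨fun h => hne (congrArg Prod.snd h), (hl _ _ _).2 h⟩))
    have h4 := h3 a (b + 1) le_rfl (Nat.le_succ b) (by simp)
    have h5 := h3 (a + 1) b (Nat.le_succ a) le_rfl (by simp)
    rw [hl] at h1
    omega
  · rintro ⟨h1, h2⟩
    refine ⟨(hl _ _ _).2 (by omega), fun x y hxy hy => ?_⟩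
    rw [Finset.mem_erase] at hy ⊢
    refine ⟨?_, hL x y hxy hy.2⟩
    rintro rfl
    obtain ⟨i', c, d⟩ := y
    obtain ⟨rfl, h4, h5⟩ := hxy
    simp only at h4 h5 hy
    rcases h4.eq_or_lt with rfl | h4
    · have := (hl _ _ _).1 hy.2
      have : b = d := by omega
      exact hy.1 (by rw [this])
    · have := (hl i (a + 1) d).1 (hL (i, a + 1, d) (i, c, d) (CellLE.mk rfl h4 le_rfl) hy.2)
      omega

variable [Fintype ι]

theorem mem_addable_iff {L : Finset (ι × ℕ × ℕ)} (hL : IsDiagram L) {l : ι → ℕ → ℕ}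
    (hl : ∀ i a b, (i, a, b) ∈ L ↔ b < l i a) {i : ι} {a b : ℕ} :
    (i, a, b) ∈ addable L ↔ b = l i a ∧ (∀ c < a, l i a < l i c) := by
  rw [mem_addable, hl]
  constructor
  · rintro ⟨h1, h2⟩
    have h3 : ∀ c d, c ≤ a → d ≤ b → (c, d) ≠ (a, b) → d < l i c := by
      intro c d hc hd hne
      exact (hl _ _ _).1 (Finset.mem_of_mem_insert_of_ne (h2 (i, c, d) (i, a, b)
        (CellLE.mk rfl hc hd) (Finset.mem_insert_self _ _)) fun h => hne (congrArg Prod.snd h))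
    have h4 : b = l i a := by
      by_contra hne
      have := h3 a (b - 1) le_rfl (Nat.sub_le _ _) (by simp; omega)
      omega
    refine ⟨h4, fun c hc => ?_⟩
    rw [← h4]
    exact h3 c b hc.le le_rfl (by simp; omega)
  · rintro ⟨rfl, h2⟩
    refine ⟨lt_irrefl _, fun x y hxy hy => ?_⟩
    rcases Finset.mem_insert.1 hy with rfl | hy
    · obtain ⟨i', c, d⟩ := x
      obtain ⟨rfl, h4, h5⟩ := hxy
      simp only at h4 h5
      rw [Finset.mem_insert, hl]
      rcases h4.eq_or_lt with rfl | h4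
      · rcases h5.eq_or_lt with rfl | h5
        · exact Or.inl rfl
        · exact Or.inr h5
      · exact Or.inr (h5.trans_lt (h2 c h4))
    · exact Finset.mem_insert_of_mem (hL x y hxy hy)

/-- In each diagram an addable cell is either in the top row, exactly one, or in the row following
that of a removable cell, exactly one for each. -/
theorem IsDiagram.card_addable {L : Finset (ι × ℕ × ℕ)} (hL : IsDiagram L) :
    (addable L).card = (removable L).card + Fintype.card ι := by
  obtain ⟨l, hl, hl'⟩ := hL.exists_rowLen
  have hanti : ∀ i, Antitone (l i) := fun i => antitone_nat_of_succ_le (hl' i)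
  have key : addable L = (removable L).image (fun x => (x.1, x.2.1 + 1, l x.1 (x.2.1 + 1))) ∪
      Finset.univ.image fun i => (i, 0, l i 0) := by
    ext ⟨i, a, b⟩
    rw [mem_addable_iff hL hl, Finset.mem_union, Finset.mem_image, Finset.mem_image]
    constructor
    · rintro ⟨rfl, h⟩
      rcases a with _ | a
      · exact Or.inr ⟨i, Finset.mem_univ _, rfl⟩
      · have := h a (Nat.lt_succ_self a)
        exact Or.inl ⟨(i, a, l i a - 1), (mem_removable_iff hL hl).2 ⟨by omega, this⟩, rfl⟩
    · rintro (⟨⟨i', a', b'⟩, h, h'⟩ | ⟨i', -, h'⟩)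
      · simp only [Prod.mk.injEq] at h'
        obtain ⟨rfl, rfl, rfl⟩ := h'
        rw [mem_removable_iff hL hl] at h
        exact ⟨rfl, fun c hc => h.2.trans_le (hanti i' (Nat.lt_succ_iff.1 hc))⟩
      · simp only [Prod.mk.injEq] at h'
        obtain ⟨rfl, rfl, rfl⟩ := h'
        exact ⟨rfl, fun c hc => absurd hc (Nat.not_lt_zero c)⟩
  rw [key, Finset.card_union_of_disjoint, Finset.card_image_of_injOn, Finset.card_image_of_injective,
    Finset.card_univ]
  · intro i j h
    exact congrArg Prod.fst h
  · rintro ⟨i, a, b⟩ h ⟨i', a', b'⟩ h' heq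
    simp only [Prod.mk.injEq] at heq
    obtain ⟨rfl, h2, -⟩ := heq
    obtain rfl : a = a' := by omega
    rw [Finset.mem_coe, mem_removable_iff hL hl] at h h'
    rw [show b = b' by omega]
  · rw [Finset.disjoint_left]
    intro x hx hx'
    obtain ⟨y, -, rfl⟩ := Finset.mem_image.1 hx
    obtain ⟨i, -, h⟩ := Finset.mem_image.1 hx'
    simp at h

variable [Inhabited ι]

omit [Fintype ι] in
/-- The number of standard tableaux of a given shape. -/
noncomputable def tableauCount (n : ℕ) (L : Finset (ι × ℕ × ℕ)) : ℕ :=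
  (finite_tableaux n L).toFinset.card

theorem update_update_default {C : Type*} (h : ℕ → C) (n : ℕ) (x y : C) (hx : h n = x) :
    Function.update (Function.update h n y) n x = h := by
  rw [Function.update_idem, ← hx, Function.update_eq_self]

omit [Fintype ι] in
theorem mem_removable_of_mem_tableaux {n : ℕ} {L : Finset (ι × ℕ × ℕ)} {h : ℕ → ι × ℕ × ℕ}
    (hh : h ∈ tableaux (n + 1) L) : h n ∈ removable L := by
  obtain ⟨h1, rfl, -⟩ := hh
  refine mem_removable.2 ⟨mem_shape_of_lt (Nat.lt_succ_self n), ?_⟩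
  rw [← h1.shape_eq_erase]
  exact (h1.mono (Nat.le_succ n)).isDiagram

omit [Fintype ι] in
theorem tableauCount_succ {n : ℕ} {L : Finset (ι × ℕ × ℕ)} (hL : IsDiagram L) :
    tableauCount (n + 1) L = ∑ x ∈ removable L, tableauCount n (L.erase x) := by
  unfold tableauCount
  rw [Finset.card_eq_sum_card_fiberwise (f := fun h => h n) (t := removable L)]
  · refine Finset.sum_congr rfl fun x hx => ?_
    rw [mem_removable] at hx
    refine Finset.card_nbij' (fun h => Function.update h n default) (fun h => Function.update h n x)
      ?_ ?_ ?_ ?_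
    · intro h hh
      simp only [Finset.coe_filter, Set.Finite.mem_toFinset, Set.mem_ofPred_eq] at hh
      obtain ⟨h1, rfl⟩ := hh
      simpa using update_default_mem_tableaux h1
    · intro h hh
      simp only [Set.Finite.coe_toFinset] at hh
      have := update_mem_tableaux hh (Finset.notMem_erase x L)
        (by rw [Finset.insert_erase hx.1]; exact hL)
      rw [Finset.insert_erase hx.1] at this
      simpa using this
    · intro h hh
      simp only [Finset.coe_filter, Set.Finite.mem_toFinset, Set.mem_ofPred_eq] at hh
      exact update_update_default h n x default hh.2
    · intro h hh
      simp only [Set.Finite.coe_toFinset] at hh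
      exact update_update_default h n default x (hh.2.2 n le_rfl)
  · intro h hh
    simp only [Set.Finite.coe_toFinset] at hh
    exact mem_removable_of_mem_tableaux hh

omit [Inhabited ι] in
-- Adding `x` and then removing another cell `y` amounts to removing `y` first and then adding `x`;
-- this interchanges the two summations in the count.
theorem mem_addable_removable_iff {L : Finset (ι × ℕ × ℕ)} (hL : IsDiagram L) {x y : ι × ℕ × ℕ} :
    (x ∈ addable L ∧ y ∈ (removable (insert x L)).erase x) ↔
      (x ∈ (addable (L.erase y)).erase y ∧ y ∈ removable L) := by
  simp only [Finset.mem_erase, mem_addable, mem_removable]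
  constructor
  · rintro ⟨⟨h1, h2⟩, h3, h4, h5⟩
    have h6 := Finset.mem_of_mem_insert_of_ne h4 h3
    rw [Finset.erase_insert_of_ne h3.symm] at h5
    refine ⟨⟨h3.symm, fun h => h1 h.2, h5⟩, h6, ?_⟩
    convert hL.inter h5 using 1
    ext z
    simp only [Finset.mem_inter, Finset.mem_insert, Finset.mem_erase]
    constructor
    · tauto
    · rintro ⟨h7, rfl | h8⟩
      · exact absurd h7 h1
      · exact h8
  · rintro ⟨⟨h1, h2, h3⟩, h4, h5⟩
    refine ⟨⟨fun h => h2 ⟨h1, h⟩, ?_⟩, h1.symm, Finset.mem_insert_of_mem h4, ?_⟩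
    · convert hL.union h3 using 1
      ext z
      simp only [Finset.mem_union, Finset.mem_insert, Finset.mem_erase]
      tauto
    · rw [Finset.erase_insert_of_ne h1]
      exact h3

/-- The dimension of a module induced to the next level. -/
theorem sum_tableauCount_addable {n : ℕ} {L : Finset (ι × ℕ × ℕ)} (hL : IsDiagram L)
    (hn : L.card = n) : ∑ x ∈ addable L, tableauCount (n + 1) (insert x L) =
      Fintype.card ι * (n + 1) * tableauCount n L := by
  have step : ∀ (n : ℕ) (L : Finset (ι × ℕ × ℕ)), IsDiagram L →
      ∑ x ∈ addable L, tableauCount (n + 1) (insert x L) = (addable L).card * tableauCount n L +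
        ∑ x ∈ addable L, ∑ y ∈ (removable (insert x L)).erase x,
          tableauCount n ((insert x L).erase y) := by
    intro n L hL
    rw [← smul_eq_mul, ← Finset.sum_const, ← Finset.sum_add_distrib]
    refine Finset.sum_congr rfl fun x hx => ?_
    rw [mem_addable] at hx
    rw [tableauCount_succ hx.2, ← Finset.add_sum_erase (a := x), Finset.erase_insert hx.1]
    rw [mem_removable, Finset.erase_insert hx.1]
    exact ⟨Finset.mem_insert_self _ _, hL⟩
  induction n generalizing L with
  | zero =>
    obtain rfl := Finset.card_eq_zero.1 hn
    rw [step 0 _ hL, hL.card_addable]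
    have h1 : removable (∅ : Finset (ι × ℕ × ℕ)) = ∅ := by
      ext; simp [mem_removable]
    rw [h1, Finset.sum_eq_zero]
    · simp
    · intro x _
      refine Finset.sum_eq_zero fun y hy => ?_
      rw [Finset.mem_erase, mem_removable] at hy
      simp [hy.1] at hy
  | succ m ih =>
    -- The terms in which the added cell is removed again are split off. In the others removal comes
    -- first, so the induction hypothesis applies to `L.erase y`, up to its term `x = y`. The excess
    -- of addable over removable cells accounts for the difference.
    rw [step _ _ hL, Finset.sum_comm' (t' := removable L)
      (s' := fun y => (addable (L.erase y)).erase y)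
      (fun x y => mem_addable_removable_iff hL)]
    have h2 : ∀ y ∈ removable L, ∑ x ∈ (addable (L.erase y)).erase y,
        tableauCount (m + 1) ((insert x L).erase y) + tableauCount (m + 1) L =
          Fintype.card ι * (m + 1) * tableauCount m (L.erase y) := by
      intro y hy
      rw [mem_removable] at hy
      rw [← ih hy.2 (by rw [Finset.card_erase_of_mem hy.1, hn]; rfl),
        ← Finset.sum_erase_add (s := addable (L.erase y)) (a := y), Finset.insert_erase hy.1]
      · congr 1
        refine Finset.sum_congr rfl fun x hx => ?_
        rw [Finset.erase_insert_of_ne (Finset.ne_of_mem_erase hx)]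
      · rw [mem_addable, Finset.insert_erase hy.1]
        exact ⟨Finset.notMem_erase _ _, hL⟩
    have h3 := Finset.sum_congr rfl h2
    rw [Finset.sum_add_distrib, ← Finset.mul_sum, ← tableauCount_succ hL, Finset.sum_const,
      smul_eq_mul] at h3
    rw [hL.card_addable]
    linear_combination h3

end Counting

/-! ### A spanning set for induced modules -/

section Induced

variable {A : Type*} [Ring A] [Algebra ℂ A] {ι : Type*} [Fintype ι] {n : ℕ} {w : ι → ℂ} {q : ℂ}

/-- The product `T k * T (k + 1) * ⋯` of `m` consecutive members of a family. -/
def ascProd (T : ℕ → A) : ℕ → ℕ → A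
  | _, 0 => 1
  | k, m + 1 => T k * ascProd T (k + 1) m

/-- The product `T k * T (k - 1) * ⋯ * T 1`. -/
def descProd (T : ℕ → A) : ℕ → A
  | 0 => 1
  | k + 1 => T (k + 1) * descProd T k

omit [Algebra ℂ A] in
theorem ascProd_succ (T : ℕ → A) (k m : ℕ) : ascProd T k (m + 1) = T k * ascProd T (k + 1) m := rfl

omit [Algebra ℂ A] in
theorem commute_ascProd {T : ℕ → A} {a : A} {k m : ℕ}
    (H : ∀ j, k ≤ j → j < k + m → a * T j = T j * a) :
    a * ascProd T k m = ascProd T k m * a := by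
  induction m generalizing k with
  | zero => rw [ascProd, one_mul, mul_one]
  | succ m ih =>
    rw [ascProd_succ, ← mul_assoc, H k le_rfl (by omega), mul_assoc,
      ih fun j h1 h2 => H j (by omega) (by omega), mul_assoc]

omit [Algebra ℂ A] in
theorem commute_descProd {T : ℕ → A} {a : A} {k : ℕ}
    (H : ∀ j, 1 ≤ j → j ≤ k → a * T j = T j * a) : a * descProd T k = descProd T k * a := by
  induction k with
  | zero => rw [descProd, one_mul, mul_one]
  | succ k ih =>
    rw [descProd, ← mul_assoc, H (k + 1) (by omega) le_rfl, mul_assoc,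
      ih fun j h1 h2 => H j h1 (by omega), mul_assoc]

omit [Algebra ℂ A] in
theorem descProd_comp_succ (T : ℕ → A) (k : ℕ) :
    descProd T (k + 1) = descProd (fun i => T (i + 1)) k * T 1 := by
  induction k with
  | zero => simp [descProd]
  | succ k ih => rw [descProd, ih, descProd, mul_assoc]

namespace HeckeFamily

theorem mul_ascProd {T : ℕ → A} (h : HeckeFamily n w q T) {i k m : ℕ} (hk : 1 ≤ k) (h1 : k < i)
    (h2 : i < k + m) (hn : k + m ≤ n) :
    T i * ascProd T k m = ascProd T k m * T (i - 1) := by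
  induction m generalizing k with
  | zero => omega
  | succ m ih =>
    rw [ascProd_succ]
    rcases Nat.lt_or_ge (k + 1) i with h3 | h3
    · rw [← mul_assoc, ← h.comm k i h3 (by omega), mul_assoc, ih (by omega) h3 (by omega) (by omega),
        mul_assoc]
    · obtain rfl : i = k + 1 := by omega
      obtain ⟨m, rfl⟩ : ∃ m', m = m' + 1 := ⟨m - 1, by omega⟩
      rw [ascProd_succ, Nat.add_sub_cancel, ← mul_assoc, ← mul_assoc,
        ← h.braid k hk (by omega), mul_assoc, commute_ascProd, ← mul_assoc, mul_assoc (T k)]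
      intro j h4 h5
      exact h.comm k j (by omega) (by omega)

theorem mul_descProd {T : ℕ → A} (h : HeckeFamily n w q T) {i k : ℕ} (hi : 1 ≤ i) (hk : i < k)
    (hn : k < n) : T i * descProd T k = descProd T k * T (i + 1) := by
  induction k with
  | zero => omega
  | succ k ih =>
    rw [descProd]
    rcases Nat.lt_succ_iff_lt_or_eq.1 hk with h3 | rfl
    · rw [← mul_assoc, h.comm i (k + 1) (by omega) hn, mul_assoc, ih h3 (by omega), mul_assoc]
    · obtain ⟨j, rfl⟩ : ∃ j, i = j + 1 := ⟨i - 1, by omega⟩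
      rw [descProd, ← mul_assoc, ← mul_assoc, h.braid (j + 1) hi hn, mul_assoc, commute_descProd,
        ← mul_assoc, mul_assoc (T (j + 1 + 1))]
      intro l h4 h5
      exact (h.comm l (j + 1 + 1) (by omega) hn).symm

theorem descProd_mul_ascProd {T : ℕ → A} (h : HeckeFamily n w q T) {k m : ℕ} (hk : k + 1 ≤ m)
    (hn : m < n) : descProd (fun i => T (i + 1)) k * ascProd T 1 m = ascProd T 1 m * descProd T k := by
  induction k with
  | zero => simp [descProd]
  | succ k ih =>
    rw [descProd, mul_assoc, ih (by omega), ← mul_assoc,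
      h.mul_ascProd le_rfl (by omega) (by omega) (by omega), Nat.add_sub_cancel, mul_assoc, descProd]

end HeckeFamily

variable {V : Type*} [AddCommGroup V] [Module ℂ V] {T : ℕ → Module.End ℂ V}

/-- For `a = 0` this is the quadratic relation. The induction uses that `T 1 * T 0 * T 1` commutes
with every power of `T 0`. -/
theorem HeckeFamily.mul_pow_mul_apply (h : HeckeFamily n w q T) (hq : q ≠ 0) (hn : 1 < n) (a : ℕ)
    (v : V) : T 0 (T 1 ((T 0 ^ a) (T 1 v))) = T 1 ((T 0 ^ a) (T 1 (T 0 v))) +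
      (1 - q) • (T 0 (T 1 ((T 0 ^ a) v)) - (T 0 ^ a) (T 1 (T 0 v))) := by
  have h4 : ∀ v, T 0 (T 1 (T 0 (T 1 v))) = T 1 (T 0 (T 1 (T 0 v))) := fun v =>
    LinearMap.congr_fun (h.braid_four hn) v
  have h2 : ∀ v, T 1 (T 1 v) = (1 - q) • T 1 v + q • v := fun v =>
    LinearMap.congr_fun (h.quadratic 1 le_rfl hn) v
  induction a generalizing v with
  | zero =>
    simp only [pow_zero, Module.End.one_apply]
    have e := h2 (T 0 v)
    rw [h2 v, e, map_add, map_smul, map_smul]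
    module
  | succ a ih =>
    have hc : Commute (T 1 * T 0 * T 1) (T 0 ^ a) := by
      refine Commute.pow_right ?_ a
      change T 1 * T 0 * T 1 * T 0 = T 0 * (T 1 * T 0 * T 1)
      rw [← h.braid_four hn]
      noncomm_ring
    have hP : ∀ v, T 1 (T 0 (T 1 ((T 0 ^ a) v))) = (T 0 ^ a) (T 1 (T 0 (T 1 v))) := fun v =>
      LinearMap.congr_fun hc v
    rw [pow_succ']
    simp only [Module.End.mul_apply]
    set X := T 0
    set Y := T 1
    set P := X ^ a
    have E1 := congrArg (fun z => X (Y (X z))) (h2 (P (Y v)))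
    have E2 := congrArg (fun z => Y (X z)) (h2 (P (Y (X v))))
    have E3 := h4 (Y (P (Y v)))
    have E4 := congrArg (fun z => Y (X (Y z))) (ih v)
    have E6 := h4 (Y (P v))
    have E7 := congrArg (fun z => X (Y (X z))) (h2 (P v))
    have E8 := congrArg X (hP v)
    have E8' := congrArg X (hP (Y v))
    have E9 := congrArg (fun z => X (P (Y (X z)))) (h2 v)
    simp only [map_add, map_smul, map_sub] at E1 E2 E3 E4 E6 E7 E8 E8' E9
    -- The quadratic relation is read backwards to insert a pair `T 1 * T 1`, at the cost of a
    -- factor `q` that is cancelled here.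
    refine smul_right_injective V hq ?_
    simp only
    linear_combination (norm := module) -E1 + E3 + E4 + E2 - (1 - q) • E6 + (1 - q) • E7 +
      ((1 - q) ^ 2) • E8 - (1 - q) • E8' - (1 - q) • E9

section Stable

variable (h : HeckeFamily (n + 1) w q T) {W N : Submodule ℂ V} (hW : ∀ i < n, ∀ x ∈ W, T i x ∈ W)
  (hU : ∀ k ≤ n, ∀ x ∈ W, ascProd T (k + 1) (n - k) x ∈ N)

include h hW hU

/-- The operator commutes with the product, or lengthens it, or meets its first factor, where the
quadratic relation applies, or slides through it with index lowered by one. What passes through acts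
on `W`. -/
theorem HeckeFamily.ascProd_stable {i k : ℕ} (h1 : 1 ≤ i) (hi : i ≤ n) (hk : k ≤ n) {x : V}
    (hx : x ∈ W) : T i (ascProd T (k + 1) (n - k) x) ∈ N := by
  rcases lt_trichotomy i k with h2 | rfl | h2
  · rw [← Module.End.mul_apply, commute_ascProd, Module.End.mul_apply]
    · exact hU k hk _ (hW i (by omega) x hx)
    · intro j h3 h4
      exact h.comm i j (by omega) (by omega)
  · have := hU (i - 1) (by omega) x hx
    rw [show n - (i - 1) = n - i + 1 by omega, Nat.sub_add_cancel h1, ascProd_succ,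
      Module.End.mul_apply] at this
    exact this
  · rcases Nat.eq_or_lt_of_le (Nat.succ_le_of_lt h2) with rfl | h2
    · have h3 := hU (k + 1) hi x hx
      have h4 := hU k hk x hx
      rw [show n - k = n - (k + 1) + 1 by omega, ascProd_succ, Module.End.mul_apply] at h4 ⊢
      have h5 := LinearMap.congr_fun (h.quadratic (k + 1) h1 (by omega))
        (ascProd T (k + 1 + 1) (n - (k + 1)) x)
      rw [Module.End.mul_apply] at h5
      rw [h5]
      exact N.add_mem (N.smul_mem _ h4) (N.smul_mem _ h3)
    · rw [← Module.End.mul_apply, h.mul_ascProd (by omega) h2 (by omega) (by omega),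
        Module.End.mul_apply]
      exact hU k hk _ (hW (i - 1) (by omega) x hx)

/-- This is the exponent `0` of the elements `T_k ⋯ T_1 T_0 ^ a T_1 ⋯ T_n`: without `T_0` in the
middle they reduce to the ascending products, whose span is stable under `T_1, …, T_n`. -/
theorem HeckeFamily.descProd_ascProd_mem {k : ℕ} (hk : k ≤ n) {x : V} (hx : x ∈ W) :
    descProd T k (ascProd T 1 n x) ∈ N := by
  set S := Submodule.span ℂ {y | ∃ k ≤ n, ∃ x ∈ W, ascProd T (k + 1) (n - k) x = y} with hS
  have key : ∀ k ≤ n, ∀ y ∈ S, descProd T k y ∈ S := by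
    intro k hk
    induction k with
    | zero => exact fun y hy => hy
    | succ k ih =>
      intro y hy
      have h1 := ih (by omega) y hy
      rw [descProd, Module.End.mul_apply]
      refine (Submodule.span_le (p := S.comap (T (k + 1)))).2 ?_ h1
      rintro _ ⟨l, hl, z, hz, rfl⟩
      exact h.ascProd_stable (N := S) hW (fun k hk x hx => Submodule.subset_span ⟨k, hk, x, hx, rfl⟩)
        (by omega) hk hl hz
  refine (Submodule.span_le (p := N)).2 ?_
    (key k hk _ (Submodule.subset_span ⟨0, Nat.zero_le n, x, hx, rfl⟩))
  rintro _ ⟨l, hl, z, hz, rfl⟩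
  exact hU l hl z hz

omit [Fintype ι] h hU in
theorem descProd_mem {x : V} (hx : x ∈ W) : ∀ j < n, descProd T j x ∈ W := by
  intro j hj
  induction j with
  | zero => exact hx
  | succ j ih => exact hW _ hj _ (ih (by omega))

omit [Fintype ι] h hU in
theorem pow_apply_mem (hn : 0 < n) (a : ℕ) {x : V} (hx : x ∈ W) : (T 0 ^ a) x ∈ W := by
  induction a with
  | zero => exact hx
  | succ a ih =>
    rw [pow_succ', Module.End.mul_apply]
    exact hW 0 hn _ ih

variable (hD : ∀ k ≤ n, ∀ a, ∀ x ∈ W, descProd T k ((T 0 ^ a) (ascProd T 1 n x)) ∈ N)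

include hD

/-- The case of substance is `i = 0 < k`. The factors other than `T_1` commute with `T_0`, so
`HeckeFamily.mul_pow_mul_apply` moves `T_0` to the right at the expense of terms with shorter
descending part; all factors that come out on the right act on `W`. -/
theorem HeckeFamily.descProd_stable (hq : q ≠ 0) {i k a : ℕ} (hi : i ≤ n) (hk : k ≤ n) {x : V}
    (hx : x ∈ W) : T i (descProd T k ((T 0 ^ a) (ascProd T 1 n x))) ∈ N := by
  have hcomm0 : ∀ j, 2 ≤ j → j ≤ n → ∀ a, T j * T 0 ^ a = T 0 ^ a * T j := fun j h1 h2 a =>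
    (Commute.pow_right (show Commute (T j) (T 0) from (h.comm 0 j (by omega) (by omega)).symm) a)
  rcases Nat.eq_zero_or_pos i with rfl | h1
  · rcases Nat.eq_zero_or_pos k with rfl | h2
    · have := hD 0 hk (a + 1) x hx
      rwa [pow_succ', Module.End.mul_apply] at this
    · obtain ⟨k, rfl⟩ : ∃ k', k = k' + 1 := ⟨k - 1, by omega⟩
      obtain ⟨m, rfl⟩ : ∃ m, n = m + 1 := ⟨n - 1, by omega⟩
      have hc : ∀ a, T 0 ^ a * descProd (fun i => T (i + 1)) k =
          descProd (fun i => T (i + 1)) k * T 0 ^ a := fun a =>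
        commute_descProd fun j h3 h4 => (hcomm0 _ (by omega) (by omega) a).symm
      have hc' : ∀ a, T 0 ^ a * ascProd T 2 m = ascProd T 2 m * T 0 ^ a := fun a =>
        commute_ascProd fun j h3 h4 => (hcomm0 _ h3 (by omega) a).symm
      have hd := h.descProd_mul_ascProd (m := m + 1) hk (by omega)
      have hc0 := hc 1
      have hc0' := hc' 1
      rw [pow_one] at hc0 hc0'
      have hA : ∀ y, ascProd T 1 (m + 1) y = T 1 (ascProd T 2 m y) := fun y => by
        rw [ascProd_succ, Module.End.mul_apply]
      have hB : ∀ y, descProd T (k + 1) y = descProd (fun i => T (i + 1)) k (T 1 y) := fun y => by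
        rw [descProd_comp_succ, Module.End.mul_apply]
      have hd' : ∀ y, descProd (fun i => T (i + 1)) k (T 1 (ascProd T 2 m y)) =
          ascProd T 1 (m + 1) (descProd T k y) := fun y => by
        rw [← hA]
        exact LinearMap.congr_fun hd y
      have hd'' : ∀ y, descProd (fun i => T (i + 1)) k (ascProd T 1 (m + 1) y) =
          ascProd T 1 (m + 1) (descProd T k y) := fun y => LinearMap.congr_fun hd y
      have hcv : ∀ a y, (T 0 ^ a) (descProd (fun i => T (i + 1)) k y) =
          descProd (fun i => T (i + 1)) k ((T 0 ^ a) y) := fun a y => LinearMap.congr_fun (hc a) y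
      have hcv0 : ∀ y, T 0 (descProd (fun i => T (i + 1)) k y) =
          descProd (fun i => T (i + 1)) k (T 0 y) := fun y => LinearMap.congr_fun hc0 y
      have hcv' : ∀ a y, (T 0 ^ a) (ascProd T 2 m y) = ascProd T 2 m ((T 0 ^ a) y) :=
        fun a y => LinearMap.congr_fun (hc' a) y
      have hcv0' : ∀ y, T 0 (ascProd T 2 m y) = ascProd T 2 m (T 0 y) :=
        fun y => LinearMap.congr_fun hc0' y
      rw [hB, hcv0, hA, h.mul_pow_mul_apply hq (by omega), map_add, map_smul, map_sub, hcv0', ← hB,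
        ← hA, ← hcv0, hcv', hd', ← hcv a, hd'']
      have hk' : ∀ {y}, y ∈ W → descProd T k y ∈ W := fun hy =>
        descProd_mem hW hy k (by omega)
      have e1 := hD 0 (Nat.zero_le _) 1 _ (hk' (pow_apply_mem hW (by omega) a hx))
      have e2 := hD 0 (Nat.zero_le _) a _ (hk' (hW 0 (by omega) x hx))
      rw [pow_one] at e1
      exact N.add_mem (hD _ hk a _ (hW 0 (by omega) x hx)) (N.smul_mem _ (N.sub_mem e1 e2))
  · have key : 2 ≤ i → T i ((T 0 ^ a) (ascProd T 1 n x)) =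
        (T 0 ^ a) (ascProd T 1 n (T (i - 1) x)) := fun h3 => by
      rw [← Module.End.mul_apply, hcomm0 i h3 hi, Module.End.mul_apply, ← Module.End.mul_apply (T i),
        h.mul_ascProd le_rfl (by omega) (by omega) (by omega), Module.End.mul_apply]
    rcases lt_trichotomy i k with h2 | rfl | h2
    · rw [← Module.End.mul_apply, h.mul_descProd h1 h2 (by omega), Module.End.mul_apply]
      have e : T (i + 1) ((T 0 ^ a) (ascProd T 1 n x)) =
          (T 0 ^ a) (ascProd T 1 n (T i x)) := by
        rw [← Module.End.mul_apply, hcomm0 (i + 1) (by omega) (by omega), Module.End.mul_apply,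
          ← Module.End.mul_apply (T (i + 1)),
          h.mul_ascProd le_rfl (by omega) (by omega) (by omega), Module.End.mul_apply,
          Nat.add_sub_cancel]
      rw [e]
      exact hD k hk a _ (hW i (by omega) x hx)
    · obtain ⟨j, rfl⟩ : ∃ j, i = j + 1 := ⟨i - 1, by omega⟩
      have h3 := hD j (by omega) a x hx
      have h4 := hD (j + 1) hk a x hx
      rw [descProd, Module.End.mul_apply] at h4 ⊢
      have h5 := LinearMap.congr_fun (h.quadratic (j + 1) h1 (by omega))
        (descProd T j ((T 0 ^ a) (ascProd T 1 n x)))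
      rw [Module.End.mul_apply] at h5
      rw [h5]
      exact N.add_mem (N.smul_mem _ h4) (N.smul_mem _ h3)
    · rcases Nat.eq_or_lt_of_le (Nat.succ_le_of_lt h2) with rfl | h2
      · exact hD (k + 1) hi a x hx
      · rw [← Module.End.mul_apply, commute_descProd, Module.End.mul_apply, key (by omega)]
        · exact hD k hk a _ (hW _ (by omega) x hx)
        · intro j h3 h4
          exact (h.comm j i (by omega) (by omega)).symm

end Stable

theorem Polynomial.natDegree_prod_X_sub_C' {κ : Type*} [Fintype κ] (w : κ → ℂ) :
    (∏ x, (Polynomial.X - Polynomial.C (w x))).natDegree = Fintype.card κ := by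
  simp [Polynomial.natDegree_prod_of_monic _ _ fun x _ => Polynomial.monic_X_sub_C (w x)]

/-- The remainder on division by the cyclotomic polynomial has degree less than the number of
parameters. -/
theorem pow_mem_span_pow [Nonempty ι] {f : Module.End ℂ V}
    (hf : Polynomial.aeval f (∏ x, (Polynomial.X - Polynomial.C (w x))) = 0) (a : ℕ) :
    ∃ c : ℕ → ℂ, f ^ a = ∑ b ∈ Finset.range (Fintype.card ι), c b • f ^ b := by
  set P := ∏ x, (Polynomial.X - Polynomial.C (w x)) with hP
  have hm : P.Monic := Polynomial.monic_prod_of_monic _ _ fun x _ => Polynomial.monic_X_sub_C (w x)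
  have hd : P.natDegree = Fintype.card ι := Polynomial.natDegree_prod_X_sub_C' w
  have hlt : ((Polynomial.X : Polynomial ℂ) ^ a %ₘ P).natDegree < Fintype.card ι := by
    rw [← hd]
    refine Polynomial.natDegree_modByMonic_lt _ hm fun h => ?_
    rw [h, Polynomial.natDegree_one] at hd
    exact Fintype.card_ne_zero hd.symm
  refine ⟨((Polynomial.X : Polynomial ℂ) ^ a %ₘ P).coeff, ?_⟩
  rw [← Polynomial.aeval_eq_sum_range' hlt, Polynomial.aeval_modByMonic_eq_self_of_root hf, map_pow,
    Polynomial.aeval_X]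

/-- A module generated by a module for the previous level is at most `r (n + 1)` times as large. -/
theorem HeckeFamily.exists_stable [Nonempty ι] (h : HeckeFamily (n + 1) w q T) (hq : q ≠ 0)
    {κ : Type*} [Fintype κ] (g : κ → V)
    (hg : ∀ i < n, ∀ j, T i (g j) ∈ Submodule.span ℂ (Set.range g)) :
    ∃ N : Submodule ℂ V, (∀ j, g j ∈ N) ∧ (∀ i < n + 1, ∀ x ∈ N, T i x ∈ N) ∧
      FiniteDimensional ℂ N ∧ Module.finrank ℂ N ≤ Fintype.card ι * (n + 1) * Fintype.card κ := by
  set W := Submodule.span ℂ (Set.range g) with hWdef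
  have hW : ∀ i < n, ∀ x ∈ W, T i x ∈ W := fun i hi x hx => by
    refine (Submodule.span_le (p := W.comap (T i))).2 ?_ hx
    rintro _ ⟨j, rfl⟩
    exact hg i hi j
  -- For each of the `n + 1` places there are `r` operators: the slot of exponent `0` holds an
  -- ascending product, those of exponents `1, …, r - 1` hold `T_k ⋯ T_1 T_0 ^ a T_1 ⋯ T_n`.
  let E : Fin (n + 1) × Fin (Fintype.card ι) → Module.End ℂ V := fun z =>
    if z.2.val = 0 then ascProd T (z.1.val + 1) (n - z.1.val)
    else descProd T z.1.val * T 0 ^ z.2.val * ascProd T 1 n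
  let G : (Fin (n + 1) × Fin (Fintype.card ι)) × κ → V := fun z => E z.1 (g z.2)
  set N := Submodule.span ℂ (Set.range G) with hN
  have hE : ∀ z, ∀ x ∈ W, E z x ∈ N := fun z x hx => by
    refine (Submodule.span_le (p := N.comap (E z))).2 ?_ hx
    rintro _ ⟨j, rfl⟩
    exact Submodule.subset_span ⟨(z, j), rfl⟩
  have hU : ∀ k ≤ n, ∀ x ∈ W, ascProd T (k + 1) (n - k) x ∈ N := fun k hk x hx => by
    have := hE (⟨k, by omega⟩, ⟨0, Fintype.card_pos⟩) x hx
    simpa only [E, if_true] using this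
  have hD : ∀ k ≤ n, ∀ a, ∀ x ∈ W, descProd T k ((T 0 ^ a) (ascProd T 1 n x)) ∈ N := by
    intro k hk a x hx
    obtain ⟨c, hc⟩ := pow_mem_span_pow (h.cyclotomic (by omega)) a
    rw [hc, LinearMap.sum_apply, map_sum]
    refine N.sum_mem fun b hb => ?_
    rw [LinearMap.smul_apply, map_smul]
    refine N.smul_mem _ ?_
    rcases Nat.eq_zero_or_pos b with rfl | hb'
    · exact h.descProd_ascProd_mem hW hU hk hx
    · have := hE (⟨k, by omega⟩, ⟨b, Finset.mem_range.1 hb⟩) x hx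
      simpa only [E, if_neg hb'.ne', Module.End.mul_apply] using this
  refine ⟨N, fun j => ?_, fun i hi x hx => ?_,
    FiniteDimensional.span_of_finite ℂ (Set.finite_range G), ?_⟩
  · have := hU n le_rfl (g j) (Submodule.subset_span ⟨j, rfl⟩)
    rwa [Nat.sub_self] at this
  · refine (Submodule.span_le (p := N.comap (T i))).2 ?_ hx
    rintro _ ⟨⟨⟨⟨k, hk⟩, a⟩, j⟩, rfl⟩
    have hj : g j ∈ W := Submodule.subset_span ⟨j, rfl⟩
    change T i (E _ _) ∈ N
    dsimp only [E]
    split_ifs with ha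
    · rcases Nat.eq_zero_or_pos i with rfl | h1
      · rcases Nat.eq_zero_or_pos k with rfl | h2
        · have := hD 0 (by omega) 1 _ hj
          rwa [pow_one] at this
        · rw [← Module.End.mul_apply, commute_ascProd, Module.End.mul_apply]
          · exact hU k (by omega) _ (hW 0 (by omega) _ hj)
          · intro l h3 h4
            exact h.comm 0 l (by omega) (by omega)
      · exact h.ascProd_stable hW hU h1 (by omega) (by omega) hj
    · exact h.descProd_stable hW hU hD hq (by omega) (by omega) hj
  · refine (finrank_range_le_card G).trans ?_
    simp only [Fintype.card_prod, Fintype.card_fin]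
    exact (congrArg (· * Fintype.card κ) (mul_comm _ _)).le

end Induced

/-! ### Decomposition of modules into seminormal forms -/

theorem HeckeOn.exists_stable {V : Type*} [AddCommGroup V] [Module ℂ V] {ι : Type*} [Fintype ι]
    [Nonempty ι] {n : ℕ} {w : ι → ℂ} {q : ℂ} {T : ℕ → Module.End ℂ V} {p : Submodule ℂ V}
    (h : HeckeOn (n + 1) w q T p) (hq : q ≠ 0) {κ : Type*} [Fintype κ] (g : κ → V)
    (hgp : ∀ j, g j ∈ p) (hg : ∀ i < n, ∀ j, T i (g j) ∈ Submodule.span ℂ (Set.range g)) :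
    ∃ N : Submodule ℂ V, (∀ j, g j ∈ N) ∧ (∀ i < n + 1, ∀ x ∈ N, T i x ∈ N) ∧
      FiniteDimensional ℂ N ∧ Module.finrank ℂ N ≤ Fintype.card ι * (n + 1) * Fintype.card κ := by
  obtain ⟨N, h1, h2, h3, h4⟩ := h.heckeFamily.exists_stable hq (fun j => (⟨g j, hgp j⟩ : p)) (by
    intro i hi j
    have := hg i hi j
    rw [← h.coe_restrictFamily (by omega) ⟨g j, hgp j⟩,
      show Set.range g = p.subtype '' Set.range fun j => (⟨g j, hgp j⟩ : p) by
        rw [← Set.range_comp]; rfl, ← Submodule.map_span] at this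
    obtain ⟨y, hy, hxy⟩ := this
    rwa [← Subtype.ext hxy])
  refine ⟨N.map p.subtype, fun j => ⟨_, h1 j, rfl⟩, ?_, inferInstance, ?_⟩
  · rintro i hi _ ⟨x, hx, rfl⟩
    exact ⟨_, h2 i hi x hx, h.coe_restrictFamily hi x⟩
  · rwa [Submodule.finrank_map_subtype_eq]

/-! ### Seminormal families of vectors in a module -/

section Intertwining

open Finsupp

variable {ι : Type} {w : ι → ℂ} {q : ℂ} {n : ℕ} {M : Type*} [AddCommGroup M] [Module ℂ M]
  {T : ℕ → Module.End ℂ M} {S : Set (ℕ → ι × ℕ × ℕ)} {m : (ℕ → ι × ℕ × ℕ) → M}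

/-- Sets of sequences that are closed under the exchange of consecutive letters whenever the result
is standard. -/
def SwapClosed (n : ℕ) (S : Set (ℕ → ι × ℕ × ℕ)) : Prop :=
  ∀ f ∈ S, ∀ i, i + 1 < n → ¬ CellLE (f i) (f (i + 1)) → f ∘ Equiv.swap i (i + 1) ∈ S

theorem SwapClosed.union {S' : Set (ℕ → ι × ℕ × ℕ)} (h : SwapClosed n S) (h' : SwapClosed n S') :
    SwapClosed n (S ∪ S') := fun f hf i hi hle =>
  hf.imp (fun hf => h f hf i hi hle) (fun hf => h' f hf i hi hle)

theorem swapClosed_tableaux [DecidableEq ι] [Inhabited ι] (L : Finset (ι × ℕ × ℕ)) :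
    SwapClosed n (tableaux n L) := fun _ hf _ hi hle => swap_mem_tableaux hf hi hle

/-- The vectors `m f` (`f ∈ S`) transform like the vectors of the seminormal form. -/
structure Intertwines (n : ℕ) (w : ι → ℂ) (q : ℂ) (T : ℕ → Module.End ℂ M)
    (S : Set (ℕ → ι × ℕ × ℕ)) (m : (ℕ → ι × ℕ × ℕ) → M) : Prop where
  zero : 0 < n → ∀ f ∈ S, T 0 (m f) = w (f 0).1 • m f
  succ : ∀ i, i + 1 < n → ∀ f ∈ S, T (i + 1) (m f) = cellDiag w q (f i) (f (i + 1)) • m f +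
    cellOff w q (f i) (f (i + 1)) • m (f ∘ Equiv.swap i (i + 1))

theorem SwapClosed.seminormal_mem (hS : SwapClosed n S) {i : ℕ} (hi : i < n) :
    ∀ x ∈ Finsupp.supported ℂ ℂ S, seminormal w q i x ∈ Finsupp.supported ℂ ℂ S := by
  intro x hx
  rw [Finsupp.supported_eq_span_single] at hx
  refine (Submodule.span_le (p := (Finsupp.supported ℂ ℂ S).comap (seminormal w q i))).2 ?_ hx
  rintro _ ⟨f, hf, rfl⟩
  change seminormal w q i (single f 1) ∈ Finsupp.supported ℂ ℂ S
  have h1 := Finsupp.single_mem_supported ℂ (1 : ℂ) hf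
  rcases i with _ | i
  · rw [seminormal_zero_single]
    exact Submodule.smul_mem _ _ h1
  · rw [seminormal_succ_single]
    exact Submodule.add_mem _ (Submodule.smul_mem _ _ h1)
      (cellOff_smul_mem fun hle => Finsupp.single_mem_supported ℂ (1 : ℂ) (hS f hf i hi hle))

theorem Intertwines.linearCombination_seminormal (hm : Intertwines n w q T S m) {i : ℕ} (hi : i < n) :
    ∀ x ∈ Finsupp.supported ℂ ℂ S, Finsupp.linearCombination ℂ m (seminormal w q i x) =
      T i (Finsupp.linearCombination ℂ m x) := by
  intro x hx
  rw [Finsupp.supported_eq_span_single] at hx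
  refine LinearMap.eqOn_span (f := Finsupp.linearCombination ℂ m ∘ₗ seminormal w q i)
    (g := T i ∘ₗ Finsupp.linearCombination ℂ m) ?_ hx
  rintro _ ⟨f, hf, rfl⟩
  simp only [LinearMap.comp_apply]
  rcases i with _ | i
  · rw [seminormal_zero_single, map_smul]
    simp [hm.zero hi f hf]
  · rw [seminormal_succ_single, map_add, map_smul, map_smul]
    simp [hm.succ i hi f hf]

theorem Intertwines.ker_stable (hm : Intertwines n w q T S m) (hS : SwapClosed n S) :
    ∀ i < n, ∀ x ∈ Finsupp.supported ℂ ℂ S ⊓ LinearMap.ker (Finsupp.linearCombination ℂ m),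
      seminormal w q i x ∈ Finsupp.supported ℂ ℂ S ⊓ LinearMap.ker (Finsupp.linearCombination ℂ m) := by
  intro i hi x hx
  refine ⟨hS.seminormal_mem hi x hx.1, ?_⟩
  have := hx.2
  rw [SetLike.mem_coe, LinearMap.mem_ker] at this ⊢
  rw [hm.linearCombination_seminormal hi x hx.1, this, map_zero]

variable [DecidableEq ι] [Inhabited ι]

theorem tableaux_ext {f g : ℕ → ι × ℕ × ℕ} {L L' : Finset (ι × ℕ × ℕ)} (hf : f ∈ tableaux n L)
    (hg : g ∈ tableaux n L') (H : ∀ k < n, f k = g k) : f = g := by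
  ext1 k
  by_cases hk : k < n
  · exact H k hk
  · rw [hf.2.2 k (by omega), hg.2.2 k (by omega)]

theorem IsMatrixUnit.apply_supported {f g : ℕ → ι × ℕ × ℕ}
    {E : Module.End ℂ ((ℕ → ι × ℕ × ℕ) →₀ ℂ)} (hE : IsMatrixUnit n f g E)
    {L : Finset (ι × ℕ × ℕ)} (hf : f ∈ tableaux n L) (hg : g ∈ tableaux n L)
    (hS : ∀ h ∈ S, h ∈ tableaux n (shape n h)) :
    ∀ x ∈ Finsupp.supported ℂ ℂ S, E x = x f • single g (1 : ℂ) := by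
  intro x hx
  rw [Finsupp.supported_eq_span_single] at hx
  refine LinearMap.eqOn_span (f := E) (g := (Finsupp.lapply f).smulRight (single g (1 : ℂ))) ?_ hx
  rintro _ ⟨h, hh, rfl⟩
  have hh := hS h hh
  rw [LinearMap.smulRight_apply, Finsupp.lapply_apply]
  change E (single h 1) = _
  by_cases H : ∀ k < n, h k = f k
  · obtain rfl := tableaux_ext hh hf H
    rw [hE.apply_pos hh.1 H, single_eq_same, one_smul]
    congr 1
    ext1 k
    by_cases hk : k < n
    · rw [splice_of_lt hk]
    · rw [splice_of_le (by omega), hh.2.2 k (by omega), hg.2.2 k (by omega)]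
  · rw [hE h hh.1, if_neg H, single_eq_of_ne, zero_smul]
    rintro rfl
    exact H fun _ _ => rfl

theorem mem_tableaux_shape {L : Finset (ι × ℕ × ℕ)} {h : ℕ → ι × ℕ × ℕ} (hh : h ∈ tableaux n L) :
    h ∈ tableaux n (shape n h) := ⟨hh.1, rfl, hh.2.2⟩

variable [Fintype ι]

/-- A matrix unit from `f` to `g` turns `x` into a nonzero multiple of the vector of `g`, without
leaving the stable subspace. -/
theorem single_mem_of_stable (hG : GenericParameters n w q) {L : Finset (ι × ℕ × ℕ)}
    {U : Submodule ℂ ((ℕ → ι × ℕ × ℕ) →₀ ℂ)} (hU : ∀ i < n, ∀ x ∈ U, seminormal w q i x ∈ U)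
    (hS : ∀ h ∈ S, h ∈ tableaux n (shape n h)) {x : (ℕ → ι × ℕ × ℕ) →₀ ℂ} (hx : x ∈ U)
    (hxS : x ∈ Finsupp.supported ℂ ℂ S) {f g : ℕ → ι × ℕ × ℕ} (hf : f ∈ tableaux n L)
    (hg : g ∈ tableaux n L) (hxf : x f ≠ 0) : single g (1 : ℂ) ∈ U := by
  obtain ⟨E, hE, hE'⟩ := hasMatrixUnits hG f g hf.1 hg.1 (hf.2.1.trans hg.2.1.symm)
  have := apply_mem_of_mem_seminormalAlgebra hU hE x hx
  rw [hE'.apply_supported hf hg hS x hxS] at this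
  have := U.smul_mem (x f)⁻¹ this
  rwa [inv_smul_smul₀ hxf] at this

/-- The seminormal form is irreducible. -/
theorem single_mem_of_ne_zero (hG : GenericParameters n w q) {L : Finset (ι × ℕ × ℕ)}
    {U : Submodule ℂ ((ℕ → ι × ℕ × ℕ) →₀ ℂ)} (hU : ∀ i < n, ∀ x ∈ U, seminormal w q i x ∈ U)
    {x : (ℕ → ι × ℕ × ℕ) →₀ ℂ} (hx : x ∈ U) (hxS : x ∈ Finsupp.supported ℂ ℂ (tableaux n L))
    (hx0 : x ≠ 0) {g : ℕ → ι × ℕ × ℕ} (hg : g ∈ tableaux n L) : single g (1 : ℂ) ∈ U := by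
  obtain ⟨f, hf⟩ := Finsupp.ne_iff.1 hx0
  refine single_mem_of_stable hG hU (fun h hh => mem_tableaux_shape hh) hx hxS (f := f) ?_ hg hf
  exact hxS (Finsupp.mem_support_iff.2 hf)

/-- The linear relations form a stable subspace; if one were nontrivial, irreducibility would put
the vector of `f` among them. -/
theorem Intertwines.linearIndependent (hG : GenericParameters n w q) {L : Finset (ι × ℕ × ℕ)}
    (hm : Intertwines n w q T (tableaux n L) m) {f : ℕ → ι × ℕ × ℕ} (hf : f ∈ tableaux n L)
    (hmf : m f ≠ 0) : LinearIndepOn ℂ m (tableaux n L) := by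
  rw [linearIndepOn_iff]
  intro x hx hx0
  by_contra hne
  have := single_mem_of_ne_zero hG (hm.ker_stable (swapClosed_tableaux L))
    ⟨hx, LinearMap.mem_ker.2 hx0⟩ hx hne hf
  have := LinearMap.mem_ker.1 this.2
  rw [Finsupp.linearCombination_single, one_smul] at this
  exact hmf this

/-- Seminormal forms of different shapes have nothing in common. -/
theorem Intertwines.shape_eq (hG : GenericParameters n w q) {L L' : Finset (ι × ℕ × ℕ)}
    {m' : (ℕ → ι × ℕ × ℕ) → M} (hm : Intertwines n w q T (tableaux n L) m)
    (hm' : Intertwines n w q T (tableaux n L') m') {f : ℕ → ι × ℕ × ℕ} (hf : f ∈ tableaux n L)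
    (hmf : m f ≠ 0) (hspan : m f ∈ Submodule.span ℂ (m' '' tableaux n L')) : L = L' := by
  classical
  by_contra hne
  have hdisj : ∀ g ∈ tableaux n L', g ∉ tableaux n L := fun g h h' => hne (h'.2.1.symm.trans h.2.1)
  -- Different shapes have disjoint sets of tableaux, so the two families combine into one.
  set m'' : (ℕ → ι × ℕ × ℕ) → M := fun g => if g ∈ tableaux n L then m g else m' g with hm''def
  have e1 : ∀ g ∈ tableaux n L, m'' g = m g := fun g hg => if_pos hg
  have e2 : ∀ g ∈ tableaux n L', m'' g = m' g := fun g hg => if_neg (hdisj g hg)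
  have hS := (swapClosed_tableaux (n := n) L).union (swapClosed_tableaux L')
  have hsw : ∀ {a b : M} {g : ℕ → ι × ℕ × ℕ} {i : ℕ}, (¬ CellLE (g i) (g (i + 1)) → a = b) →
      cellOff w q (g i) (g (i + 1)) • a = cellOff w q (g i) (g (i + 1)) • b := by
    intro a b g i H
    by_cases hle : CellLE (g i) (g (i + 1))
    · rw [cellOff, if_pos hle, zero_smul, zero_smul]
    · rw [H hle]
  have hm'' : Intertwines n w q T (tableaux n L ∪ tableaux n L') m'' := by
    refine ⟨fun hn g hg => ?_, fun i hi g hg => ?_⟩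
    · rcases hg with hg | hg
      · rw [e1 g hg, hm.zero hn g hg]
      · rw [e2 g hg, hm'.zero hn g hg]
    · rcases hg with hg | hg
      · rw [e1 g hg, hm.succ i hi g hg, hsw fun hle => (e1 _ (swap_mem_tableaux hg hi hle)).symm]
      · rw [e2 g hg, hm'.succ i hi g hg, hsw fun hle => (e2 _ (swap_mem_tableaux hg hi hle)).symm]
  obtain ⟨y, hy, hy'⟩ := (Finsupp.mem_span_image_iff_linearCombination ℂ).1 hspan
  have hyf : y f = 0 := by
    by_contra h
    exact hdisj f (hy (Finsupp.mem_support_iff.2 h)) hf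
  have hy'' : Finsupp.linearCombination ℂ m'' y = m f := by
    rw [← hy', Finsupp.linearCombination_apply, Finsupp.linearCombination_apply]
    exact Finsupp.sum_congr fun g hg => by rw [e2 g (hy hg)]
  -- This relation between the combined vectors has coefficient `1` at `f`, so the matrix unit at
  -- `f` isolates the relation `m f = 0`.
  have h1 : single f (1 : ℂ) - y ∈ Finsupp.supported ℂ ℂ (tableaux n L ∪ tableaux n L') :=
    Submodule.sub_mem _ (Finsupp.single_mem_supported ℂ 1 (Or.inl hf))
      (Finsupp.supported_mono Set.subset_union_right hy)
  have h2 : single f (1 : ℂ) - y ∈ LinearMap.ker (Finsupp.linearCombination ℂ m'') := by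
    rw [LinearMap.mem_ker, map_sub, hy'', Finsupp.linearCombination_single, one_smul, e1 f hf,
      sub_self]
  have h3 := single_mem_of_stable hG (hm''.ker_stable hS) (fun h hh => hh.elim
    (fun hh => mem_tableaux_shape hh) (fun hh => mem_tableaux_shape hh)) ⟨h1, h2⟩ h1 hf hf (by simp [hyf])
  have := LinearMap.mem_ker.1 h3.2
  rw [Finsupp.linearCombination_single, one_smul, e1 f hf] at this
  exact hmf this

end Intertwining

/-- By rank and nullity the second projection is injective on `N`, which is therefore the graph of a
map. -/
theorem eq_zero_of_finrank_le {V V' : Type*} [AddCommGroup V] [Module ℂ V] [AddCommGroup V']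
    [Module ℂ V'] {N : Submodule ℂ (V × V')} [FiniteDimensional ℂ N]
    (h : Module.finrank ℂ N ≤ Module.finrank ℂ (N.map (LinearMap.snd ℂ V V'))) {y : V × V'}
    (hy : y ∈ N) (hy2 : y.2 = 0) : y.1 = 0 := by
  let π := (LinearMap.snd ℂ V V').domRestrict N
  have hr : LinearMap.range π = N.map (LinearMap.snd ℂ V V') := LinearMap.range_domRestrict _ _
  have h5 := LinearMap.finrank_range_add_finrank_ker π
  rw [hr] at h5
  have h7 : LinearMap.ker π = ⊥ := Submodule.finrank_eq_zero.1 (by omega)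
  have h8 : (⟨y, hy⟩ : N) ∈ LinearMap.ker π := LinearMap.mem_ker.2 hy2
  rw [h7, Submodule.mem_bot] at h8
  exact congrArg (fun z : N => z.1.1) h8

/-! ### Extending seminormal families by one level -/

section Decomposition

open Finsupp

variable {ι : Type} {w : ι → ℂ} {q : ℂ} {n : ℕ} {M : Type*} [AddCommGroup M] [Module ℂ M]
  {T : ℕ → Module.End ℂ M} [DecidableEq ι] [Inhabited ι] [Fintype ι]

/-- The sum of the vectors of all extensions of a sequence by a cell addable to `L`. -/
noncomputable def extensionSum (n : ℕ) (L : Finset (ι × ℕ × ℕ)) (f : ℕ → ι × ℕ × ℕ) :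
    (ℕ → ι × ℕ × ℕ) →₀ ℂ :=
  ∑ x ∈ addable L, single (Function.update f n x) (1 : ℂ)

omit [Inhabited ι] in
theorem seminormal_zero_extensionSum (hn : 0 < n) (L : Finset (ι × ℕ × ℕ)) (f : ℕ → ι × ℕ × ℕ) :
    seminormal w q 0 (extensionSum n L f) = w (f 0).1 • extensionSum n L f := by
  rw [extensionSum, map_sum, Finset.smul_sum]
  refine Finset.sum_congr rfl fun x _ => ?_
  rw [seminormal_zero_single, update_lt f x 0 hn]

omit [Inhabited ι] in
theorem seminormal_succ_extensionSum {i : ℕ} (hi : i + 1 < n) (L : Finset (ι × ℕ × ℕ))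
    (f : ℕ → ι × ℕ × ℕ) : seminormal w q (i + 1) (extensionSum n L f) =
      cellDiag w q (f i) (f (i + 1)) • extensionSum n L f +
        cellOff w q (f i) (f (i + 1)) • extensionSum n L (f ∘ Equiv.swap i (i + 1)) := by
  rw [extensionSum, extensionSum, map_sum, Finset.smul_sum, Finset.smul_sum,
    ← Finset.sum_add_distrib]
  refine Finset.sum_congr rfl fun x _ => ?_
  rw [seminormal_succ_single, update_lt f x i (by omega), update_lt f x (i + 1) hi]
  congr 3
  ext1 k
  rw [Function.comp_apply]
  by_cases hk : k = n
  · subst hk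
    rw [Equiv.swap_apply_of_ne_of_ne (by omega) (by omega), Function.update_self,
      Function.update_self]
  · rw [Function.update_of_ne hk, Function.comp_apply, Function.update_of_ne]
    rw [Equiv.swap_apply_def]
    split_ifs <;> omega

/-- A submodule containing one extension sum contains all vectors whose shape is the extended one. -/
theorem single_mem_of_extensionSum_mem (hG : GenericParameters (n + 1) w q)
    {L : Finset (ι × ℕ × ℕ)} {U : Submodule ℂ ((ℕ → ι × ℕ × ℕ) →₀ ℂ)}
    (hU : ∀ i < n + 1, ∀ x ∈ U, seminormal w q i x ∈ U) {f : ℕ → ι × ℕ × ℕ} (hf : f ∈ tableaux n L)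
    (hfU : extensionSum n L f ∈ U) {x : ι × ℕ × ℕ} (hx : x ∈ addable L) {g : ℕ → ι × ℕ × ℕ}
    (hg : g ∈ tableaux (n + 1) (insert x L)) : single g (1 : ℂ) ∈ U := by
  have hup : ∀ y ∈ addable L, Function.update f n y ∈ tableaux (n + 1) (insert y L) := fun y hy =>
    update_mem_tableaux hf (mem_addable.1 hy).1 (mem_addable.1 hy).2
  refine single_mem_of_stable hG hU (S := {h | h ∈ tableaux (n + 1) (shape (n + 1) h)})
    (fun h hh => hh) hfU ?_ (hup x hx) hg ?_
  · exact Submodule.sum_mem _ fun y hy => Finsupp.single_mem_supported ℂ 1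
      (mem_tableaux_shape (hup y hy))
  · rw [extensionSum, Finsupp.finsetSum_apply, Finset.sum_eq_single x]
    · simp
    · intro y _ hyx
      refine single_eq_of_ne fun h => hyx ?_
      have := congrFun h n
      simpa using this.symm
    · exact fun h => absurd hx h

/-- This replaces the decomposition of the induced module. The pairs of `m f` with the extension sum
of `f` generate a submodule `N` of the product of `M` with the seminormal space. Its second
projection contains all forms of shape `L` plus a cell, whose dimension is the largest possible for
`N`. So `N` is the graph of a homomorphism, and `φ` consists of the images of the basis vectors. -/
theorem Intertwines.exists_extension (hG : GenericParameters (n + 1) w q)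
    (h : HeckeFamily (n + 1) w q T) {L : Finset (ι × ℕ × ℕ)} {m : (ℕ → ι × ℕ × ℕ) → M}
    (hm : Intertwines n w q T (tableaux n L) m) (hne : (tableaux n L).Nonempty) :
    ∃ φ : (ℕ → ι × ℕ × ℕ) → M,
      (∀ x ∈ addable L, Intertwines (n + 1) w q T (tableaux (n + 1) (insert x L)) φ) ∧
        ∀ f ∈ tableaux n L, m f = ∑ x ∈ addable L, φ (Function.update f n x) := by
  classical
  obtain ⟨f₀, hf₀⟩ := hne
  let κ := {f // f ∈ (finite_tableaux n L).toFinset}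
  have hκ : ∀ j : κ, j.1 ∈ tableaux n L := fun j => (Set.Finite.mem_toFinset _).1 j.2
  let g : κ → M × ((ℕ → ι × ℕ × ℕ) →₀ ℂ) := fun f => (m f, extensionSum n L f.1)
  have hup : ∀ f ∈ tableaux n L, ∀ y ∈ addable L,
      Function.update f n y ∈ tableaux (n + 1) (insert y L) := fun f hf y hy =>
    update_mem_tableaux hf (mem_addable.1 hy).1 (mem_addable.1 hy).2
  obtain ⟨N, h1, h2, h3, h4⟩ := (h.heckeOn.prod (heckeOn_seminormal hG)).exists_stable hG.q_ne g
    (fun j => ⟨trivial, Submodule.sum_mem _ fun y hy => single_mem_stdSpan (hup _ (hκ j) y hy).1⟩) (by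
      intro i hi j
      rcases i with _ | i
      · have : ((T 0).prodMap (seminormal w q 0)) (g j) = w (j.1 0).1 • g j :=
          Prod.ext (hm.zero hi _ (hκ j)) (seminormal_zero_extensionSum (q := q) hi L j.1)
        rw [this]
        exact Submodule.smul_mem _ _ (Submodule.subset_span ⟨j, rfl⟩)
      · have : ((T (i + 1)).prodMap (seminormal w q (i + 1))) (g j) =
            cellDiag w q (j.1 i) (j.1 (i + 1)) • g j + cellOff w q (j.1 i) (j.1 (i + 1)) •
              (m (j.1 ∘ Equiv.swap i (i + 1)), extensionSum n L (j.1 ∘ Equiv.swap i (i + 1))) :=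
          Prod.ext (hm.succ i hi _ (hκ j)) (seminormal_succ_extensionSum hi L _)
        rw [this]
        refine Submodule.add_mem _ (Submodule.smul_mem _ _ (Submodule.subset_span ⟨j, rfl⟩)) ?_
        by_cases hle : CellLE (j.1 i) (j.1 (i + 1))
        · rw [cellOff, if_pos hle, zero_smul]
          exact Submodule.zero_mem _
        · exact Submodule.smul_mem _ _ (Submodule.subset_span
            ⟨⟨_, (Set.Finite.mem_toFinset _).2 (swap_mem_tableaux (hκ j) hi hle)⟩, rfl⟩))
  have hgN : ∀ f ∈ tableaux n L, (m f, extensionSum n L f) ∈ N := fun f hf =>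
    h1 ⟨f, (Set.Finite.mem_toFinset _).2 hf⟩
  set U := N.map (LinearMap.snd ℂ M ((ℕ → ι × ℕ × ℕ) →₀ ℂ)) with hUdef
  have hU : ∀ i < n + 1, ∀ x ∈ U, seminormal w q i x ∈ U := by
    rintro i hi _ ⟨x, hx, rfl⟩
    exact ⟨_, h2 i hi x hx, rfl⟩
  have hsingle : ∀ x ∈ addable L, ∀ f ∈ tableaux (n + 1) (insert x L), single f (1 : ℂ) ∈ U :=
    fun x hx f hf => single_mem_of_extensionSum_mem hG hU hf₀ ⟨_, hgN f₀ hf₀, rfl⟩ hx hf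
  have hinj : ∀ y ∈ N, y.2 = 0 → y.1 = 0 := by
    -- All tableaux of the shapes with one more cell. Their number equals the bound for the
    -- dimension of `N`, and their vectors are independent in its second projection.
    let s := (addable L).biUnion fun x => (finite_tableaux (n + 1) (insert x L)).toFinset
    have hs : s.card = Fintype.card ι * (n + 1) * tableauCount n L := by
      rw [← sum_tableauCount_addable (hf₀.2.1 ▸ hf₀.1.isDiagram) (hf₀.2.1 ▸ hf₀.1.card_shape),
        Finset.card_biUnion]
      · rfl
      · intro x hx y hy hxy
        rw [Function.onFun, Finset.disjoint_left]
        intro f hf hf'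
        rw [Set.Finite.mem_toFinset] at hf hf'
        have := hf.2.1.symm.trans hf'.2.1
        have hx' : x ∈ insert y L := this ▸ Finset.mem_insert_self x L
        exact (mem_addable.1 hx).1 (Finset.mem_of_mem_insert_of_ne hx' hxy)
    have hsU : ∀ f ∈ s, single f (1 : ℂ) ∈ U := by
      intro f hf
      obtain ⟨x, hx, hf⟩ := Finset.mem_biUnion.1 hf
      exact hsingle x hx f ((Set.Finite.mem_toFinset _).1 hf)
    have hfin : FiniteDimensional ℂ U := inferInstance
    have hcard : s.card ≤ Module.finrank ℂ U := by
      have hli : LinearIndependent ℂ (fun f : s => (⟨single f.1 (1 : ℂ), hsU f.1 f.2⟩ : U)) := by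
        refine LinearIndependent.of_comp U.subtype ?_
        exact (Finsupp.linearIndependent_single_one ℂ (ℕ → ι × ℕ × ℕ)).comp (fun f : s => f.1)
          Subtype.val_injective
      simpa using hli.fintype_card_le_finrank
    have hκc : Fintype.card κ = tableauCount n L := Fintype.card_coe _
    rw [hκc, ← hs] at h4
    exact fun y hy => eq_zero_of_finrank_le (h4.trans hcard) hy
  have huniq : ∀ {x y : M} {z : (ℕ → ι × ℕ × ℕ) →₀ ℂ}, (x, z) ∈ N → (y, z) ∈ N → x = y :=
    fun {x y z} hx hy => sub_eq_zero.1 (hinj _ (N.sub_mem hx hy) (sub_self z))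
  let φ : (ℕ → ι × ℕ × ℕ) → M := fun f =>
    if h : ∃ x, (x, single f (1 : ℂ)) ∈ N then h.choose else 0
  have hφ : ∀ x ∈ addable L, ∀ f ∈ tableaux (n + 1) (insert x L), (φ f, single f (1 : ℂ)) ∈ N := by
    intro x hx f hf
    obtain ⟨⟨y, z⟩, hy, rfl : z = _⟩ := hsingle x hx f hf
    have hex : ∃ x, (x, single f (1 : ℂ)) ∈ N := ⟨y, hy⟩
    change (dite _ _ _, _) ∈ N
    rw [dif_pos hex]
    exact hex.choose_spec
  refine ⟨φ, fun x hx => ⟨fun hn f hf => ?_, fun i hi f hf => ?_⟩, fun f hf => ?_⟩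
  · have e1 := h2 0 hn _ (hφ x hx f hf)
    have e2 := N.smul_mem (w (f 0).1) (hφ x hx f hf)
    rw [LinearMap.prodMap_apply, seminormal_zero_single] at e1
    exact huniq e1 e2
  · have e1 := h2 (i + 1) hi _ (hφ x hx f hf)
    have e2 := N.smul_mem (cellDiag w q (f i) (f (i + 1))) (hφ x hx f hf)
    have e3 : cellOff w q (f i) (f (i + 1)) •
        (φ (f ∘ Equiv.swap i (i + 1)), single (f ∘ Equiv.swap i (i + 1)) (1 : ℂ)) ∈ N := by
      by_cases hle : CellLE (f i) (f (i + 1))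
      · rw [cellOff, if_pos hle, zero_smul]
        exact N.zero_mem
      · exact N.smul_mem _ (hφ x hx _ (swap_mem_tableaux hf hi hle))
    rw [LinearMap.prodMap_apply, seminormal_succ_single] at e1
    exact huniq e1 (N.add_mem e2 e3)
  · refine huniq (hgN f hf) ?_
    have : (∑ x ∈ addable L, φ (Function.update f n x), extensionSum n L f) =
        ∑ x ∈ addable L, (φ (Function.update f n x), single (Function.update f n x) (1 : ℂ)) :=
      Prod.ext (by rw [Prod.fst_sum]) (by rw [Prod.snd_sum]; rfl)
    rw [this]
    exact N.sum_mem fun x hx => hφ x hx _ (hup f hf x hx)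

/-- Every module is a sum of seminormal forms. -/
theorem HeckeFamily.span_intertwines (hG : GenericParameters n w q) (h : HeckeFamily n w q T) :
    Submodule.span ℂ {x | ∃ L m f, Intertwines n w q T (tableaux n L) m ∧ f ∈ tableaux n L ∧
      m f = x} = ⊤ := by
  induction n with
  | zero =>
    -- At level `0` there are no operators, so every vector is a seminormal family for the empty
    -- shape.
    refine eq_top_iff.2 fun x _ => Submodule.subset_span
      ⟨∅, fun _ => x, fun _ => default, ⟨fun hn => absurd hn (lt_irrefl 0), fun i hi => by omega⟩, ?_,
        rfl⟩
    exact ⟨⟨by simp, by simp⟩, by simp [shape], fun _ _ => rfl⟩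
  | succ n ih =>
    rw [eq_top_iff, ← ih (hG.mono (Nat.le_succ n)) (h.mono (Nat.le_succ n)), Submodule.span_le]
    rintro _ ⟨L, m, f, hm, hf, rfl⟩
    obtain ⟨φ, h1, h2⟩ := hm.exists_extension hG h ⟨f, hf⟩
    rw [SetLike.mem_coe, h2 f hf]
    refine Submodule.sum_mem _ fun x hx => Submodule.subset_span ⟨_, φ, _, h1 x hx, ?_, rfl⟩
    exact update_mem_tableaux hf (mem_addable.1 hx).1 (mem_addable.1 hx).2

end Decomposition

/-! ### Modules over the cyclotomic Hecke algebra -/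

section HeckeModules

universe v

variable {n r : ℕ} {u : Fin r → ℂ} {q : ℂ}

theorem CycHecke.induction_gen {P : CycHecke n u q → Prop}
    (gen : ∀ i : Fin n, P (CycHecke.gen n u q i)) (scalar : ∀ c : ℂ, P (algebraMap ℂ _ c))
    (add : ∀ a b, P a → P b → P (a + b)) (mul : ∀ a b, P a → P b → P (a * b)) (a) : P a := by
  have ha : a ∈ Algebra.adjoin ℂ (Set.range (CycHecke.gen n u q)) := by
    rw [CycHecke.adjoin_gen]; trivial
  induction ha using Algebra.adjoin_induction with
  | mem x hx =>
    obtain ⟨i, rfl⟩ := hx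
    exact gen i
  | algebraMap c => exact scalar c
  | add x y _ _ hx hy => exact add x y hx hy
  | mul x y _ _ hx hy => exact mul x y hx hy

theorem CycHecke.smul_mem {M : Type*} [AddCommGroup M] [Module ℂ M] [Module (CycHecke n u q) M]
    [IsScalarTower ℂ (CycHecke n u q) M] {U : Submodule ℂ M}
    (hU : ∀ i : Fin n, ∀ x ∈ U, CycHecke.gen n u q i • x ∈ U) (a : CycHecke n u q) :
    ∀ x ∈ U, a • x ∈ U := by
  induction a using CycHecke.induction_gen with
  | gen i => exact hU i
  | scalar c =>
    intro x hx
    rw [algebraMap_smul]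
    exact U.smul_mem c hx
  | add a b ha hb =>
    intro x hx
    rw [add_smul]
    exact U.add_mem (ha x hx) (hb x hx)
  | mul a b ha hb =>
    intro x hx
    rw [mul_smul]
    exact ha _ (hb x hx)

/-- The generators as operators on a module, extended by `0`. -/
noncomputable def CycHecke.act (n : ℕ) {r : ℕ} (u : Fin r → ℂ) (q : ℂ) (M : Type*) [AddCommGroup M]
    [Module ℂ M] [Module (CycHecke n u q) M] [IsScalarTower ℂ (CycHecke n u q) M] (i : ℕ) :
    Module.End ℂ M :=
  Algebra.lsmul ℂ ℂ M (CycHecke.genNat n u q i)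

theorem CycHecke.act_val {M : Type*} [AddCommGroup M] [Module ℂ M] [Module (CycHecke n u q) M]
    [IsScalarTower ℂ (CycHecke n u q) M] (i : Fin n) (x : M) :
    CycHecke.act n u q M i x = CycHecke.gen n u q i • x := by
  rw [← CycHecke.genNat_val]
  rfl

variable {ι : Type*} [Fintype ι] {w : ι → ℂ}
  (huw : ∏ k, (Polynomial.X - Polynomial.C (u k)) = ∏ x, (Polynomial.X - Polynomial.C (w x)))

include huw

theorem CycHecke.heckeFamily_act {M : Type*} [AddCommGroup M] [Module ℂ M]
    [Module (CycHecke n u q) M] [IsScalarTower ℂ (CycHecke n u q) M] :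
    HeckeFamily n w q (CycHecke.act n u q M) :=
  (CycHecke.heckeFamily_genNat n u q w huw).map (Algebra.lsmul ℂ ℂ M)

theorem HeckeOn.exists_module {V : Type*} [AddCommGroup V] [Module ℂ V] {T : ℕ → Module.End ℂ V}
    {p : Submodule ℂ V} (h : HeckeOn n w q T p) :
    ∃ (_ : Module (CycHecke n u q) p) (_ : IsScalarTower ℂ (CycHecke n u q) p),
      ∀ (i : Fin n) (x : p), ((CycHecke.gen n u q i • x : p) : V) = T i x := by
  obtain ⟨ρ, hρ⟩ := h.heckeFamily.exists_algHom huw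
  let _ : Module (CycHecke n u q) p := Module.compHom p ρ.toRingHom
  have hsmul : ∀ (a : CycHecke n u q) (x : p), a • x = ρ a x := fun _ _ => rfl
  refine ⟨inferInstance, ⟨fun c a x => ?_⟩, fun i x => ?_⟩
  · rw [hsmul, hsmul, map_smul, LinearMap.smul_apply]
  · rw [hsmul, hρ, h.coe_restrictFamily i.2]

/-- A submodule over the algebra gives a subspace stable under the operators, so `hirr` becomes
simplicity. The set `S` and the map `e` also serve the case without parameters. -/
theorem HeckeOn.exists_simple_module {V : Type v} {X : Type*} [AddCommGroup V] [Module ℂ V]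
    {T : ℕ → Module.End ℂ V} {p : Submodule ℂ V} (h : HeckeOn n w q T p) {S : Set X} {e : X → V}
    (hne : S.Nonempty) (hspan : p = Submodule.span ℂ (e '' S)) (hli : LinearIndepOn ℂ e S)
    (hirr : ∀ U ≤ p, (∀ i < n, ∀ x ∈ U, T i x ∈ U) → U ≠ ⊥ → ∀ f ∈ S, e f ∈ U) :
    ∃ (P : Type v) (_ : AddCommGroup P) (_ : Module ℂ P) (_ : Module (CycHecke n u q) P)
      (_ : IsScalarTower ℂ (CycHecke n u q) P), IsSimpleModule (CycHecke n u q) P ∧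
        ∃ (m : X → P) (j : P →ₗ[ℂ] V), Function.Injective j ∧ (∀ f ∈ S, j (m f) = e f) ∧
          LinearIndepOn ℂ m S ∧ Submodule.span ℂ (m '' S) = ⊤ ∧
            ∀ (i : Fin n) (x : P), j (CycHecke.act n u q P i x) = T i (j x) := by
  classical
  obtain ⟨_, _, hact⟩ := h.exists_module huw
  have hp : ∀ f ∈ S, e f ∈ p := fun f hf => hspan ▸ Submodule.subset_span ⟨f, hf, rfl⟩
  let m : X → p := fun f => if hf : f ∈ S then ⟨e f, hp f hf⟩ else 0
  have hm : ∀ f ∈ S, (m f : V) = e f := fun f hf => by simp only [m, dif_pos hf]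
  have him : p.subtype '' (m '' S) = e '' S := by
    rw [← Set.image_comp]
    exact Set.image_congr hm
  refine ⟨p, inferInstance, inferInstance, inferInstance, inferInstance, ?_, m, p.subtype,
    p.injective_subtype, hm, ?_, ?_, fun i x => ?_⟩
  · have hnt : Nontrivial (Submodule (CycHecke n u q) p) := by
      obtain ⟨f, hf⟩ := hne
      refine (Submodule.nontrivial_iff _).2 ⟨⟨m f, 0, fun h0 => hli.ne_zero hf ?_⟩⟩
      rw [← hm f hf, h0, Submodule.coe_zero]
    refine (isSimpleModule_iff _ _).2 ⟨fun K => or_iff_not_imp_left.2 fun hK => ?_⟩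
    obtain ⟨x, hx, hx0⟩ := Submodule.exists_mem_ne_zero_of_ne_bot hK
    have h1 := hirr ((K.restrictScalars ℂ).map p.subtype) (Submodule.map_subtype_le _ _) (by
      rintro i hi _ ⟨y, hy, rfl⟩
      exact ⟨CycHecke.gen n u q ⟨i, hi⟩ • y, K.smul_mem _ hy, hact ⟨i, hi⟩ y⟩) (by
      intro h0
      have : (x : V) ∈ (K.restrictScalars ℂ).map p.subtype := ⟨x, hx, rfl⟩
      rw [h0, Submodule.mem_bot] at this
      exact hx0 (Subtype.ext this))
    have h2 : p ≤ (K.restrictScalars ℂ).map p.subtype := by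
      conv_lhs => rw [hspan]
      rw [Submodule.span_le]
      rintro _ ⟨f, hf, rfl⟩
      exact h1 f hf
    refine eq_top_iff.2 fun y _ => ?_
    obtain ⟨z, hz, hzy⟩ := h2 y.2
    rw [← Subtype.ext hzy]
    exact hz
  · refine LinearIndepOn.of_comp p.subtype ?_
    exact hli.congr fun f hf => (hm f hf).symm
  · refine eq_top_iff.2 fun y _ => ?_
    have : (y : V) ∈ Submodule.span ℂ (e '' S) := hspan ▸ y.2
    rw [← him, ← Submodule.map_span] at this
    obtain ⟨z, hz, hzy⟩ := this
    rwa [← Subtype.ext hzy]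
  · rw [CycHecke.act_val]
    exact hact i x

end HeckeModules

/-! ### Simple modules and their seminormal bases -/

section SimpleModules

open Finsupp

variable {n r : ℕ} {u : Fin r → ℂ} {q : ℂ} {ι : Type} [Fintype ι] [DecidableEq ι] [Inhabited ι]
  {w : ι → ℂ}
  (huw : ∏ k, (Polynomial.X - Polynomial.C (u k)) = ∏ x, (Polynomial.X - Polynomial.C (w x)))
  (hG : GenericParameters n w q)

/-- The vectors `m f`, for `f` a standard sequence with set of members `L`, are a basis and transform
like the vectors of the seminormal form. -/
def IsSeminormalBasis (w : ι → ℂ) {M : Type*} [AddCommGroup M] [Module ℂ M]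
    [Module (CycHecke n u q) M] [IsScalarTower ℂ (CycHecke n u q) M] (L : Finset (ι × ℕ × ℕ))
    (m : (ℕ → ι × ℕ × ℕ) → M) : Prop :=
  Intertwines n w q (CycHecke.act n u q M) (tableaux n L) m ∧ LinearIndepOn ℂ m (tableaux n L) ∧
    Submodule.span ℂ (m '' tableaux n L) = ⊤

include huw hG

theorem exists_seminormal_module {L : Finset (ι × ℕ × ℕ)} (hL : IsDiagram L) (hn : L.card = n) :
    ∃ (V : Type) (_ : AddCommGroup V) (_ : Module ℂ V) (_ : Module (CycHecke n u q) V)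
      (_ : IsScalarTower ℂ (CycHecke n u q) V), IsSimpleModule (CycHecke n u q) V ∧
        ∃ m : (ℕ → ι × ℕ × ℕ) → V, IsSeminormalBasis (n := n) (u := u) (q := q) w L m := by
  have hS := swapClosed_tableaux (n := n) L
  have hon : HeckeOn n w q (seminormal w q) (Finsupp.supported ℂ ℂ (tableaux n L)) :=
    (heckeOn_seminormal hG).of_le (Finsupp.supported_mono fun f hf => hf.1)
      fun i hi => hS.seminormal_mem hi
  obtain ⟨P, _, _, _, _, h1, m, j, hj, h2, h3, h4, h5⟩ := hon.exists_simple_module huw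
    (e := fun f => single f (1 : ℂ)) (tableaux_nonempty hL hn)
    (Finsupp.supported_eq_span_single ℂ _)
    ((Finsupp.linearIndependent_single_one ℂ (ℕ → ι × ℕ × ℕ)).linearIndepOn _) (by
      intro U hUp hU hU0 f hf
      obtain ⟨x, hx, hx0⟩ := Submodule.exists_mem_ne_zero_of_ne_bot hU0
      exact single_mem_of_ne_zero hG hU hx (hUp hx) hx0 hf)
  refine ⟨P, inferInstance, inferInstance, inferInstance, inferInstance, h1, m,
    ⟨fun h0 f hf => ?_, fun i hi f hf => ?_⟩, h3, h4⟩
  · refine hj ((h5 ⟨0, h0⟩ _).trans ?_)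
    rw [map_smul, h2 f hf]
    exact seminormal_zero_single f
  · refine hj ((h5 ⟨i + 1, hi⟩ _).trans ?_)
    rw [map_add, map_smul, map_smul, h2 f hf]
    refine (seminormal_succ_single i f).trans ?_
    congr 1
    by_cases hle : CellLE (f i) (f (i + 1))
    · rw [cellOff, if_pos hle, zero_smul, zero_smul]
    · rw [h2 _ (hS f hf i hi hle)]

/-- A simple module is nonzero and spanned by vectors of seminormal families, so it contains a
nonzero one; the span of that family is a submodule, hence everything. -/
theorem exists_isSeminormalBasis {M : Type*} [AddCommGroup M] [Module ℂ M]
    [Module (CycHecke n u q) M] [IsScalarTower ℂ (CycHecke n u q) M]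
    (hM : IsSimpleModule (CycHecke n u q) M) : ∃ (L : Finset (ι × ℕ × ℕ)), IsDiagram L ∧
      L.card = n ∧ ∃ m : (ℕ → ι × ℕ × ℕ) → M, IsSeminormalBasis (n := n) (u := u) (q := q) w L m := by
  have hspan := (CycHecke.heckeFamily_act (n := n) (q := q) (M := M) huw).span_intertwines hG
  have hnt := IsSimpleModule.nontrivial (CycHecke n u q) M
  obtain ⟨L, m, f, hm, hf, hmf⟩ : ∃ L m f, Intertwines n w q (CycHecke.act n u q M) (tableaux n L) m ∧
      f ∈ tableaux n L ∧ m f ≠ 0 := by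
    by_contra! H
    refine bot_ne_top (α := Submodule ℂ M) (le_antisymm bot_le ?_)
    rw [← hspan, Submodule.span_le]
    rintro _ ⟨L, m, f, hm, hf, rfl⟩
    exact H L m f hm hf
  refine ⟨L, hf.2.1 ▸ hf.1.isDiagram, hf.2.1 ▸ hf.1.card_shape, m, hm,
    hm.linearIndependent hG hf hmf, ?_⟩
  have hstable : ∀ i : Fin n, ∀ x ∈ Submodule.span ℂ (m '' tableaux n L),
      CycHecke.gen n u q i • x ∈ Submodule.span ℂ (m '' tableaux n L) := by
    intro i x hx
    obtain ⟨y, hy, rfl⟩ := (Finsupp.mem_span_image_iff_linearCombination ℂ).1 hx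
    rw [← CycHecke.act_val, ← hm.linearCombination_seminormal i.2 y hy]
    exact (Finsupp.mem_span_image_iff_linearCombination ℂ).2
      ⟨_, (swapClosed_tableaux L).seminormal_mem i.2 y hy, rfl⟩
  let K : Submodule (CycHecke n u q) M :=
    { (Submodule.span ℂ (m '' tableaux n L)).toAddSubmonoid with
      smul_mem' := fun a x hx => CycHecke.smul_mem hstable a x hx }
  have hK : m f ∈ K := Submodule.subset_span (s := m '' tableaux n L) ⟨f, hf, rfl⟩
  have hK' : K = ⊤ := (eq_bot_or_eq_top K).resolve_left fun h0 => by
    rw [h0, Submodule.mem_bot] at hK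
    exact hmf hK
  refine eq_top_iff.2 fun x _ => ?_
  have hx : x ∈ K := hK' ▸ Submodule.mem_top
  exact hx

omit huw in
theorem IsSeminormalBasis.shape_eq {M : Type*} [AddCommGroup M] [Module ℂ M]
    [Module (CycHecke n u q) M] [IsScalarTower ℂ (CycHecke n u q) M] {L L' : Finset (ι × ℕ × ℕ)}
    {m m' : (ℕ → ι × ℕ × ℕ) → M} (hm : IsSeminormalBasis (n := n) (u := u) (q := q) w L m)
    (hm' : IsSeminormalBasis (n := n) (u := u) (q := q) w L' m') (hL : IsDiagram L) (hn : L.card = n) :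
    L = L' := by
  obtain ⟨f, hf⟩ := tableaux_nonempty hL hn
  exact hm.1.shape_eq hG hm'.1 hf (hm.2.1.ne_zero hf) (hm'.2.2 ▸ Submodule.mem_top)

end SimpleModules

/-! ### Standard tableaux as sequences of cells -/

section Translation

variable {ι : Type} [Fintype ι] [DecidableEq ι] {n : ℕ}

/-- The cells of a family of Young diagrams. -/
def cellSet (lam : ι → YoungDiagram) : Finset (ι × ℕ × ℕ) :=
  (Finset.univ.sigma fun x => (lam x).cells).map (Equiv.sigmaEquivProd ι (ℕ × ℕ)).toEmbedding

omit [DecidableEq ι] in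
theorem mem_cellSet {lam : ι → YoungDiagram} {c : ι × ℕ × ℕ} : c ∈ cellSet lam ↔ c.2 ∈ lam c.1 := by
  rw [cellSet, Finset.mem_map_equiv, Finset.mem_sigma]
  exact and_iff_right (Finset.mem_univ _)

omit [DecidableEq ι] in
theorem card_cellSet (lam : ι → YoungDiagram) : (cellSet lam).card = ∑ x, (lam x).card := by
  rw [cellSet, Finset.card_map, Finset.card_sigma]

omit [DecidableEq ι] in
theorem isDiagram_cellSet (lam : ι → YoungDiagram) : IsDiagram (cellSet lam) := by
  rintro ⟨i, x⟩ ⟨j, y⟩ ⟨h1, h2⟩ hy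
  obtain rfl : i = j := h1
  rw [mem_cellSet] at hy ⊢
  exact (lam i).isLowerSet h2 hy

omit [DecidableEq ι] in
theorem cellSet_injective : Function.Injective (cellSet (ι := ι)) := by
  intro lam mu h
  ext1 x
  refine SetLike.ext fun c => ?_
  have := Finset.ext_iff.1 h (x, c)
  rwa [mem_cellSet, mem_cellSet] at this

theorem IsDiagram.exists_cellSet {L : Finset (ι × ℕ × ℕ)} (hL : IsDiagram L) :
    ∃ lam : ι → YoungDiagram, cellSet lam = L := by
  refine ⟨fun x => ⟨(L.filter fun c => c.1 = x).image Prod.snd, ?_⟩, ?_⟩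
  · intro a b hba ha
    simp only [Finset.coe_image, Finset.coe_filter, Set.mem_image, Set.mem_ofPred_eq] at ha ⊢
    obtain ⟨c, ⟨hc, rfl⟩, rfl⟩ := ha
    exact ⟨(c.1, b), ⟨hL _ c ⟨rfl, hba⟩ hc, rfl⟩, rfl⟩
  · ext ⟨i, c⟩
    rw [mem_cellSet]
    change c ∈ (L.filter fun c => c.1 = i).image Prod.snd ↔ _
    simp only [Finset.mem_image, Finset.mem_filter, Prod.exists, exists_eq_right]

variable [Inhabited ι] {lam : ι → YoungDiagram}

omit [Fintype ι] [DecidableEq ι] in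
/-- The sequence of the cells of a tableau, continued by a fixed cell. -/
def cellSeq (t : Fin n ≃ MultiCell lam) (k : ℕ) : ι × ℕ × ℕ :=
  if h : k < n then (t ⟨k, h⟩).1 else default

omit [Fintype ι] [DecidableEq ι] in
theorem cellSeq_of_lt (t : Fin n ≃ MultiCell lam) {k : ℕ} (h : k < n) :
    cellSeq t k = (t ⟨k, h⟩).1 := dif_pos h

omit [Fintype ι] [DecidableEq ι] in
theorem cellSeq_val (t : Fin n ≃ MultiCell lam) (i : Fin n) : cellSeq t i = (t i).1 := dif_pos i.2

omit [Fintype ι] [DecidableEq ι] in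
theorem stdSeq_cellSeq_iff {t : Fin n ≃ MultiCell lam} : StdSeq n (cellSeq t) ↔ IsStandard t := by
  constructor
  · intro h a b h1 h2
    refine h.le_of_cellLE a a.2 b b.2 ?_
    rw [cellSeq_val, cellSeq_val]
    exact ⟨h1, h2⟩
  · refine fun h => ⟨fun a ha b hb hab => ?_, fun b hb x hx => ?_⟩
    · rw [cellSeq_of_lt t ha, cellSeq_of_lt t hb] at hab
      exact h ⟨a, ha⟩ ⟨b, hb⟩ hab.1 hab.2
    · rw [cellSeq_of_lt t hb] at hx
      have hx' : x.2 ∈ lam x.1 := by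
        rw [hx.1]
        exact (lam _).isLowerSet hx.2 (t ⟨b, hb⟩).2
      refine ⟨t.symm ⟨x, hx'⟩, (t.symm ⟨x, hx'⟩).2, ?_⟩
      rw [cellSeq_val, Equiv.apply_symm_apply]

theorem shape_cellSeq (t : Fin n ≃ MultiCell lam) : shape n (cellSeq t) = cellSet lam := by
  ext x
  rw [mem_shape, mem_cellSet]
  constructor
  · rintro ⟨a, ha, rfl⟩
    rw [cellSeq_of_lt t ha]
    exact (t ⟨a, ha⟩).2
  · intro hx
    refine ⟨t.symm ⟨x, hx⟩, (t.symm ⟨x, hx⟩).2, ?_⟩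
    rw [cellSeq_val, Equiv.apply_symm_apply]

theorem cellSeq_mem_tableaux (t : StdTableau lam n) : cellSeq t.1 ∈ tableaux n (cellSet lam) :=
  ⟨stdSeq_cellSeq_iff.2 t.2, shape_cellSeq t.1, fun _ hk => dif_neg (by omega)⟩

theorem exists_cellSeq_eq {f : ℕ → ι × ℕ × ℕ} (hf : f ∈ tableaux n (cellSet lam)) :
    ∃ t : StdTableau lam n, cellSeq t.1 = f := by
  have hmem : ∀ k : Fin n, (f k).2 ∈ lam (f k).1 := fun k => by
    rw [← mem_cellSet, ← hf.2.1]
    exact mem_shape_of_lt k.2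
  let t : Fin n ≃ MultiCell lam := Equiv.ofBijective (fun k => ⟨f k, hmem k⟩) (by
    constructor
    · intro a b hab
      exact Fin.ext (hf.1.injOn a.2 b.2 (congrArg Subtype.val hab))
    · rintro ⟨c, hc⟩
      rw [← mem_cellSet, ← hf.2.1] at hc
      obtain ⟨a, ha, h⟩ := mem_shape.1 hc
      exact ⟨⟨a, ha⟩, Subtype.ext h⟩)
  have ht : cellSeq t = f := by
    ext1 k
    by_cases hk : k < n
    · rw [cellSeq_of_lt t hk]; rfl
    · rw [cellSeq, dif_neg hk, hf.2.2 k (by omega)]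
  exact ⟨⟨t, stdSeq_cellSeq_iff.1 (ht ▸ hf.1)⟩, ht⟩

omit [Fintype ι] [DecidableEq ι] in
theorem cellSeq_injective : Function.Injective (cellSeq (lam := lam) (n := n)) := by
  intro t t' h
  refine Equiv.ext fun i => Subtype.ext ?_
  rw [← cellSeq_val, ← cellSeq_val, h]

/-- Standard tableaux correspond to standard sequences. -/
noncomputable def tableauEquiv (lam : ι → YoungDiagram) (n : ℕ) :
    StdTableau lam n ≃ tableaux n (cellSet lam) :=
  Equiv.ofBijective (fun t => ⟨cellSeq t.1, cellSeq_mem_tableaux t⟩) (by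
    constructor
    · intro t t' h
      exact Subtype.ext (cellSeq_injective (congrArg Subtype.val h))
    · rintro ⟨f, hf⟩
      obtain ⟨t, ht⟩ := exists_cellSeq_eq hf
      exact ⟨t, Subtype.ext ht⟩)

omit [Fintype ι] [DecidableEq ι] in
theorem cellSeq_swap (t : Fin n ≃ MultiCell lam) {j i : Fin n} (h : j.val + 1 = i.val) :
    cellSeq ((Equiv.swap j i).trans t) = cellSeq t ∘ Equiv.swap j.val (j.val + 1) := by
  ext1 k
  by_cases hk : k < n
  · have : Equiv.swap j.val (j.val + 1) k = (Equiv.swap j i ⟨k, hk⟩).val := by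
      simp only [Equiv.swap_apply_def, h, Fin.ext_iff]
      split_ifs <;> rfl
    rw [Function.comp_apply, this, cellSeq_val, cellSeq_of_lt _ hk]
    rfl
  · have h2 := i.2
    rw [Function.comp_apply, Equiv.swap_apply_of_ne_of_ne (by omega) (by omega), cellSeq, cellSeq,
      dif_neg hk, dif_neg hk]

omit [Fintype ι] [DecidableEq ι] in
theorem isStandard_swap_iff (t : StdTableau lam n) {j i : Fin n} (h : j.val + 1 = i.val) :
    IsStandard ((Equiv.swap j i).trans t.1) ↔ ¬ CellLE (t.1 j).1 (t.1 i).1 := by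
  constructor
  · intro hs hle
    have := hs i j (by simpa using hle.1) (by simpa using hle.2)
    rw [Fin.le_def] at this
    omega
  · intro hle
    rw [← stdSeq_cellSeq_iff, cellSeq_swap t.1 h]
    refine (stdSeq_cellSeq_iff.2 t.2).swap (by omega) ?_
    rwa [h, cellSeq_val, cellSeq_val]

theorem diagCoeff_eq_cellDiag {ι : Type} (w : ι → ℂ) (q : ℂ) {lam : ι → YoungDiagram}
    (x y : MultiCell lam) : diagCoeff w q x y = cellDiag w q x.1 y.1 := rfl

omit [Fintype ι] [DecidableEq ι] in
open Classical in
theorem cellOff_smul_eq {w : ι → ℂ} {q : ℂ} {M : Type*} [AddCommGroup M] [Module ℂ M]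
    {m : (ℕ → ι × ℕ × ℕ) → M} {b : StdTableau lam n → M} (hmb : ∀ t, b t = m (cellSeq t.1))
    (t : StdTableau lam n) {j i : Fin n} (hji : j.val + 1 = i.val) :
    (diagCoeff w q (t.1 j) (t.1 i) + q) • (if h : IsStandard ((Equiv.swap j i).trans t.1)
      then b ⟨(Equiv.swap j i).trans t.1, h⟩ else 0) =
    cellOff w q (cellSeq t.1 j) (cellSeq t.1 (j + 1)) •
      m (cellSeq t.1 ∘ Equiv.swap j.val (j.val + 1)) := by
  rw [hji, cellSeq_val, cellSeq_val]
  by_cases hle : CellLE (t.1 j).1 (t.1 i).1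
  · rw [dif_neg (fun h => (isStandard_swap_iff t hji).1 h hle), cellOff, if_pos hle, smul_zero,
      zero_smul]
  · rw [dif_pos ((isStandard_swap_iff t hji).2 hle), cellOff, if_neg hle, hmb, cellSeq_swap t.1 hji,
      hji, diagCoeff_eq_cellDiag]

/-- Bases indexed by tableaux and bases given on standard sequences correspond under `tableauEquiv`.
A nonstandard exchange is expressed by a zero vector in one formulation and by a zero coefficient in
the other. -/
theorem isYoungModule_iff {r : ℕ} {u : Fin r → ℂ} {q : ℂ} {w : ι → ℂ} {M : Type*} [AddCommGroup M]
    [Module ℂ M] [Module (CycHecke n u q) M] [IsScalarTower ℂ (CycHecke n u q) M] :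
    IsYoungModule (n := n) (u := u) (q := q) w lam M ↔
      ∃ m, IsSeminormalBasis (n := n) (u := u) (q := q) w (M := M) (cellSet lam) m := by
  classical
  constructor
  · rintro ⟨b, h1, h2⟩
    let m : (ℕ → ι × ℕ × ℕ) → M := fun f =>
      if hf : f ∈ tableaux n (cellSet lam) then b ((tableauEquiv lam n).symm ⟨f, hf⟩) else 0
    have hm : ∀ t : StdTableau lam n, b t = m (cellSeq t.1) := fun t => by
      simp only [m, dif_pos (cellSeq_mem_tableaux t)]
      congr 1
      exact ((tableauEquiv lam n).symm_apply_apply t).symm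
    have hm' : (fun f : tableaux n (cellSet lam) => m f) = b ∘ (tableauEquiv lam n).symm := by
      ext1 f
      simp only [m, dif_pos f.2, Function.comp_apply]
    refine ⟨m, ⟨fun h0 f hf => ?_, fun i hi f hf => ?_⟩, ?_, ?_⟩
    · obtain ⟨t, rfl⟩ := exists_cellSeq_eq hf
      have := h1 t ⟨0, h0⟩ rfl
      rw [← CycHecke.act_val, hm, ← cellSeq_val] at this
      exact this
    · obtain ⟨t, rfl⟩ := exists_cellSeq_eq hf
      have := h2 t ⟨i, by omega⟩ ⟨i + 1, hi⟩ rfl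
      rw [← CycHecke.act_val, cellOff_smul_eq hm t rfl, diagCoeff_eq_cellDiag, ← cellSeq_val,
        ← cellSeq_val, hm] at this
      exact this
    · change LinearIndependent ℂ fun f : tableaux n (cellSet lam) => m f
      rw [hm']
      exact b.linearIndependent.comp _ (Equiv.injective _)
    · rw [Set.image_eq_range, hm', Set.range_comp, Equiv.range_eq_univ, Set.image_univ, b.span_eq]
  · rintro ⟨m, h1, h2, h3⟩
    let b : Module.Basis (StdTableau lam n) ℂ M :=
      (Module.Basis.mk (v := fun f : tableaux n (cellSet lam) => m f) h2 (by
        rw [← Set.image_eq_range, h3])).reindex (tableauEquiv lam n).symm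
    have hm : ∀ t : StdTableau lam n, b t = m (cellSeq t.1) := fun t => by
      rw [Module.Basis.reindex_apply, Equiv.symm_symm]
      exact Module.Basis.mk_apply _ _ _
    refine ⟨b, fun t i hi => ?_, fun t j i hji => ?_⟩
    · have := h1.zero (by omega) _ (cellSeq_mem_tableaux t)
      rw [← hi, cellSeq_val, ← hm, CycHecke.act_val] at this
      exact this
    · have := h1.succ j (by omega) _ (cellSeq_mem_tableaux t)
      rw [cellOff_smul_eq hm t hji, ← CycHecke.act_val, diagCoeff_eq_cellDiag, hm, ← cellSeq_val,
        ← cellSeq_val, ← hji]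
      exact this

end Translation

/-! ### Twisting -/

section Twist

theorem CycHecke.smul_intertwines {n r : ℕ} {u : Fin r → ℂ} {q : ℂ} {M N : Type*} [AddCommGroup M]
    [Module ℂ M] [Module (CycHecke n u q) M] [IsScalarTower ℂ (CycHecke n u q) M] [AddCommGroup N]
    [Module ℂ N] [Module (CycHecke n u q) N] [IsScalarTower ℂ (CycHecke n u q) N]
    (σ : CycHecke n u q ≃ₐ[ℂ] CycHecke n u q) (Φ : N →ₗ[ℂ] M)
    (H : ∀ (i : Fin n) (x : N), Φ (σ.symm (CycHecke.gen n u q i) • x) = CycHecke.gen n u q i • Φ x)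
    (a : CycHecke n u q) : ∀ x, Φ (σ.symm a • x) = a • Φ x := by
  induction a using CycHecke.induction_gen with
  | gen i => exact H i
  | scalar c =>
    intro x
    rw [AlgEquiv.commutes, algebraMap_smul, algebraMap_smul, map_smul]
  | add a b ha hb =>
    intro x
    rw [map_add, add_smul, map_add, ha, hb, add_smul]
  | mul a b ha hb =>
    intro x
    rw [map_mul, mul_smul, ha, hb, mul_smul]

theorem CycHecke.tau_symm_gen {n r p d : ℕ} [NeZero p] {u : Fin r → ℂ} {v : Fin d → ℂ} {q ξ : ℂ}
    (hξ : IsPrimitiveRoot ξ p)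
    (huv : ∏ k : Fin r, (Polynomial.X - Polynomial.C (u k)) =
      ∏ l : Fin d, (Polynomial.X ^ p - Polynomial.C (v l ^ p))) (i : Fin n) :
    (CycHecke.tau n u v q ξ hξ huv).symm (CycHecke.gen n u q i) =
      if i.val = 0 then ξ⁻¹ • CycHecke.gen n u q i else CycHecke.gen n u q i := by
  rw [AlgEquiv.symm_apply_eq]
  split_ifs with h
  · rw [map_smul, CycHecke.tau_gen, if_pos h, inv_smul_smul₀ (hξ.ne_zero (NeZero.ne p))]
  · rw [CycHecke.tau_gen, if_neg h]

variable {p d n : ℕ} [NeZero p]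

/-- The cells of a shifted family of diagrams are the cells of the original family. -/
def cellShift (lam : MultiPartition (ZMod p × Fin d) n) : MultiCell (shift lam).1 ≃ MultiCell lam.1 :=
  Equiv.subtypeEquiv
    ((((Equiv.addRight (1 : ZMod p)).prodCongr (Equiv.refl (Fin d)))).prodCongr (Equiv.refl (ℕ × ℕ)))
    fun _ => Iff.rfl

theorem cellShift_fst (lam : MultiPartition (ZMod p × Fin d) n) (c : MultiCell (shift lam).1) :
    (cellShift lam c).1.1 = (c.1.1.1 + 1, c.1.1.2) := rfl

theorem cellShift_snd (lam : MultiPartition (ZMod p × Fin d) n) (c : MultiCell (shift lam).1) :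
    (cellShift lam c).1.2 = c.1.2 := rfl

theorem cellShift_fst_eq_iff (lam : MultiPartition (ZMod p × Fin d) n)
    (c c' : MultiCell (shift lam).1) :
    (cellShift lam c).1.1 = (cellShift lam c').1.1 ↔ c.1.1 = c'.1.1 := by
  rw [cellShift_fst, cellShift_fst, Prod.ext_iff, Prod.ext_iff, add_left_inj]

theorem isStandard_cellShift_iff (lam : MultiPartition (ZMod p × Fin d) n)
    (t : Fin n ≃ MultiCell (shift lam).1) : IsStandard (t.trans (cellShift lam)) ↔ IsStandard t := by
  simp only [IsStandard, Equiv.trans_apply, cellShift_fst_eq_iff, cellShift_snd]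

/-- Standard tableaux of a shifted shape are the standard tableaux of the original shape. -/
def tableauShift (lam : MultiPartition (ZMod p × Fin d) n) :
    StdTableau (shift lam).1 n ≃ StdTableau lam.1 n :=
  Equiv.subtypeEquiv (Equiv.equivCongr (Equiv.refl (Fin n)) (cellShift lam))
    fun t => (isStandard_cellShift_iff lam t).symm

theorem coe_tableauShift (lam : MultiPartition (ZMod p × Fin d) n) (t : StdTableau (shift lam).1 n) :
    (tableauShift lam t).1 = t.1.trans (cellShift lam) := rfl

/-- A common factor of the parameters cancels in the quotient, and within one diagram no parameter
occurs. -/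
theorem diagCoeff_cellShift (lam : MultiPartition (ZMod p × Fin d) n) {w : ZMod p × Fin d → ℂ} {q ζ : ℂ}
    (hζ : ζ ≠ 0) (hw : ∀ i j, w (i + 1, j) = ζ * w (i, j)) (c c' : MultiCell (shift lam).1) :
    diagCoeff w q (cellShift lam c) (cellShift lam c') = diagCoeff w q c c' := by
  unfold diagCoeff
  by_cases h : c.1.1 = c'.1.1
  · rw [if_pos h, if_pos ((cellShift_fst_eq_iff lam c c').2 h)]
    rfl
  · rw [if_neg h, if_neg (fun h' => h ((cellShift_fst_eq_iff lam c c').1 h')), cellShift_fst,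
      cellShift_fst, hw, hw]
    change (1 - q) * (ζ * w c'.1.1 * q ^ (-cellContent c')) /
      (ζ * w c'.1.1 * q ^ (-cellContent c') - ζ * w c.1.1 * q ^ (-cellContent c)) = _
    rw [mul_assoc ζ, mul_assoc ζ, ← mul_sub, mul_left_comm, mul_div_mul_left _ _ hζ]

/-- Twisting the module of a shifted shape gives the module of the original shape. -/
theorem nonempty_twistedModule_equiv {r : ℕ} {u : Fin r → ℂ} {v : Fin d → ℂ} {q ξ : ℂ}
    (hξ : IsPrimitiveRoot ξ p)
    (huv : ∏ k : Fin r, (Polynomial.X - Polynomial.C (u k)) =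
      ∏ l : Fin d, (Polynomial.X ^ p - Polynomial.C (v l ^ p)))
    {w : ZMod p × Fin d → ℂ} (hw : ∀ i j, w (i + 1, j) = ξ⁻¹ * w (i, j))
    (lam : MultiPartition (ZMod p × Fin d) n)
    {M : Type*} [AddCommGroup M] [Module ℂ M] [Module (CycHecke n u q) M]
    [IsScalarTower ℂ (CycHecke n u q) M]
    {N : Type*} [AddCommGroup N] [Module ℂ N] [Module (CycHecke n u q) N]
    [IsScalarTower ℂ (CycHecke n u q) N]
    (hM : IsYoungModule (n := n) (u := u) (q := q) w lam.1 M)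
    (hN : IsYoungModule (n := n) (u := u) (q := q) w (shift lam).1 N) :
    Nonempty (TwistedModule (CycHecke.tau n u v q ξ hξ huv) N ≃ₗ[CycHecke n u q] M) := by
  classical
  obtain ⟨b, hb1, hb2⟩ := hM
  obtain ⟨b', hb1', hb2'⟩ := hN
  have hξ0 := hξ.ne_zero (NeZero.ne p)
  let Φ : N ≃ₗ[ℂ] M := b'.equiv b (tableauShift lam)
  have hΦ : ∀ t, Φ (b' t) = b (tableauShift lam t) := fun t => b'.equiv_apply _ _ _
  have key : ∀ (i : Fin n) (x : N), Φ ((CycHecke.tau n u v q ξ hξ huv).symm (CycHecke.gen n u q i) • x) =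
      CycHecke.gen n u q i • Φ x := by
    intro i x
    have : Φ.toLinearMap ∘ₗ Algebra.lsmul ℂ ℂ N
        ((CycHecke.tau n u v q ξ hξ huv).symm (CycHecke.gen n u q i)) =
          Algebra.lsmul ℂ ℂ M (CycHecke.gen n u q i) ∘ₗ Φ.toLinearMap := by
      refine b'.ext fun t => ?_
      simp only [LinearMap.comp_apply, Algebra.lsmul_coe, LinearEquiv.coe_coe]
      rw [CycHecke.tau_symm_gen, hΦ]
      by_cases hi : i.val = 0
      -- Here the direction of the shift matters: `τ⁻¹` multiplies `T₁` by `ξ⁻¹`, and passing from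
      -- the index `i` in the shifted family to `i + 1` in the original one multiplies the parameter
      -- by `ξ⁻¹` as well.
      · rw [if_pos hi, smul_assoc, hb1' t i hi, map_smul, map_smul, hΦ, hb1 _ i hi, smul_smul,
          coe_tableauShift, Equiv.trans_apply, cellShift_fst, hw]
      · rw [if_neg hi]
        have hji : (⟨i.val - 1, by omega⟩ : Fin n).val + 1 = i.val := by simp only; omega
        generalize (⟨i.val - 1, by omega⟩ : Fin n) = j at hji
        rw [hb2' t j i hji, hb2 _ j i hji, map_add, map_smul, map_smul, hΦ]
        rw [coe_tableauShift, Equiv.trans_apply, Equiv.trans_apply,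
          diagCoeff_cellShift lam (inv_ne_zero hξ0) hw]
        congr 2
        have hiff := isStandard_cellShift_iff lam ((Equiv.swap j i).trans t.1)
        rw [Equiv.trans_assoc] at hiff
        by_cases hs : IsStandard ((Equiv.swap j i).trans t.1)
        · rw [dif_pos hs, dif_pos (hiff.2 hs), hΦ]
          rfl
        · rw [dif_neg hs, dif_neg (fun h => hs (hiff.1 h)), map_zero]
    exact LinearMap.congr_fun this x
  exact ⟨{ toFun := Φ
           map_add' := fun x y => map_add Φ x y
           map_smul' := fun a x => CycHecke.smul_intertwines _ Φ.toLinearMap key a x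
           invFun := Φ.symm
           left_inv := fun x => Φ.symm_apply_apply x
           right_inv := fun x => Φ.apply_symm_apply x }⟩

end Twist

/-! ### Ordering the parameters -/

section Ordering

/-- Equal multisets of values mean fibres of equal size; bijections between the fibres are glued
together. -/
theorem exists_equiv_comp_eq {α β γ : Type*} [Fintype α] [Fintype β] {f : α → γ} {g : β → γ}
    (h : Finset.univ.val.map f = Finset.univ.val.map g) : ∃ e : α ≃ β, g ∘ e = f := by
  classical
  have hc : ∀ c, Nonempty ({x // f x = c} ≃ {y // g y = c}) := fun c => by
    rw [← Fintype.card_eq, Fintype.card_subtype, Fintype.card_subtype]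
    have := congrArg (Multiset.count c) h
    rw [Multiset.count_map, Multiset.count_map] at this
    simpa only [eq_comm, Finset.card, Finset.filter_val] using this
  let e : α ≃ β := (Equiv.sigmaFiberEquiv f).symm.trans
    ((Equiv.sigmaCongrRight fun c => (hc c).some).trans (Equiv.sigmaFiberEquiv g))
  exact ⟨e, funext fun x => ((hc (f x)).some ⟨x, rfl⟩).2⟩

theorem roots_prod_X_sub_C_univ {α : Type*} [Fintype α] (f : α → ℂ) :
    (∏ x, (Polynomial.X - Polynomial.C (f x))).roots = Finset.univ.val.map f := by
  rw [← Polynomial.roots_multiset_prod_X_sub_C (Finset.univ.val.map f), Multiset.map_map]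
  rfl

theorem exists_equiv_of_prod_eq {α β : Type*} [Fintype α] [Fintype β] {f : α → ℂ} {g : β → ℂ}
    (h : ∏ x, (Polynomial.X - Polynomial.C (f x)) = ∏ y, (Polynomial.X - Polynomial.C (g y))) :
    ∃ e : α ≃ β, g ∘ e = f :=
  exists_equiv_comp_eq (by rw [← roots_prod_X_sub_C_univ, h, roots_prod_X_sub_C_univ])

variable {p : ℕ} [NeZero p] {ξ : ℂ}

theorem prod_root_mul (hξ : IsPrimitiveRoot ξ p) (v : ℂ) :
    ∏ i : ZMod p, (Polynomial.X - Polynomial.C ((ξ⁻¹) ^ i.val * v)) =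
      Polynomial.X ^ p - Polynomial.C (v ^ p) := by
  rw [X_pow_sub_C_eq_prod hξ.inv (NeZero.pos p) rfl, Finset.prod_range]
  -- For a successor, `ZMod` is `Fin` by definition and the two products coincide.
  obtain ⟨p, rfl⟩ : ∃ p', p = p' + 1 := ⟨p - 1, (Nat.succ_pred (NeZero.ne p)).symm⟩
  rfl

/-- Reduction of the exponent modulo `p` is harmless, as `ξ⁻¹` has `p`th power `1`. -/
theorem pow_val_add_one (hξ : IsPrimitiveRoot ξ p) (i : ZMod p) :
    (ξ⁻¹) ^ (i + 1).val = ξ⁻¹ * (ξ⁻¹) ^ i.val := by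
  rw [← pow_succ', ZMod.val_add, ZMod.val_one_eq_one_mod, Nat.add_mod_mod]
  exact (pow_eq_pow_mod _ (hξ.inv.pow_eq_one)).symm

end Ordering

/-! ### Classification of the simple modules -/

/-! ### The case of an empty set of parameters -/

section NoParameters

variable {ι : Type} [Fintype ι] [IsEmpty ι] {r : ℕ} {u : Fin r → ℂ} {q : ℂ} {w : ι → ℂ}

omit [Fintype ι] in
theorem isYoungModule_zero_iff {lam : ι → YoungDiagram} {M : Type*} [AddCommGroup M] [Module ℂ M]
    [Module (CycHecke 0 u q) M] :
    IsYoungModule (n := 0) (u := u) (q := q) w lam M ↔ ∃ x : M, x ≠ 0 ∧ Submodule.span ℂ {x} = ⊤ := by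
  have : IsEmpty (MultiCell lam) := ⟨fun c => isEmptyElim c.1.1⟩
  let _ : Unique (StdTableau lam 0) :=
    { default := ⟨Equiv.equivOfIsEmpty _ _, fun a => a.elim0⟩
      uniq := fun t => Subtype.ext (Equiv.ext fun i => i.elim0) }
  constructor
  · rintro ⟨b, -, -⟩
    refine ⟨b default, b.ne_zero _, ?_⟩
    rw [← b.span_eq, Set.range_unique]
  · rintro ⟨x, hx, hspan⟩
    refine ⟨Module.Basis.mk (v := fun _ => x) (LinearIndependent.of_subsingleton default hx)
      (by rw [Set.range_unique, hspan]), fun _ i => i.elim0, fun _ i => i.elim0⟩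

theorem exists_simple_module_zero
    (huw : ∏ k, (Polynomial.X - Polynomial.C (u k)) = ∏ x, (Polynomial.X - Polynomial.C (w x)))
    (lam : ι → YoungDiagram) :
    ∃ (V : Type) (_ : AddCommGroup V) (_ : Module ℂ V) (_ : Module (CycHecke 0 u q) V)
      (_ : IsScalarTower ℂ (CycHecke 0 u q) V), IsSimpleModule (CycHecke 0 u q) V ∧
        IsYoungModule (n := 0) (u := u) (q := q) w lam V := by
  have h : HeckeFamily 0 w q (0 : ℕ → Module.End ℂ ℂ) :=
    ⟨fun i j _ hj => absurd hj (Nat.not_lt_zero j), fun i _ hi => absurd hi (Nat.not_lt_zero _),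
      fun h => absurd h (Nat.not_lt_zero _), fun h => absurd h (Nat.not_lt_zero _),
      fun i _ hi => absurd hi (Nat.not_lt_zero i)⟩
  obtain ⟨P, _, _, _, _, h1, m, j, hj, h2, h3, h4, h5⟩ := h.heckeOn.exists_simple_module huw
    (S := {()}) (e := fun _ => (1 : ℂ)) (Set.singleton_nonempty _)
    (by rw [Set.image_singleton, ← Ideal.span, Ideal.span_singleton_one])
    (linearIndepOn_singleton_iff ℂ |>.2 one_ne_zero) (fun U _ _ hU f _ => by
      rw [(eq_bot_or_eq_top U).resolve_left hU]
      trivial)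
  refine ⟨P, inferInstance, inferInstance, inferInstance, inferInstance, h1,
    isYoungModule_zero_iff.2 ⟨m (), h3.ne_zero rfl, ?_⟩⟩
  rwa [Set.image_singleton] at h4

omit [Fintype ι] in
theorem isYoungModule_of_isSimpleModule_zero {M : Type*} [AddCommGroup M] [Module ℂ M]
    [Module (CycHecke 0 u q) M] [IsScalarTower ℂ (CycHecke 0 u q) M]
    (hM : IsSimpleModule (CycHecke 0 u q) M) (lam : ι → YoungDiagram) :
    IsYoungModule (n := 0) (u := u) (q := q) w lam M := by
  have hnt := IsSimpleModule.nontrivial (CycHecke 0 u q) M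
  obtain ⟨x, hx⟩ := exists_ne (0 : M)
  refine isYoungModule_zero_iff.2 ⟨x, hx, ?_⟩
  let K : Submodule (CycHecke 0 u q) M :=
    { (Submodule.span ℂ {x}).toAddSubmonoid with
      smul_mem' := fun a x hx => CycHecke.smul_mem (fun i => i.elim0) a x hx }
  have hK : x ∈ K := Submodule.mem_span_singleton_self (R := ℂ) x
  have hK' : K = ⊤ := (eq_bot_or_eq_top K).resolve_left fun h0 => by
    rw [h0, Submodule.mem_bot] at hK
    exact hx hK
  refine eq_top_iff.2 fun y _ => ?_
  have hy : y ∈ K := hK' ▸ Submodule.mem_top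
  exact hy

end NoParameters

/-- The classification of the simple modules by tuples of Young diagrams. -/
theorem existsUnique_isYoungModule {ι : Type} [Fintype ι] {n r : ℕ} {u : Fin r → ℂ} {q : ℂ} {w : ι → ℂ}
    (hq : q ≠ 0)
    (huw : ∏ k, (Polynomial.X - Polynomial.C (u k)) = ∏ x, (Polynomial.X - Polynomial.C (w x)))
    (hss : IsSemisimpleRing (CycHecke n u q)) (M : Type*) [AddCommGroup M] [Module ℂ M]
    [Module (CycHecke n u q) M] [IsScalarTower ℂ (CycHecke n u q) M]
    (hM : IsSimpleModule (CycHecke n u q) M) :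
    ∃! lam : MultiPartition ι n, IsYoungModule (n := n) (u := u) (q := q) w lam.1 M := by
  classical
  rcases isEmpty_or_nonempty ι with hι | ⟨⟨x₀⟩⟩
  · rcases Nat.eq_zero_or_pos n with rfl | hn
    · exact ⟨⟨fun x => isEmptyElim x, by simp⟩, isYoungModule_of_isSimpleModule_zero hM _,
        fun mu _ => Subtype.ext (funext fun x => isEmptyElim x)⟩
    · have hnt := IsSimpleModule.nontrivial (CycHecke n u q) M
      have h0 := (CycHecke.heckeFamily_act (n := n) (q := q) (M := M) huw).cyclotomic hn
      -- Without parameters the cyclotomic relation reads `1 = 0`, which no nonzero module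
      -- satisfies.
      rw [Finset.univ_eq_empty, Finset.prod_empty, map_one] at h0
      exact absurd h0 one_ne_zero
  · have : Inhabited ι := ⟨x₀⟩
    have hG := genericParameters_of_isSemisimpleRing hq huw hss
    obtain ⟨L, hL, hn, m, hm⟩ := exists_isSeminormalBasis huw hG hM
    obtain ⟨lam, rfl⟩ := hL.exists_cellSet
    refine ⟨⟨lam, (card_cellSet lam).symm.trans hn⟩, isYoungModule_iff.2 ⟨m, hm⟩, fun mu hmu => ?_⟩
    obtain ⟨m', hm'⟩ := isYoungModule_iff.1 hmu
    exact Subtype.ext (cellSet_injective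
      (hm'.shape_eq hG hm (isDiagram_cellSet _) ((card_cellSet _).trans mu.2)))

/-- Every tuple of Young diagrams gives a simple module. -/
theorem exists_isYoungModule {ι : Type} [Fintype ι] {n r : ℕ} {u : Fin r → ℂ} {q : ℂ} {w : ι → ℂ}
    (hq : q ≠ 0)
    (huw : ∏ k, (Polynomial.X - Polynomial.C (u k)) = ∏ x, (Polynomial.X - Polynomial.C (w x)))
    (hss : IsSemisimpleRing (CycHecke n u q)) (lam : MultiPartition ι n) :
    ∃ (V : Type) (_ : AddCommGroup V) (_ : Module ℂ V) (_ : Module (CycHecke n u q) V)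
      (_ : IsScalarTower ℂ (CycHecke n u q) V), IsSimpleModule (CycHecke n u q) V ∧
        IsYoungModule (n := n) (u := u) (q := q) w lam.1 V := by
  classical
  rcases isEmpty_or_nonempty ι with hι | ⟨⟨x₀⟩⟩
  · obtain rfl : n = 0 := by rw [← lam.2]; simp
    exact exists_simple_module_zero huw lam.1
  · have : Inhabited ι := ⟨x₀⟩
    have hG := genericParameters_of_isSemisimpleRing hq huw hss
    obtain ⟨V, _, _, _, _, h1, h2⟩ := exists_seminormal_module huw hG (isDiagram_cellSet lam.1)
      ((card_cellSet _).trans lam.2)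
    exact ⟨V, inferInstance, inferInstance, inferInstance, inferInstance, h1, isYoungModule_iff.2 h2⟩

theorem mainTheorem5 (n r p d : ℕ) [NeZero p] (hr : r = p * d)
    (u : Fin r → ℂ) (v : Fin d → ℂ) (q ξ : ℂ) (hq : q ≠ 0) (hξ : IsPrimitiveRoot ξ p)
    (huv : ∏ k : Fin r, (Polynomial.X - Polynomial.C (u k)) =
      ∏ l : Fin d, (Polynomial.X ^ p - Polynomial.C (v l ^ p)))
    (hv : ∀ i j : Fin d, i ≠ j → v i ^ p ≠ v j ^ p)
    (hss : IsSemisimpleRing (CycHecke n u q)) :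
    -- an ordering of the parameters by pairs `(i, j)`, with `i` modulo `p`
    ∃ e : ZMod p × Fin d ≃ Fin r,
      (∀ (i : ZMod p) (j : Fin d), u (e (i, j)) = (ξ⁻¹) ^ i.val * v j) ∧
      -- every `V(λ)` exists and is simple
      (∀ lam : MultiPartition (ZMod p × Fin d) n,
        ∃ (V : Type) (_ : AddCommGroup V) (_ : Module ℂ V) (_ : Module (CycHecke n u q) V)
          (_ : IsScalarTower ℂ (CycHecke n u q) V),
          IsSimpleModule (CycHecke n u q) V ∧
            IsYoungModule (n := n) (u := u) (q := q) (u ∘ e) lam.1 V) ∧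
      -- every simple module is `V(λ)` for exactly one `λ`
      (∀ (M : Type*) [AddCommGroup M] [Module ℂ M] [Module (CycHecke n u q) M]
        [IsScalarTower ℂ (CycHecke n u q) M], IsSimpleModule (CycHecke n u q) M →
          ∃! lam : MultiPartition (ZMod p × Fin d) n,
            IsYoungModule (n := n) (u := u) (q := q) (u ∘ e) lam.1 M) ∧
      -- `τ ∘ shift = 1`: if `M = V(λ)` and `N = V(shift λ)`, then the twist of `N` by `τ` is `M`
      (∀ (lam : MultiPartition (ZMod p × Fin d) n)
        (M : Type*) [AddCommGroup M] [Module ℂ M] [Module (CycHecke n u q) M]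
        [IsScalarTower ℂ (CycHecke n u q) M]
        (N : Type*) [AddCommGroup N] [Module ℂ N] [Module (CycHecke n u q) N]
        [IsScalarTower ℂ (CycHecke n u q) N],
        IsYoungModule (n := n) (u := u) (q := q) (u ∘ e) lam.1 M →
        IsYoungModule (n := n) (u := u) (q := q) (u ∘ e) (shift lam).1 N →
          Nonempty (TwistedModule (CycHecke.tau n u v q ξ hξ huv) N ≃ₗ[CycHecke n u q] M)) := by
  -- The parameters labelled `(i, j)` are the roots `ξ⁻ⁱ v_j`, with the representative of `i`
  -- between `0` and `p - 1` as exponent.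
  have hprod : ∏ k : Fin r, (Polynomial.X - Polynomial.C (u k)) =
      ∏ x : ZMod p × Fin d, (Polynomial.X - Polynomial.C ((ξ⁻¹) ^ x.1.val * v x.2)) := by
    rw [huv, Fintype.prod_prod_type_right]
    exact Finset.prod_congr rfl fun j _ => (prod_root_mul hξ (v j)).symm
  obtain ⟨e, he⟩ := exists_equiv_of_prod_eq hprod.symm
  refine ⟨e, fun i j => congrFun he (i, j), ?_⟩
  rw [he]
  refine ⟨fun lam => exists_isYoungModule hq hprod hss lam, fun M _ _ _ _ hM =>
    existsUnique_isYoungModule hq hprod hss M hM, fun lam M _ _ _ _ N _ _ _ _ hM hN =>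
    nonempty_twistedModule_equiv hξ huv (fun i j => ?_) lam hM hN⟩
  rw [pow_val_add_one hξ, mul_assoc]
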